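/- Let $\mathcal K_1 = L^2([0,2\pi],dk/2\pi)$, and let $P$ be the operator $Pf=-if'$ on $\mathcal K_1$ with domain $D(P)=\{f\in AC[0,2\pi] : f'\in\mathcal K_1,\ f(0)=f(2\pi)\}$. For a compact interval $I=[a,b]$ let $P_I$ be the operator $P_If=-if'$ on $L^2(I,dE)$ with domain $D(P_I)=\{f\in AC[a,b] : f'\in L^2(I,dE),\ f(a)=f(b)=0\}$. A function in brackets, such as $\lambda(k)$, $e^{ik}$ or $e^{iE}$, also denotes the corresponding multiplication operator. The deficiency indices of a symmetric operator $A$ are $d_\pm(A)=\dim\ker(A^*\mp i)$, and $\bar A$ is the closure of $A$. Let $\lambda:\mathbb R\to\mathbb C$ be a twice continuously differentiable $2\pi$-periodic function with $|\lambda(k)|=1$ for all $k$, such that $\lambda'$ has at most finitely many zeros in $[0,2\pi)$. Let $m\in\mathbb Z$ be the winding number of $\lambda$, and let $\theta:\mathbb R\to\mathbb R$ be a continuous $2\pi$-periodic function such that $\lambda(k)=e^{ig(k)}$ for all $k\in\mathbb R$, where $g(k)=mk+\theta(k)$. Consider on $\mathcal K_1$ the operator $$T=\frac12\left(\frac1{m+\theta'(k)}P+P\frac1{m+\theta'(k)}\right)$$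 with its natural domain (the intersection of the natural domains of the two products). Then $T$ is densely defined and symmetric, and the following hold. (1) If $\lambda'$ has no zeros, then $m\neq0$ and $T$ is self-adjoint. Moreover, there exists a unitary operator $V:\mathcal K_1\to\bigoplus_{j=0}^{|m|-1}\mathcal K_1$ such that $$VTV^{-1}=\bigoplus_{j=0}^{|m|-1}\left(P+\frac j{|m|}\right),\qquad V\lambda(k)V^{-1}=\bigoplus_{j=0}^{|m|-1}e^{ik}.$$ (2) Suppose that $\lambda'$ has a zero. Let $0\le a_1<a_2<\dots<a_n<2\pi$ be the zeros of $\lambda'$ in $[0,2\pi)$, put $a_{n+1}=2\pi+a_1$ and $I_j=(a_j,a_{j+1})$ for $j=1,\dots,n$. Then each $g(\bar I_j)$ is the compact interval with endpoints $g(a_j)$ and $g(a_{j+1})$ and, with $P_j=P_I$ for $I=g(\bar I_j)$, there exists a unitary operator $V:\mathcal K_1\to\bigoplus_{j=1}^nL^2(g(\bar I_j),dE)$ such that $$V\bar TV^{-1}=\bigoplus_{j=1}^nP_j,\qquad V\lambda(k)V^{-1}=\bigoplus_{j=1}^ne^{iE}.$$ (3) In both cases the deficiency indices $d_+(T)$ and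 $d_-(T)$ are both equal to the number of zeros of $\lambda'$ in $[0,2\pi)$. In particular, $T$ has a self-adjoint extension. All equalities between operators include equality of the domains. -/

import Mathlib

open MeasureTheory Set
open scoped Real

noncomputable section

namespace TimeOp

/-! ## Unbounded operators -/

section Abstract

variable {E F : Type*} [NormedAddCommGroup E] [InnerProductSpace ℂ E]
  [NormedAddCommGroup F] [InnerProductSpace ℂ F]

/-- The product `B A` of two operators with its natural domain
`{x ∈ D(A) | A x ∈ D(B)}`. -/
def prodOp (B A : E →ₗ.[ℂ] E) : E →ₗ.[ℂ] E where
  domain :=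
    { carrier := {x | ∃ h : x ∈ A.domain, A ⟨x, h⟩ ∈ B.domain}
      add_mem' := by
        rintro x y ⟨hx, hx'⟩ ⟨hy, hy'⟩
        refine ⟨A.domain.add_mem hx hy, ?_⟩
        have := B.domain.add_mem hx' hy'
        rwa [← LinearPMap.map_add] at this
      zero_mem' := ⟨A.domain.zero_mem, by
        have : A ⟨0, A.domain.zero_mem⟩ = 0 := LinearPMap.map_zero A
        rw [this]; exact B.domain.zero_mem⟩
      smul_mem' := by
        rintro c x ⟨hx, hx'⟩
        refine ⟨A.domain.smul_mem c hx, ?_⟩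
        have := B.domain.smul_mem c hx'
        rwa [← LinearPMap.map_smul] at this }
  toFun :=
    { toFun := fun x => B ⟨A ⟨x.1, x.2.fst⟩, x.2.snd⟩
      map_add' := by
        intro x y
        rw [← LinearPMap.map_add]
        congr 1
        apply Subtype.ext
        exact LinearPMap.map_add A ⟨x.1, x.2.fst⟩ ⟨y.1, y.2.fst⟩
      map_smul' := by
        intro c x
        rw [RingHom.id_apply, ← LinearPMap.map_smul]
        congr 1
        apply Subtype.ext
        exact LinearPMap.map_smul A c ⟨x.1, x.2.fst⟩ }

/-- `V A V⁻¹` for a unitary `V`, with domain `V D(A)`. -/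
def conjOp (V : E ≃ₗᵢ[ℂ] F) (A : E →ₗ.[ℂ] E) : F →ₗ.[ℂ] F where
  domain := A.domain.comap V.symm.toLinearEquiv.toLinearMap
  toFun := V.toLinearEquiv.toLinearMap ∘ₗ A.toFun ∘ₗ
    V.symm.toLinearEquiv.toLinearMap.submoduleComap A.domain

/-- The direct sum `⨁ⱼ Aⱼ` on the Hilbert space direct sum, with domain `⨁ⱼ D(Aⱼ)`. -/
def directSumOp {ι : Type*} [Fintype ι] {H : ι → Type*} [∀ j, NormedAddCommGroup (H j)]
    [∀ j, InnerProductSpace ℂ (H j)] (A : ∀ j, H j →ₗ.[ℂ] H j) :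
    PiLp 2 H →ₗ.[ℂ] PiLp 2 H where
  domain :=
    { carrier := {x | ∀ j, x j ∈ (A j).domain}
      add_mem' := fun hx hy j => (A j).domain.add_mem (hx j) (hy j)
      zero_mem' := fun j => (A j).domain.zero_mem
      smul_mem' := fun c _ hx j => (A j).domain.smul_mem c (hx j) }
  toFun :=
    { toFun := fun x => WithLp.toLp 2 fun j => A j ⟨x.1 j, x.2 j⟩
      map_add' := by
        intro x y
        ext j
        exact LinearPMap.map_add (A j) ⟨x.1 j, x.2 j⟩ ⟨y.1 j, y.2 j⟩
      map_smul' := by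
        intro c x
        ext j
        exact LinearPMap.map_smul (A j) c ⟨x.1 j, x.2 j⟩ }

/-- `A` is densely defined and `A ⊂ A*`. -/
def IsSymmetricOp (A : E →ₗ.[ℂ] E) : Prop :=
  Dense (A.domain : Set E) ∧ A.IsFormalAdjoint A

/-- `dim ker (A* - z)`. -/
def defectNumber [CompleteSpace E] (A : E →ₗ.[ℂ] E) (z : ℂ) : Cardinal :=
  Module.rank ℂ (LinearMap.ker (A.adjoint.toFun - z • A.adjoint.domain.subtype))

/-- The deficiency index `d₊(A) = dim ker (A* - i)`. -/
def deficiencyIndexPlus [CompleteSpace E] (A : E →ₗ.[ℂ] E) : Cardinal :=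
  defectNumber A Complex.I

/-- The deficiency index `d₋(A) = dim ker (A* + i)`. -/
def deficiencyIndexMinus [CompleteSpace E] (A : E →ₗ.[ℂ] E) : Cardinal :=
  defectNumber A (-Complex.I)

end Abstract

/-! ## Multiplication operators -/

/-- The multiplication operator by `φ` on `L²(μ)`, with its natural domain
`{f ∈ L²(μ) | φ f ∈ L²(μ)}`. -/
def mulOp (μ : Measure ℝ) (φ : ℝ → ℂ) : Lp ℂ 2 μ →ₗ.[ℂ] Lp ℂ 2 μ where
  domain :=
    { carrier := {f | MemLp (fun k => φ k * f k) 2 μ}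
      add_mem' := by
        intro f g hf hg
        refine (MemLp.add hf hg).ae_eq ?_
        filter_upwards [Lp.coeFn_add f g] with k hk
        rw [hk]
        exact (mul_add _ _ _).symm
      zero_mem' := by
        refine (MemLp.zero (p := 2) (μ := μ) (ε := ℂ)).ae_eq ?_
        filter_upwards [Lp.coeFn_zero ℂ 2 μ] with k hk
        rw [hk]
        exact (mul_zero _).symm
      smul_mem' := by
        intro c f hf
        refine (MemLp.const_smul hf c).ae_eq ?_
        filter_upwards [Lp.coeFn_smul c f] with k hk
        simp [hk, mul_left_comm] }
  toFun :=
    { toFun := fun f => MemLp.toLp (fun k => φ k * f.1 k) f.2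
      map_add' := by
        intro f g
        rw [← MemLp.toLp_add]
        apply MemLp.toLp_congr
        filter_upwards [Lp.coeFn_add f.1 g.1] with k hk
        exact (congrArg (φ k * ·) hk).trans (mul_add _ _ _)
      map_smul' := by
        intro c f
        rw [RingHom.id_apply, ← MemLp.toLp_const_smul]
        apply MemLp.toLp_congr
        filter_upwards [Lp.coeFn_smul c f.1] with k hk
        simp [hk, mul_left_comm] }

/-! ## The operators `-i d/dx` on an interval -/

theorem ae_differentiableAt_of_ac {F : ℝ → ℂ} {a b : ℝ}
    (hF : AbsolutelyContinuousOnInterval F a b) :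
    ∀ᵐ x ∂(volume.restrict (uIcc a b)), DifferentiableAt ℝ F x := by
  rw [ae_restrict_iff' measurableSet_uIcc]
  exact hF.boundedVariationOn.ae_differentiableAt_of_mem_uIcc

/-- The graph of `F ↦ -i F'` on the functions `F` that are absolutely continuous on the interval
with endpoints `a`, `b`, with `F, F' ∈ L²(μ)` and boundary values `(F(a), F(b)) ∈ B`. -/
def momentumGraph (μ : Measure ℝ) (a b : ℝ) (hμ : μ ≪ volume.restrict (uIcc a b))
    (B : Submodule ℂ (ℂ × ℂ)) : Submodule ℂ (Lp ℂ 2 μ × Lp ℂ 2 μ) where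
  carrier := {p | ∃ F : ℝ → ℂ, AbsolutelyContinuousOnInterval F a b ∧ (F a, F b) ∈ B ∧
    p.1 =ᵐ[μ] F ∧ p.2 =ᵐ[μ] fun x => -Complex.I * deriv F x}
  add_mem' := by
    rintro p q ⟨F, hF, hFB, hp, hp'⟩ ⟨G, hG, hGB, hq, hq'⟩
    refine ⟨F + G, hF.add hG, B.add_mem hFB hGB, ?_, ?_⟩
    · exact (Lp.coeFn_add p.1 q.1).trans (hp.add hq)
    · filter_upwards [Lp.coeFn_add p.2 q.2, hp', hq', hμ.ae_le (ae_differentiableAt_of_ac hF),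
        hμ.ae_le (ae_differentiableAt_of_ac hG)] with x h1 h2 h3 h4 h5
      rw [Prod.snd_add, h1, Pi.add_apply, h2, h3, deriv_add h4 h5]
      ring
  zero_mem' := by
    refine ⟨fun _ => 0, ?_, B.zero_mem, Lp.coeFn_zero ℂ 2 μ, ?_⟩
    · exact contDiffOn_const.absolutelyContinuousOnInterval
    · filter_upwards [Lp.coeFn_zero ℂ 2 μ] with x hx
      simpa using hx
  smul_mem' := by
    rintro c p ⟨F, hF, hFB, hp, hp'⟩
    refine ⟨fun x => c • F x, hF.const_smul c, B.smul_mem c hFB, ?_, ?_⟩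
    · exact (Lp.coeFn_smul c p.1).trans (hp.const_smul c)
    · filter_upwards [Lp.coeFn_smul c p.2, hp', hμ.ae_le (ae_differentiableAt_of_ac hF)]
        with x h1 h2 h3
      rw [Prod.smul_snd, h1, Pi.smul_apply, h2, deriv_fun_const_smul c h3]
      simp only [smul_eq_mul]
      ring

/-- The operator `F ↦ -i F'` with graph `momentumGraph μ a b hμ B`. -/
def momentum (μ : Measure ℝ) (a b : ℝ) (hμ : μ ≪ volume.restrict (uIcc a b))
    (B : Submodule ℂ (ℂ × ℂ)) : Lp ℂ 2 μ →ₗ.[ℂ] Lp ℂ 2 μ :=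
  (momentumGraph μ a b hμ B).toLinearPMap

theorem momentumGraph_single_valued (μ : Measure ℝ) (a b : ℝ)
    (hμ : μ ≪ volume.restrict (uIcc a b)) (hμ' : volume.restrict (uIcc a b) ≪ μ)
    (B : Submodule ℂ (ℂ × ℂ)) (p : Lp ℂ 2 μ × Lp ℂ 2 μ)
    (hp : p ∈ momentumGraph μ a b hμ B) (h0 : p.1 = 0) : p.2 = 0 := by
  obtain ⟨F, hF, -, h1, h2⟩ := hp
  have hF0 : F =ᵐ[μ] 0 := by
    rw [h0] at h1
    exact h1.symm.trans (Lp.coeFn_zero ℂ 2 μ)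
  have hF1 : F =ᵐ[volume.restrict (uIoo a b)] 0 :=
    ae_restrict_of_ae_restrict_of_subset Ioo_subset_Icc_self (hμ'.ae_le hF0)
  have hF2 : EqOn F 0 (uIoo a b) :=
    Measure.eqOn_open_of_ae_eq hF1 isOpen_Ioo
      (hF.continuousOn.mono Ioo_subset_Icc_self) continuousOn_const
  have hae : ∀ᵐ x ∂(volume.restrict (uIcc a b)), x ∈ uIoo a b := by
    have : volume.restrict (uIcc a b) = volume.restrict (uIoo a b) :=
      Measure.restrict_congr_set Ioo_ae_eq_Icc.symm
    rw [this]
    exact ae_restrict_mem measurableSet_Ioo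
  apply Lp.ext
  filter_upwards [h2, Lp.coeFn_zero ℂ 2 μ, hμ.ae_le hae] with x hx hx0 hxI
  have : F =ᶠ[nhds x] fun _ => 0 :=
    Filter.eventuallyEq_of_mem (isOpen_Ioo.mem_nhds hxI) hF2
  rw [hx, hx0, this.deriv_eq]
  simp

theorem momentum_graph (μ : Measure ℝ) (a b : ℝ)
    (hμ : μ ≪ volume.restrict (uIcc a b)) (hμ' : volume.restrict (uIcc a b) ≪ μ)
    (B : Submodule ℂ (ℂ × ℂ)) :
    (momentum μ a b hμ B).graph = momentumGraph μ a b hμ B :=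
  Submodule.toLinearPMap_graph_eq _ (momentumGraph_single_valued μ a b hμ hμ' B)

/-! ## The Hilbert space `L²([0, 2π], dk/2π)` and the operator `P` -/

/-- The measure `dk/2π` on `[0, 2π]`. -/
def circleMeasure : Measure ℝ := ENNReal.ofReal (1 / (2 * π)) • volume.restrict (Icc 0 (2 * π))

theorem circleMeasure_ac : circleMeasure ≪ volume.restrict (uIcc 0 (2 * π)) := by
  rw [uIcc_of_le (by positivity)]
  exact Measure.smul_absolutelyContinuous

theorem ac_circleMeasure : volume.restrict (uIcc 0 (2 * π)) ≪ circleMeasure := by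
  rw [uIcc_of_le (by positivity)]
  apply Measure.absolutelyContinuous_smul
  rw [Ne, ENNReal.ofReal_eq_zero, not_le]
  positivity

/-- The Hilbert space `L²([0, 2π], dk/2π)`. -/
abbrev K1 : Type := Lp ℂ 2 circleMeasure

/-- `P f = -i f'` on `L²([0, 2π], dk/2π)`, with domain the `f ∈ AC[0, 2π]` with `f' ∈ L²` and
`f(0) = f(2π)`. -/
def P : K1 →ₗ.[ℂ] K1 :=
  momentum circleMeasure 0 (2 * π) circleMeasure_ac
    (LinearMap.eqLocus (LinearMap.fst ℂ ℂ ℂ) (LinearMap.snd ℂ ℂ ℂ))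

theorem mem_P_graph (f h : K1) : (f, h) ∈ P.graph ↔
    ∃ F : ℝ → ℂ, AbsolutelyContinuousOnInterval F 0 (2 * π) ∧ F 0 = F (2 * π) ∧
      f =ᵐ[circleMeasure] F ∧ h =ᵐ[circleMeasure] fun x => -Complex.I * deriv F x := by
  unfold P
  rw [momentum_graph _ _ _ _ ac_circleMeasure]
  rfl

/-- The Hilbert space `L²(I, dE)`, where `I` is the compact interval with endpoints `a`, `b`
(in either order). -/
abbrev L2Interval (a b : ℝ) : Type := Lp ℂ 2 (volume.restrict (uIcc a b))

/-- `P_I f = -i f'` on `L²(I, dE)`, where `I` is the compact interval with endpoints `a`, `b`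
(in either order), with domain the `f ∈ AC(I)` with `f' ∈ L²` and `f(a) = f(b) = 0`. -/
def PInterval (a b : ℝ) : L2Interval a b →ₗ.[ℂ] L2Interval a b :=
  momentum (volume.restrict (uIcc a b)) a b Measure.AbsolutelyContinuous.rfl ⊥

theorem mem_PInterval_graph (a b : ℝ) (f h : L2Interval a b) : (f, h) ∈ (PInterval a b).graph ↔
    ∃ F : ℝ → ℂ, AbsolutelyContinuousOnInterval F a b ∧ (F a = 0 ∧ F b = 0) ∧
      f =ᵐ[volume.restrict (uIcc a b)] F ∧
      h =ᵐ[volume.restrict (uIcc a b)] fun x => -Complex.I * deriv F x := by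
  unfold PInterval
  rw [momentum_graph _ _ _ _ Measure.AbsolutelyContinuous.rfl]
  simp only [← Prod.mk_eq_zero]
  rfl

/-! ## The time operator -/

/-- The lift `g(k) = m k + θ(k)` of the phase. -/
def phase (m : ℤ) (θ : ℝ → ℝ) (k : ℝ) : ℝ := m * k + θ k

/-- `m` is the winding number of `lam`, with continuous `2π`-periodic remainder `θ`:
`lam(k) = exp (i (m k + θ(k)))`. -/
def HasWinding (lam : ℝ → ℂ) (m : ℤ) (θ : ℝ → ℝ) : Prop :=
  Continuous θ ∧ Function.Periodic θ (2 * π) ∧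
    ∀ k, lam k = Complex.exp (Complex.I * (phase m θ k : ℂ))

/-- The multiplication operator `1 / (m + θ'(k))`. -/
def invSpeed (m : ℤ) (θ : ℝ → ℝ) : K1 →ₗ.[ℂ] K1 :=
  mulOp circleMeasure fun k => 1 / ((m : ℂ) + ((deriv θ k : ℝ) : ℂ))

/-- `T = ½ ((1 / (m + θ'(k))) P + P (1 / (m + θ'(k))))` with its natural domain. -/
def timeOp (m : ℤ) (θ : ℝ → ℝ) : K1 →ₗ.[ℂ] K1 :=
  (1 / 2 : ℂ) • (prodOp (invSpeed m θ) P + prodOp P (invSpeed m θ))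

/-- The zeros of `lam'` in `[0, 2π)`. -/
def criticalPoints (lam : ℝ → ℂ) : Set ℝ := {k | k ∈ Ico 0 (2 * π) ∧ deriv lam k = 0}

end TimeOp

end

open TimeOp

/-!
# The time operator of a winding phase

Write `lam = e^{ig}` with `g = m k + θ` and `γ = g'`, a `2π`-periodic `C¹` function whose zeros are
those of `lam'`.

*The operator.* Elements of the domain of `T = ½ (γ⁻¹ P + P γ⁻¹)` are exactly the functions `f = γ u`
with `u` periodic and absolutely continuous and with `u'` and `(γ' / γ) u` square integrable, and then
`T f = -i (u' + ½ (γ' / γ) u)`: see `IsSpeed.exists_of_mem_graph` and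
`IsSpeed.mem_graph_of_primitive`.

*The change of variables.* Cut the circle at points `a 0 < ⋯ < a n = a 0 + 2π` between which `γ` has
no zero, so that `g` is monotone on each piece. Substituting `E = g k` with the weight `√(2π |γ|)` is a
unitary operator `PhasePartition.unitary` from `⨁ⱼ L²(g [aⱼ, aⱼ₊₁])` onto `L²(dk / 2π)`. It turns
multiplication by `lam` into multiplication by `e^{iE}`, and `T` into a restriction of `-i d/dE` on each
interval. The image of `f = γ u` is a multiple of `γ u / √|γ|`, which is continuous up to the endpoints
(`PhasePartition.exists_boundary_value`).

*Critical points.* If the cuts are the zeros of `γ`, the boundary values `γ u / √|γ|` vanish, so `T` is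
contained in the direct sum of the minimal operators `-i d/dE`. Conversely, functions on the intervals
whose derivative has mean zero and vanishes near the endpoints come from the domain of `T`, since they
vanish where `γ` is small; they form a core of the direct sum
(`PhasePartition.minimalOp_graph_subset_closure`). Hence the closure of `T` is that direct sum, each
summand contributes `1` to both deficiency indices, and periodic boundary conditions on every interval
give a self-adjoint extension.

*No critical points.* If `γ` has no zero, one interval of length `2π |m|` suffices, and periodicity of
`u` and `γ` becomes the periodic boundary condition: `T` is equivalent to the self-adjoint operator
`-i d/dE` with that condition (`PhasePartition.timeOpOf_eq_periodicOp`). Its eigenvalues are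
`q / |m|` for `q ∈ ℤ`, each simple. Division of `q` by `|m|` with remainder `j` identifies its eigenbasis
with the one of `⨁ⱼ (P + j / |m|)`, and multiplication by `e^{iE}`, which shifts `q` by `|m|`, becomes
multiplication by `e^{ik}` (`exists_unitary_periodic`).

*The operator `-i d/dx` on an interval* is treated through the bounded Volterra operator `J v = ∫ₐˣ v`,
of which only the identity `J + J* = σ |e⟩⟨e|` is used, with `e` the constant function `1`
(`IsVolterra`). This gives the adjoint and the deficiency indices of the minimal operator and the
self-adjointness of the periodic one.
-/

noncomputable section

open scoped InnerProductSpace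

namespace TimeOp

/-! ### Unbounded operators and their graphs -/

section Operators

variable {E F : Type*} [NormedAddCommGroup E] [InnerProductSpace ℂ E]
  [NormedAddCommGroup F] [InnerProductSpace ℂ F]

theorem mem_prodOp_graph {B A : E →ₗ.[ℂ] E} {x z : E} :
    (x, z) ∈ (prodOp B A).graph ↔ ∃ y, (x, y) ∈ A.graph ∧ (y, z) ∈ B.graph := by
  constructor
  · intro h
    obtain ⟨⟨u, hu, hu'⟩, h1, h2⟩ := (LinearPMap.mem_graph_iff _).1 h
    obtain rfl : u = x := h1
    exact ⟨A ⟨u, hu⟩, A.mem_graph ⟨u, hu⟩, (LinearPMap.mem_graph_iff _).2 ⟨⟨_, hu'⟩, rfl, h2⟩⟩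
  · rintro ⟨y, h1, h2⟩
    obtain ⟨⟨u, hu⟩, h3, h4⟩ := (LinearPMap.mem_graph_iff _).1 h1
    obtain ⟨⟨v, hv⟩, h5, h6⟩ := (LinearPMap.mem_graph_iff _).1 h2
    obtain rfl : u = x := h3
    obtain rfl : v = y := h5
    obtain rfl : A ⟨u, hu⟩ = v := h4
    exact (LinearPMap.mem_graph_iff _).2 ⟨⟨u, hu, hv⟩, rfl, h6⟩

theorem mem_add_graph {A B : E →ₗ.[ℂ] F} {x : E} {z : F} :
    (x, z) ∈ (A + B).graph ↔ ∃ y y', (x, y) ∈ A.graph ∧ (x, y') ∈ B.graph ∧ z = y + y' := by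
  constructor
  · intro h
    obtain ⟨⟨u, hu, hu'⟩, h1, h2⟩ := (LinearPMap.mem_graph_iff _).1 h
    obtain rfl : u = x := h1
    exact ⟨A ⟨u, hu⟩, B ⟨u, hu'⟩, A.mem_graph ⟨u, hu⟩, B.mem_graph ⟨u, hu'⟩, h2.symm⟩
  · rintro ⟨y, y', h1, h2, rfl⟩
    obtain ⟨⟨u, hu⟩, h3, h4⟩ := (LinearPMap.mem_graph_iff _).1 h1
    obtain ⟨⟨v, hv⟩, h5, h6⟩ := (LinearPMap.mem_graph_iff _).1 h2
    obtain rfl : u = x := h3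
    obtain rfl : v = u := h5
    obtain rfl : A ⟨v, hu⟩ = y := h4
    obtain rfl : B ⟨v, hv⟩ = y' := h6
    exact (LinearPMap.mem_graph_iff _).2 ⟨⟨v, hu, hv⟩, rfl, rfl⟩

theorem mem_smul_graph {A : E →ₗ.[ℂ] F} {c : ℂ} {x : E} {z : F} :
    (x, z) ∈ (c • A).graph ↔ ∃ y, (x, y) ∈ A.graph ∧ z = c • y := by
  rw [LinearPMap.smul_graph]
  constructor
  · rintro ⟨⟨u, v⟩, h1, h2⟩
    obtain ⟨rfl, rfl⟩ := Prod.mk_inj.1 h2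
    exact ⟨v, h1, rfl⟩
  · rintro ⟨y, h1, rfl⟩
    exact ⟨(x, y), h1, rfl⟩

theorem mem_vadd_graph {A : E →ₗ.[ℂ] E} {c : ℂ} {x y : E} :
    (x, y) ∈ ((c • (LinearMap.id : E →ₗ[ℂ] E)) +ᵥ A).graph ↔ (x, y - c • x) ∈ A.graph := by
  constructor
  · intro h
    obtain ⟨⟨u, hu⟩, h1, h2⟩ := (LinearPMap.mem_graph_iff _).1 h
    obtain rfl : u = x := h1
    have h3 : c • u + A ⟨u, hu⟩ = y := h2
    exact (LinearPMap.mem_graph_iff _).2 ⟨⟨u, hu⟩, rfl, by simp [← h3]⟩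
  · intro h
    obtain ⟨⟨u, hu⟩, h1, h2⟩ := (LinearPMap.mem_graph_iff _).1 h
    obtain rfl : u = x := h1
    refine (LinearPMap.mem_graph_iff _).2 ⟨⟨u, hu⟩, rfl, ?_⟩
    change c • u + A ⟨u, hu⟩ = y
    rw [h2]; simp

theorem mem_conjOp_graph {V : E ≃ₗᵢ[ℂ] F} {A : E →ₗ.[ℂ] E} {x y : F} :
    (x, y) ∈ (conjOp V A).graph ↔ (V.symm x, V.symm y) ∈ A.graph := by
  constructor
  · intro h
    obtain ⟨⟨u, hu⟩, h1, h2⟩ := (LinearPMap.mem_graph_iff _).1 h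
    obtain rfl : u = x := h1
    have h3 : V (A ⟨V.symm u, hu⟩) = y := h2
    exact (LinearPMap.mem_graph_iff _).2 ⟨⟨_, hu⟩, rfl, by simp [← h3]⟩
  · intro h
    obtain ⟨⟨u, hu⟩, h1, h2⟩ := (LinearPMap.mem_graph_iff _).1 h
    obtain rfl : u = V.symm x := h1
    refine (LinearPMap.mem_graph_iff _).2 ⟨⟨x, hu⟩, rfl, ?_⟩
    change V (A ⟨V.symm x, hu⟩) = y
    rw [h2]; simp

theorem mem_directSumOp_graph {ι : Type*} [Fintype ι] {H : ι → Type*}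
    [∀ j, NormedAddCommGroup (H j)] [∀ j, InnerProductSpace ℂ (H j)] {A : ∀ j, H j →ₗ.[ℂ] H j}
    {x y : PiLp 2 H} :
    (x, y) ∈ (directSumOp A).graph ↔ ∀ j, (x j, y j) ∈ (A j).graph := by
  constructor
  · intro h j
    obtain ⟨⟨u, hu⟩, h1, h2⟩ := (LinearPMap.mem_graph_iff _).1 h
    obtain rfl : u = x := h1
    have h3 : WithLp.toLp 2 (fun j => A j ⟨u j, hu j⟩) = y := h2
    exact (LinearPMap.mem_graph_iff _).2 ⟨⟨_, hu j⟩, rfl, by rw [← h3]⟩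
  · intro h
    have hx : ∀ j, x j ∈ (A j).domain := fun j => LinearPMap.mem_domain_of_mem_graph (h j)
    refine (LinearPMap.mem_graph_iff _).2 ⟨⟨x, hx⟩, rfl, ?_⟩
    change WithLp.toLp 2 (fun j => A j ⟨x j, hx j⟩) = y
    ext j
    exact ((LinearPMap.image_iff (hx j)).2 (h j)).symm

theorem ext_graph {A B : E →ₗ.[ℂ] F} (h : ∀ x y, (x, y) ∈ A.graph ↔ (x, y) ∈ B.graph) : A = B :=
  LinearPMap.eq_of_eq_graph (Submodule.ext fun p => h p.1 p.2)

theorem mem_adjoint_graph_iff [CompleteSpace E] {A : E →ₗ.[ℂ] E} (hA : Dense (A.domain : Set E))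
    {x y : E} :
    (x, y) ∈ A.adjoint.graph ↔ ∀ u v, (u, v) ∈ A.graph → ⟪v, x⟫_ℂ = ⟪u, y⟫_ℂ := by
  rw [LinearPMap.adjoint_graph_eq_graph_adjoint hA, Submodule.mem_adjoint_iff]
  simp only [sub_eq_zero]

theorem isSelfAdjoint_iff_graph [CompleteSpace E] {A : E →ₗ.[ℂ] E}
    (hA : Dense (A.domain : Set E)) :
    IsSelfAdjoint A ↔
      ∀ x y, (∀ u v, (u, v) ∈ A.graph → ⟪v, x⟫_ℂ = ⟪u, y⟫_ℂ) ↔ (x, y) ∈ A.graph := by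
  rw [LinearPMap.isSelfAdjoint_def]
  constructor
  · intro h x y
    rw [← mem_adjoint_graph_iff hA, h]
  · intro h
    exact ext_graph fun x y => (mem_adjoint_graph_iff hA).trans (h x y)

theorem inner_eq_of_isSelfAdjoint [CompleteSpace E] {A : E →ₗ.[ℂ] E} (hA : IsSelfAdjoint A)
    {u v x y : E} (huv : (u, v) ∈ A.graph) (hxy : (x, y) ∈ A.graph) : ⟪v, x⟫_ℂ = ⟪u, y⟫_ℂ :=
  ((isSelfAdjoint_iff_graph hA.dense_domain).1 hA x y).2 hxy u v huv

theorem isSymmetricOp_of_graph {A : E →ₗ.[ℂ] E} (hA : Dense (A.domain : Set E))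
    (h : ∀ u v x y, (u, v) ∈ A.graph → (x, y) ∈ A.graph → ⟪v, x⟫_ℂ = ⟪u, y⟫_ℂ) :
    IsSymmetricOp A :=
  ⟨hA, fun u x => h _ _ _ _ (A.mem_graph u) (A.mem_graph x)⟩

theorem dense_conjOp {V : E ≃ₗᵢ[ℂ] F} {A : E →ₗ.[ℂ] E} (hA : Dense (A.domain : Set E)) :
    Dense ((conjOp V A).domain : Set F) := by
  have : ((conjOp V A).domain : Set F) = V '' (A.domain : Set E) := by
    ext x
    exact ⟨fun hx => ⟨V.symm x, hx, by simp⟩, by rintro ⟨y, hy, rfl⟩; simpa [conjOp] using hy⟩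
  rw [this]
  exact V.surjective.denseRange.dense_image V.continuous hA

theorem isSelfAdjoint_conjOp [CompleteSpace E] [CompleteSpace F] {V : E ≃ₗᵢ[ℂ] F}
    {A : E →ₗ.[ℂ] E} (hA : IsSelfAdjoint A) : IsSelfAdjoint (conjOp V A) := by
  have hd := hA.dense_domain
  rw [isSelfAdjoint_iff_graph (dense_conjOp hd)]
  intro x y
  rw [mem_conjOp_graph, ← (isSelfAdjoint_iff_graph hd).1 hA]
  simp only [mem_conjOp_graph]
  constructor
  · intro h u v huv
    have := h (V u) (V v) (by simpa using huv)
    rw [← V.symm.inner_map_map (V v), ← V.symm.inner_map_map (V u)] at this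
    simpa using this
  · intro h u v huv
    simpa using h _ _ huv

theorem isSelfAdjoint_vadd [CompleteSpace E] {A : E →ₗ.[ℂ] E} (hA : IsSelfAdjoint A) (c : ℝ) :
    IsSelfAdjoint (((c : ℂ) • (LinearMap.id : E →ₗ[ℂ] E)) +ᵥ A) := by
  have hd := hA.dense_domain
  rw [isSelfAdjoint_iff_graph (A := ((c : ℂ) • (LinearMap.id : E →ₗ[ℂ] E)) +ᵥ A) hd]
  intro x y
  rw [mem_vadd_graph, ← (isSelfAdjoint_iff_graph hd).1 hA]
  simp only [mem_vadd_graph]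
  constructor
  · intro h u v huv
    have := h u (v + (c : ℂ) • u) (by simpa using huv)
    rw [inner_add_left, inner_smul_left, Complex.conj_ofReal] at this
    rw [inner_sub_right, inner_smul_right, ← this]; ring
  · intro h u v huv
    have := h _ _ huv
    rw [inner_sub_left, inner_smul_left, inner_sub_right, inner_smul_right,
      Complex.conj_ofReal] at this
    linear_combination this

section DirectSum

variable {ι : Type*} [Fintype ι] {H : ι → Type*}
    [∀ j, NormedAddCommGroup (H j)] [∀ j, InnerProductSpace ℂ (H j)] {A : ∀ j, H j →ₗ.[ℂ] H j}

theorem inner_single_left [DecidableEq ι] (j : ι) (u : H j) (x : PiLp 2 H) :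
    ⟪(WithLp.toLp 2 (Pi.single j u) : PiLp 2 H), x⟫_ℂ = ⟪u, x j⟫_ℂ := by
  rw [PiLp.inner_apply, Finset.sum_eq_single j]
  · simp
  · intro i _ hi
    simp [Pi.single_eq_of_ne hi]
  · simp

theorem single_mem_directSumOp_graph [DecidableEq ι] {j : ι} {u v : H j}
    (h : (u, v) ∈ (A j).graph) :
    ((WithLp.toLp 2 (Pi.single j u) : PiLp 2 H), (WithLp.toLp 2 (Pi.single j v) : PiLp 2 H)) ∈
      (directSumOp A).graph := by
  rw [mem_directSumOp_graph]
  intro i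
  rcases eq_or_ne i j with rfl | hi
  · simpa using h
  · simp only [Pi.single_eq_of_ne hi]
    exact (A i).graph.zero_mem

theorem dense_directSumOp [∀ j, CompleteSpace (H j)] (hA : ∀ j, Dense ((A j).domain : Set (H j))) :
    Dense ((directSumOp A).domain : Set (PiLp 2 H)) := by
  classical
  rw [Submodule.dense_iff_topologicalClosure_eq_top,
    Submodule.topologicalClosure_eq_top_iff, Submodule.eq_bot_iff]
  intro x hx
  ext j
  refine (hA j).eq_zero_of_inner_right ℂ fun u hu => ?_
  rw [← inner_single_left]
  exact (Submodule.mem_orthogonal _ _).1 hx _ (LinearPMap.mem_domain_of_mem_graph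
    (single_mem_directSumOp_graph ((A j).mem_graph ⟨u, hu⟩)))

theorem mem_adjoint_directSumOp_graph [∀ j, CompleteSpace (H j)]
    (hA : ∀ j, Dense ((A j).domain : Set (H j))) {x y : PiLp 2 H} :
    (x, y) ∈ (directSumOp A).adjoint.graph ↔ ∀ j, (x j, y j) ∈ (A j).adjoint.graph := by
  classical
  simp only [mem_adjoint_graph_iff (dense_directSumOp hA), mem_adjoint_graph_iff (hA _)]
  constructor
  · intro h j u v huv
    simpa only [inner_single_left] using h _ _ (single_mem_directSumOp_graph huv)
  · intro h u v huv
    rw [PiLp.inner_apply, PiLp.inner_apply]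
    exact Finset.sum_congr rfl fun j _ => h j _ _ (mem_directSumOp_graph.1 huv j)

theorem isSelfAdjoint_directSumOp [∀ j, CompleteSpace (H j)]
    (hA : ∀ j, IsSelfAdjoint (A j)) : IsSelfAdjoint (directSumOp A) := by
  rw [LinearPMap.isSelfAdjoint_def]
  refine ext_graph fun x y => ?_
  rw [mem_adjoint_directSumOp_graph fun j => (hA j).dense_domain, mem_directSumOp_graph]
  simp only [fun j => LinearPMap.isSelfAdjoint_def.1 (hA j)]

theorem isClosed_directSumOp (hA : ∀ j, (A j).IsClosed) : (directSumOp A).IsClosed := by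
  have : ((directSumOp A).graph : Set (PiLp 2 H × PiLp 2 H)) =
      ⋂ j, (fun p : PiLp 2 H × PiLp 2 H => (p.1 j, p.2 j)) ⁻¹' ((A j).graph : Set (H j × H j)) := by
    ext ⟨x, y⟩
    simpa using mem_directSumOp_graph (A := A) (x := x) (y := y)
  unfold LinearPMap.IsClosed
  rw [this]
  exact isClosed_iInter fun j => (hA j).preimage (by fun_prop)

end DirectSum

theorem isClosed_conjOp {V : E ≃ₗᵢ[ℂ] F} {A : E →ₗ.[ℂ] E} (hA : A.IsClosed) :
    (conjOp V A).IsClosed := by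
  have : ((conjOp V A).graph : Set (F × F)) =
      (fun p : F × F => (V.symm p.1, V.symm p.2)) ⁻¹' (A.graph : Set (E × E)) := by
    ext ⟨x, y⟩
    exact mem_conjOp_graph
  unfold LinearPMap.IsClosed
  rw [this]
  exact hA.preimage (by fun_prop)

theorem conjOp_symm_conjOp (V : E ≃ₗᵢ[ℂ] F) (A : E →ₗ.[ℂ] E) : conjOp V.symm (conjOp V A) = A :=
  ext_graph fun x y => by
    rw [mem_conjOp_graph, mem_conjOp_graph]
    simp only [LinearIsometryEquiv.symm_symm, LinearIsometryEquiv.symm_apply_apply]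

theorem conjOp_trans {G : Type*} [NormedAddCommGroup G] [InnerProductSpace ℂ G]
    (V : E ≃ₗᵢ[ℂ] F) (W : F ≃ₗᵢ[ℂ] G) (A : E →ₗ.[ℂ] E) :
    conjOp (V.trans W) A = conjOp W (conjOp V A) :=
  ext_graph fun x y => by simp only [mem_conjOp_graph]; rfl

theorem dense_domain_of_graph_le_closure {A S : E →ₗ.[ℂ] E} (hS : Dense (S.domain : Set E))
    (h : (S.graph : Set (E × E)) ⊆ closure (A.graph : Set (E × E))) :
    Dense (A.domain : Set E) := by
  refine dense_iff_closure_eq.2 (eq_univ_of_univ_subset ?_)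
  rw [← hS.closure_eq]
  refine closure_minimal (fun x hx => ?_) isClosed_closure
  have h1 := h (S.mem_graph ⟨x, hx⟩)
  refine closure_mono ?_ (image_closure_subset_closure_image continuous_fst ⟨_, h1, rfl⟩)
  rintro _ ⟨⟨u, v⟩, huv, rfl⟩
  exact LinearPMap.mem_domain_of_mem_graph huv

/-- A closed extension lying in the closure of the graph is the closure. -/
theorem closure_eq_of_graph {A S : E →ₗ.[ℂ] E} (hS : S.IsClosed) (hAS : A ≤ S)
    (h : (S.graph : Set (E × E)) ⊆ closure (A.graph : Set (E × E))) : A.closure = S := by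
  refine LinearPMap.eq_of_eq_graph ?_
  rw [← (hS.isClosable.leIsClosable hAS).graph_closure_eq_closure_graph]
  apply le_antisymm
  · exact Submodule.topologicalClosure_minimal _ (LinearPMap.le_graph_of_le hAS) hS
  · exact h

/-- An operator and an extension contained in its closure have the same adjoint. -/
theorem mem_adjoint_graph_of_closure [CompleteSpace E] {A S : E →ₗ.[ℂ] E}
    (hS : Dense (S.domain : Set E)) (hAS : A ≤ S)
    (h : (S.graph : Set (E × E)) ⊆ closure (A.graph : Set (E × E))) {x y : E} :
    (x, y) ∈ A.adjoint.graph ↔ (x, y) ∈ S.adjoint.graph := by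
  rw [mem_adjoint_graph_iff (dense_domain_of_graph_le_closure hS h), mem_adjoint_graph_iff hS]
  constructor
  · intro hA u v huv
    have hc : IsClosed {p : E × E | ⟪p.2, x⟫_ℂ = ⟪p.1, y⟫_ℂ} :=
      isClosed_eq (by fun_prop) (by fun_prop)
    exact closure_minimal (t := {p : E × E | ⟪p.2, x⟫_ℂ = ⟪p.1, y⟫_ℂ})
      (fun p hp => hA p.1 p.2 hp) hc (h huv)
  · intro hS' u v huv
    exact hS' u v (LinearPMap.le_graph_of_le hAS huv)

/-! ### Defect spaces -/

/-- The defect space `ker (A* - z)`, as a subspace of the Hilbert space. -/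
def defectSpace [CompleteSpace E] (A : E →ₗ.[ℂ] E) (z : ℂ) : Submodule ℂ E where
  carrier := {x | (x, z • x) ∈ A.adjoint.graph}
  add_mem' := fun {x y} hx hy => by
    have := A.adjoint.graph.add_mem hx hy
    rwa [Prod.mk_add_mk, ← smul_add] at this
  zero_mem' := by
    change ((0 : E), z • (0 : E)) ∈ A.adjoint.graph
    rw [smul_zero]
    exact A.adjoint.graph.zero_mem
  smul_mem' := fun c x hx => by
    have := A.adjoint.graph.smul_mem c hx
    rwa [Prod.smul_mk, smul_comm] at this

theorem mem_defectSpace [CompleteSpace E] {A : E →ₗ.[ℂ] E} {z : ℂ} {x : E} :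
    x ∈ defectSpace A z ↔ (x, z • x) ∈ A.adjoint.graph := Iff.rfl

theorem defectNumber_eq_rank [CompleteSpace E] (A : E →ₗ.[ℂ] E) (z : ℂ) :
    defectNumber A z = Module.rank ℂ (defectSpace A z) := by
  have hmap : (LinearMap.ker (A.adjoint.toFun - z • A.adjoint.domain.subtype)).map
      A.adjoint.domain.subtype = defectSpace A z := by
    ext x
    rw [mem_defectSpace, LinearPMap.mem_graph_iff, Submodule.mem_map]
    constructor
    · rintro ⟨y, hy, rfl⟩
      refine ⟨y, rfl, ?_⟩
      exact sub_eq_zero.1 hy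
    · rintro ⟨y, rfl, hy⟩
      exact ⟨y, sub_eq_zero.2 hy, rfl⟩
  rw [defectNumber, ← hmap]
  exact (Submodule.equivMapOfInjective _ (Submodule.subtype_injective _) _).rank_eq

theorem defectNumber_eq_one [CompleteSpace E] {A : E →ₗ.[ℂ] E} {z : ℂ} {x₀ : E} (h₀ : x₀ ≠ 0)
    (h : ∀ x, (x, z • x) ∈ A.adjoint.graph ↔ ∃ c : ℂ, x = c • x₀) : defectNumber A z = 1 := by
  rw [defectNumber_eq_rank]
  have : defectSpace A z = Submodule.span ℂ {x₀} := by
    ext x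
    rw [mem_defectSpace, h, Submodule.mem_span_singleton]
    simp only [eq_comm]
  rw [this, ← Module.finrank_eq_rank, finrank_span_singleton h₀, Nat.cast_one]

theorem defectNumber_directSumOp {n : ℕ} {H : Fin n → Type}
    [∀ j, NormedAddCommGroup (H j)] [∀ j, InnerProductSpace ℂ (H j)] [∀ j, CompleteSpace (H j)]
    {A : ∀ j, H j →ₗ.[ℂ] H j} (hA : ∀ j, Dense ((A j).domain : Set (H j))) {z : ℂ}
    (h : ∀ j, defectNumber (A j) z = 1) : defectNumber (directSumOp A) z = n := by
  let e : defectSpace (directSumOp A) z ≃ₗ[ℂ] ∀ j, defectSpace (A j) z :=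
    { toFun := fun x j => ⟨x.1 j, by
        have := (mem_adjoint_directSumOp_graph hA).1 x.2 j
        exact this⟩
      map_add' := fun x y => rfl
      map_smul' := fun c x => rfl
      invFun := fun x => ⟨WithLp.toLp 2 fun j => (x j).1,
        (mem_adjoint_directSumOp_graph hA).2 fun j => (x j).2⟩
      left_inv := fun x => rfl
      right_inv := fun x => rfl }
  rw [defectNumber_eq_rank, e.rank_eq, rank_pi]
  simp [← defectNumber_eq_rank, h]

theorem defectNumber_congr [CompleteSpace E] {A B : E →ₗ.[ℂ] E} {z : ℂ}
    (h : ∀ x y, (x, y) ∈ A.adjoint.graph ↔ (x, y) ∈ B.adjoint.graph) :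
    defectNumber A z = defectNumber B z := by
  rw [defectNumber_eq_rank, defectNumber_eq_rank]
  have : defectSpace A z = defectSpace B z := Submodule.ext fun x => h _ _
  rw [this]

theorem defectNumber_conjOp {E F : Type} [NormedAddCommGroup E] [InnerProductSpace ℂ E]
    [NormedAddCommGroup F] [InnerProductSpace ℂ F] [CompleteSpace E] [CompleteSpace F]
    {V : E ≃ₗᵢ[ℂ] F} {A : E →ₗ.[ℂ] E} (hA : Dense (A.domain : Set E)) (z : ℂ) :
    defectNumber (conjOp V A) z = defectNumber A z := by
  have key : (defectSpace A z).map (V.toLinearEquiv : E →ₗ[ℂ] F) = defectSpace (conjOp V A) z := by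
    ext x
    rw [mem_defectSpace, mem_adjoint_graph_iff (dense_conjOp hA), Submodule.mem_map]
    simp only [mem_conjOp_graph]
    constructor
    · rintro ⟨y, hy, rfl⟩ u v huv
      have := (mem_adjoint_graph_iff hA).1 hy _ _ huv
      rw [← V.inner_map_map, ← V.inner_map_map (V.symm u)] at this
      simpa [inner_smul_right] using this
    · intro h
      refine ⟨V.symm x, (mem_adjoint_graph_iff hA).2 fun u v huv => ?_, by simp⟩
      have := h (V u) (V v) (by simpa using huv)
      rw [← V.symm.inner_map_map (V v), ← V.symm.inner_map_map (V u)] at this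
      simpa [inner_smul_right] using this
  rw [defectNumber_eq_rank, defectNumber_eq_rank, ← key]
  exact ((V.toLinearEquiv.submoduleMap _).rank_eq).symm

/-- A self-adjoint operator has no eigenvalues `± i`. -/
theorem defectNumber_of_isSelfAdjoint [CompleteSpace E] {A : E →ₗ.[ℂ] E} (hA : IsSelfAdjoint A)
    {z : ℂ} (hz : z = Complex.I ∨ z = -Complex.I) : defectNumber A z = 0 := by
  rw [defectNumber_eq_rank]
  have : defectSpace A z = ⊥ := by
    refine (Submodule.eq_bot_iff _).2 fun x hx => ?_
    rw [mem_defectSpace, LinearPMap.isSelfAdjoint_def.1 hA] at hx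
    have h1 := inner_eq_of_isSelfAdjoint hA hx hx
    rw [inner_smul_left, inner_smul_right] at h1
    have h2 : (starRingEnd ℂ z - z) * ⟪x, x⟫_ℂ = 0 := by rw [sub_mul, h1, sub_self]
    rcases mul_eq_zero.1 h2 with h3 | h3
    · exfalso
      have h4 := congrArg Complex.im h3
      rcases hz with rfl | rfl <;> norm_num at h4
    · exact inner_self_eq_zero.1 h3
  rw [this, rank_bot]

/-! ### Operators with a common eigenbasis -/

/-- A self-adjoint operator with an orthonormal basis of eigenvectors is diagonal in it. -/
theorem mem_graph_iff_of_eigenbasis [CompleteSpace E] {ι : Type*} {A : E →ₗ.[ℂ] E}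
    (hA : IsSelfAdjoint A) (b : HilbertBasis ι ℂ E) (ev : ι → ℝ)
    (hb : ∀ i, (b i, (ev i : ℂ) • b i) ∈ A.graph) {x y : E} :
    (x, y) ∈ A.graph ↔ ∀ i, ⟪b i, y⟫_ℂ = ev i * ⟪b i, x⟫_ℂ := by
  constructor
  · intro h i
    rw [← inner_eq_of_isSelfAdjoint hA (hb i) h, inner_smul_left, Complex.conj_ofReal]
  · intro h
    rw [← (isSelfAdjoint_iff_graph hA.dense_domain).1 hA]
    intro u v huv
    rw [← b.tsum_inner_mul_inner, ← b.tsum_inner_mul_inner]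
    refine tsum_congr fun i => ?_
    rw [h i, inner_eq_of_isSelfAdjoint hA huv (hb i), inner_smul_right]
    ring

/-- The unitary mapping one orthonormal basis to another. -/
def basisEquiv {ι : Type*} (b : HilbertBasis ι ℂ E) (b' : HilbertBasis ι ℂ F) :
    E ≃ₗᵢ[ℂ] F :=
  b.repr.trans b'.repr.symm

theorem inner_basisEquiv_symm {ι : Type*} (b : HilbertBasis ι ℂ E) (b' : HilbertBasis ι ℂ F)
    (i : ι) (x : F) : ⟪b i, (basisEquiv b b').symm x⟫_ℂ = ⟪b' i, x⟫_ℂ := by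
  rw [← b.repr_apply_apply, ← b'.repr_apply_apply]
  simp [basisEquiv]

/-- Two self-adjoint operators with the same eigenvalues along two orthonormal bases are unitarily
equivalent. -/
theorem conjOp_basisEquiv [CompleteSpace E] [CompleteSpace F] {ι : Type*} {A : E →ₗ.[ℂ] E}
    {B : F →ₗ.[ℂ] F} (hA : IsSelfAdjoint A) (hB : IsSelfAdjoint B) (b : HilbertBasis ι ℂ E)
    (b' : HilbertBasis ι ℂ F) (ev : ι → ℝ) (hb : ∀ i, (b i, (ev i : ℂ) • b i) ∈ A.graph)
    (hb' : ∀ i, (b' i, (ev i : ℂ) • b' i) ∈ B.graph) :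
    conjOp (basisEquiv b b') A = B := by
  refine ext_graph fun x y => ?_
  rw [mem_conjOp_graph, mem_graph_iff_of_eigenbasis hA b ev hb,
    mem_graph_iff_of_eigenbasis hB b' ev hb']
  simp only [inner_basisEquiv_symm]

theorem ext_inner_basis {ι : Type*} (b : HilbertBasis ι ℂ E) {x y : E}
    (h : ∀ i, ⟪b i, x⟫_ℂ = ⟪b i, y⟫_ℂ) : x = y := by
  apply b.repr.injective
  ext i
  rw [b.repr_apply_apply, b.repr_apply_apply, h]

/-- Two everywhere defined isometric operators permuting two orthonormal bases in the same way
are unitarily equivalent. -/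
theorem conjOp_basisEquiv_of_isometric {ι : Type*} {A : E →ₗ.[ℂ] E}
    {B : F →ₗ.[ℂ] F} (hA : ∀ x, ∃ y, (x, y) ∈ A.graph) (hB : ∀ x, ∃ y, (x, y) ∈ B.graph)
    (hA' : ∀ u v x y, (u, v) ∈ A.graph → (x, y) ∈ A.graph → ⟪v, y⟫_ℂ = ⟪u, x⟫_ℂ)
    (hB' : ∀ u v x y, (u, v) ∈ B.graph → (x, y) ∈ B.graph → ⟪v, y⟫_ℂ = ⟪u, x⟫_ℂ)
    (b : HilbertBasis ι ℂ E) (b' : HilbertBasis ι ℂ F) (s : ι → ι) (hs : s.Surjective)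
    (hb : ∀ i, (b i, b (s i)) ∈ A.graph) (hb' : ∀ i, (b' i, b' (s i)) ∈ B.graph) :
    conjOp (basisEquiv b b') A = B := by
  have key : ∀ x y y', (x, y) ∈ (conjOp (basisEquiv b b') A).graph → (x, y') ∈ B.graph →
      y = y' := by
    intro x y y' h h'
    rw [mem_conjOp_graph] at h
    refine ext_inner_basis b' fun i => ?_
    obtain ⟨i, rfl⟩ := hs i
    rw [hB' _ _ _ _ (hb' i) h', ← inner_basisEquiv_symm b b', ← inner_basisEquiv_symm b b',
      hA' _ _ _ _ (hb i) h]
  refine ext_graph fun x y => ⟨fun h => ?_, fun h => ?_⟩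
  · obtain ⟨y', hy'⟩ := hB x
    rwa [key x y y' h hy']
  · obtain ⟨y', hy'⟩ := hA ((basisEquiv b b').symm x)
    have hy2 : (x, basisEquiv b b' y') ∈ (conjOp (basisEquiv b b') A).graph := by
      rw [mem_conjOp_graph]; simpa using hy'
    rwa [← key x _ y hy2 h]

/-- The orthonormal basis of a Hilbert space direct sum assembled from bases of the summands. -/
theorem exists_directSum_basis {ι κ : Type*} [Fintype ι] [DecidableEq ι] {H : ι → Type*}
    [∀ j, NormedAddCommGroup (H j)] [∀ j, InnerProductSpace ℂ (H j)] [∀ j, CompleteSpace (H j)]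
    (b : ∀ j, HilbertBasis κ ℂ (H j)) :
    ∃ b' : HilbertBasis (κ × ι) ℂ (PiLp 2 H), ∀ i,
      b' i = WithLp.toLp 2 (Pi.single i.2 (b i.2 i.1)) := by
  classical
  let v : κ × ι → PiLp 2 H := fun i => WithLp.toLp 2 (Pi.single i.2 (b i.2 i.1))
  have hv : Orthonormal ℂ v := by
    rw [orthonormal_iff_ite]
    rintro ⟨k, i⟩ ⟨l, j⟩
    change ⟪(WithLp.toLp 2 (Pi.single i (b i k)) : PiLp 2 H),
      (WithLp.toLp 2 (Pi.single j (b j l)) : PiLp 2 H)⟫_ℂ = _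
    rw [inner_single_left]
    rcases eq_or_ne i j with rfl | hij
    · simpa using (orthonormal_iff_ite.1 (b i).orthonormal) k l
    · simp [hij]
  have hsp : (Submodule.span ℂ (range v))ᗮ = ⊥ := by
    refine (Submodule.eq_bot_iff _).2 fun x hx => ?_
    ext j
    refine ext_inner_basis (b j) fun k => ?_
    have := (Submodule.mem_orthogonal _ _).1 hx (v (k, j)) (Submodule.subset_span ⟨_, rfl⟩)
    change ⟪(WithLp.toLp 2 (Pi.single j (b j k)) : PiLp 2 H), x⟫_ℂ = 0 at this
    rw [inner_single_left] at this
    simpa using this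
  exact ⟨HilbertBasis.mkOfOrthogonalEqBot hv hsp, fun i => by
    rw [HilbertBasis.coe_mkOfOrthogonalEqBot]⟩

end Operators


/-! ### Operators with a Volterra inverse -/

section Volterra

variable {H : Type*} [NormedAddCommGroup H] [InnerProductSpace ℂ H] [CompleteSpace H]

/-- The properties of `v ↦ ∫ₐˣ v` on `L²` of an interval, with `e` the constant function `1`,
from which the theory of `-i d/dx` follows: integration by parts, which computes
`J + J* = σ |e⟩⟨e|`, and the fact that only the zero function has a constant primitive. -/
structure IsVolterra (J : H →L[ℂ] H) (e : H) (σ : ℝ) : Prop where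
  ne_zero : e ≠ 0
  inner_add_inner : ∀ u v, ⟪J u, v⟫_ℂ + ⟪u, J v⟫_ℂ = σ * (⟪u, e⟫_ℂ * ⟪e, v⟫_ℂ)
  eq_zero_of_const : ∀ v (c : ℂ), J v = c • e → v = 0

omit [CompleteSpace H] in
theorem exists_smul_of_orthogonal {e x : H} (h : ∀ v, ⟪e, v⟫_ℂ = 0 → ⟪v, x⟫_ℂ = 0) :
    ∃ c : ℂ, x = c • e := by
  have : x ∈ (Submodule.span ℂ {e})ᗮᗮ := by
    rw [Submodule.mem_orthogonal]
    intro v hv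
    exact h v ((Submodule.mem_orthogonal_singleton_iff_inner_right).1 hv)
  rw [Submodule.orthogonal_orthogonal] at this
  obtain ⟨c, hc⟩ := Submodule.mem_span_singleton.1 this
  exact ⟨c, hc.symm⟩

variable {J : H →L[ℂ] H} {e : H} {σ : ℝ} {A : H →ₗ.[ℂ] H}

namespace IsVolterra

omit [CompleteSpace H] in
/-- The adjoint relation for the pairs `(i J v, v)` with `v ⊥ e` is the maximal operator. -/
theorem forall_inner_eq_iff (hJ : IsVolterra J e σ) {x y : H} :
    (∀ v, ⟪e, v⟫_ℂ = 0 → ⟪v, x⟫_ℂ = ⟪Complex.I • J v, y⟫_ℂ) ↔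
      ∃ c : ℂ, x = c • e + Complex.I • J y := by
  have key : ∀ v, ⟪e, v⟫_ℂ = 0 →
      ⟪Complex.I • J v, y⟫_ℂ = ⟪v, Complex.I • J y⟫_ℂ := by
    intro v hv
    have h1 := hJ.inner_add_inner v y
    rw [← inner_conj_symm v e, hv] at h1
    rw [inner_smul_left, inner_smul_right, Complex.conj_I]
    simp only [map_zero, zero_mul, mul_zero] at h1
    linear_combination -Complex.I * h1
  constructor
  · intro h
    obtain ⟨c, hc⟩ := exists_smul_of_orthogonal (e := e) (x := x - Complex.I • J y) fun v hv => by
      rw [inner_sub_right, h v hv, key v hv, sub_self]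
    exact ⟨c, by rw [← hc]; simp⟩
  · rintro ⟨c, rfl⟩ v hv
    rw [key v hv, inner_add_right, inner_smul_right, ← inner_conj_symm v e, hv, map_zero, mul_zero,
      zero_add]

/-- A vector `x` orthogonal to `J v` for all `v ⊥ e` satisfies `J x ∈ ℂ e`, so it vanishes. -/
theorem dense_of_graph (hJ : IsVolterra J e σ)
    (hA : ∀ v, ⟪e, v⟫_ℂ = 0 → (Complex.I • J v, v) ∈ A.graph) : Dense (A.domain : Set H) := by
  rw [Submodule.dense_iff_topologicalClosure_eq_top,
    Submodule.topologicalClosure_eq_top_iff, Submodule.eq_bot_iff]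
  intro x hx
  obtain ⟨c, hc⟩ := (hJ.forall_inner_eq_iff (x := 0) (y := x)).1 fun v hv => by
    rw [(Submodule.mem_orthogonal _ _).1 hx _ (LinearPMap.mem_domain_of_mem_graph (hA v hv)),
      inner_zero_right]
  refine hJ.eq_zero_of_const x (Complex.I * c) ?_
  have := congrArg (fun z => Complex.I • z) hc
  simp only [smul_zero, smul_add, smul_smul, Complex.I_mul_I, neg_smul, one_smul] at this
  rw [← sub_eq_add_neg] at this
  exact (sub_eq_zero.1 this.symm).symm

section Minimal

variable (hA : ∀ u v, (u, v) ∈ A.graph ↔ u = Complex.I • J v ∧ ⟪e, v⟫_ℂ = 0)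

include hA

theorem dense_minimal (hJ : IsVolterra J e σ) : Dense (A.domain : Set H) :=
  hJ.dense_of_graph fun v hv => (hA _ v).2 ⟨rfl, hv⟩

omit [CompleteSpace H] in
theorem isClosed_minimal : A.IsClosed := by
  have : (A.graph : Set (H × H)) = {p : H × H | p.1 = Complex.I • J p.2 ∧ ⟪e, p.2⟫_ℂ = 0} := by
    ext ⟨u, v⟩
    exact hA u v
  unfold LinearPMap.IsClosed
  rw [this]
  exact (isClosed_eq (by fun_prop) (by fun_prop)).inter (isClosed_eq (by fun_prop) (by fun_prop))

theorem mem_adjoint_minimal (hJ : IsVolterra J e σ) {x y : H} :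
    (x, y) ∈ A.adjoint.graph ↔ ∃ c : ℂ, x = c • e + Complex.I • J y := by
  rw [mem_adjoint_graph_iff (dense_minimal hA hJ), ← hJ.forall_inner_eq_iff]
  simp only [hA]
  exact ⟨fun h v hv => h _ v ⟨rfl, hv⟩, by rintro h _ v ⟨rfl, hv⟩; exact h v hv⟩

theorem symm_minimal (hJ : IsVolterra J e σ) (u v x y : H) (huv : (u, v) ∈ A.graph)
    (hxy : (x, y) ∈ A.graph) : ⟪v, x⟫_ℂ = ⟪u, y⟫_ℂ :=
  (mem_adjoint_graph_iff (dense_minimal hA hJ)).1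
    ((mem_adjoint_minimal hA hJ).2 ⟨0, by simpa using ((hA x y).1 hxy).1⟩) u v huv

/-- The equation `A* x = ± i x` reads `x ± J x ∈ ℂ e`. Since `J + J*` is a real multiple of
`|e⟩⟨e|`, the operator `1 ± J` becomes coercive, hence invertible, once a suitable multiple of
`|e⟩⟨e|` is added; so the solutions form a line. -/
theorem defectNumber_minimal (hJ : IsVolterra J e σ) {z : ℂ}
    (hz : z = Complex.I ∨ z = -Complex.I) : defectNumber A z = 1 := by
  -- The eigenvalue equation is `x = c e + τ J x` with a sign `τ`.
  obtain ⟨τ, hτ, hτ'⟩ : ∃ τ : ℝ, (τ = 1 ∨ τ = -1) ∧ Complex.I * z = τ := by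
    rcases hz with rfl | rfl
    · exact ⟨-1, Or.inr rfl, by simp⟩
    · exact ⟨1, Or.inl rfl, by simp⟩
  have hre : ∀ x, (⟪J x, x⟫_ℂ).re = σ / 2 * ‖⟪e, x⟫_ℂ‖ ^ 2 := by
    intro x
    have h1 := congrArg Complex.re (hJ.inner_add_inner x x)
    rw [Complex.add_re, ← inner_conj_symm x (J x), ← inner_conj_symm x e, Complex.conj_re,
      ← Complex.normSq_eq_conj_mul_self, ← Complex.ofReal_mul, Complex.ofReal_re,
      Complex.normSq_eq_norm_sq] at h1
    linarith
  -- Adding a multiple of `|e⟩⟨e|` to `1 - τ J` makes it coercive and does not change the equation.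
  let M : H →L[ℂ] H := 1 - (τ : ℂ) • J + ((|τ * σ| : ℝ) : ℂ) • (innerSL ℂ e).smulRight e
  have hMx : ∀ x, M x = x - (τ : ℂ) • J x + ((|τ * σ| : ℝ) : ℂ) • ⟪e, x⟫_ℂ • e := fun x => rfl
  have hM : ∀ x, ‖x‖ ^ 2 ≤ (⟪M x, x⟫_ℂ).re := by
    intro x
    have h1 : (⟪M x, x⟫_ℂ).re =
        ‖x‖ ^ 2 - τ * (⟪J x, x⟫_ℂ).re + |τ * σ| * ‖⟪e, x⟫_ℂ‖ ^ 2 := by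
      rw [hMx, inner_add_left, inner_sub_left, inner_smul_left, inner_smul_left, inner_smul_left,
        ← Complex.normSq_eq_conj_mul_self, Complex.normSq_eq_norm_sq, inner_self_eq_norm_sq_to_K,
        Complex.conj_ofReal, Complex.conj_ofReal, Complex.add_re, Complex.sub_re,
        Complex.re_ofReal_mul, Complex.re_ofReal_mul]
      norm_cast
    rw [h1, hre]
    nlinarith [mul_nonneg (sub_nonneg.2 (le_abs_self (τ * σ))) (sq_nonneg ‖⟪e, x⟫_ℂ‖),
      mul_nonneg (abs_nonneg (τ * σ)) (sq_nonneg ‖⟪e, x⟫_ℂ‖)]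
  have hMu : IsUnit M := by
    refine ContinuousLinearMap.isUnit_of_forall_le_norm_inner_map M one_pos fun x => ?_
    rw [NNReal.coe_one, mul_one]
    exact (hM x).trans (Complex.re_le_norm _)
  have hbij : Function.Bijective M := (ContinuousLinearMap.isUnit_iff_bijective).1 hMu
  obtain ⟨x₀, hx₀⟩ := hbij.2 e
  refine defectNumber_eq_one (x₀ := x₀) ?_ fun x => ?_
  · rintro rfl
    exact hJ.ne_zero (by rw [← hx₀, map_zero])
  · rw [mem_adjoint_minimal hA hJ, map_smul, smul_smul, hτ']
    constructor
    · rintro ⟨c, hc⟩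
      refine ⟨c + ((|τ * σ| : ℝ) : ℂ) * ⟪e, x⟫_ℂ, hbij.1 ?_⟩
      rw [map_smul, hx₀, hMx, add_smul, mul_smul]
      congr 1
      rw [sub_eq_iff_eq_add]
      exact hc
    · rintro ⟨c, rfl⟩
      have h1 := hMx (c • x₀)
      rw [map_smul, hx₀] at h1
      refine ⟨c - ((|τ * σ| : ℝ) : ℂ) * ⟪e, c • x₀⟫_ℂ, ?_⟩
      rw [sub_smul, h1, mul_smul]
      abel

end Minimal

section Periodic

variable (hA : ∀ u v, (u, v) ∈ A.graph ↔ (∃ c : ℂ, u = c • e + Complex.I • J v) ∧ ⟪e, v⟫_ℂ = 0)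

include hA

/-- Among the elements of the maximal operator, the pair `(e, 0)` singles out those with `v ⊥ e`. -/
theorem isSelfAdjoint_periodic (hJ : IsVolterra J e σ) : IsSelfAdjoint A := by
  have hd : Dense (A.domain : Set H) :=
    hJ.dense_of_graph fun v hv => (hA _ v).2 ⟨⟨0, by simp⟩, hv⟩
  rw [isSelfAdjoint_iff_graph hd]
  intro x y
  rw [hA]
  constructor
  · intro h
    refine ⟨hJ.forall_inner_eq_iff.1 fun v hv => h _ v ((hA _ v).2 ⟨⟨0, by simp⟩, hv⟩), ?_⟩
    have := h e 0 ((hA _ _).2 ⟨⟨1, by simp⟩, by simp⟩)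
    rw [← this, inner_zero_left]
  · rintro ⟨h, hy⟩ u v huv
    obtain ⟨⟨c, rfl⟩, hv⟩ := (hA u v).1 huv
    rw [hJ.forall_inner_eq_iff.2 h v hv, inner_add_left, inner_smul_left e y c, hy, mul_zero,
      zero_add]

end Periodic

end IsVolterra

end Volterra


/-! ### Primitives of locally integrable functions -/

/-- `F` is a primitive on `ℝ` of the locally integrable function `f`; equivalently, `F` is locally
absolutely continuous with `F' = f` almost everywhere. -/
structure IsPrimitive (F f : ℝ → ℂ) : Prop where
  locallyIntegrable : LocallyIntegrable f
  sub_eq : ∀ x y, F y - F x = ∫ t in x..y, f t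

theorem intervalIntegrable_of_locallyIntegrable {f : ℝ → ℂ} (hf : LocallyIntegrable f) (x y : ℝ) :
    IntervalIntegrable f volume x y :=
  intervalIntegrable_iff.2 ((hf.integrableOn_isCompact isCompact_uIcc).mono_set uIoc_subset_uIcc)

theorem ac_ofReal_comp {F : ℝ → ℝ} {a b : ℝ} (hF : AbsolutelyContinuousOnInterval F a b) :
    AbsolutelyContinuousOnInterval (fun x => (F x : ℂ)) a b := by
  unfold AbsolutelyContinuousOnInterval at *
  simpa only [Complex.dist_eq, ← Complex.ofReal_sub, Complex.norm_real, Real.dist_eq,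
    Real.norm_eq_abs] using hF

theorem ac_congr {F G : ℝ → ℂ} {a b : ℝ} (hF : AbsolutelyContinuousOnInterval F a b)
    (h : EqOn F G (uIcc a b)) : AbsolutelyContinuousOnInterval G a b := by
  refine Filter.Tendsto.congr' ?_ hF
  filter_upwards [Filter.mem_inf_of_right (Filter.mem_principal_self _)] with E hE
  exact Finset.sum_congr rfl fun i hi => by rw [h (hE.1 i hi).1, h (hE.1 i hi).2]

theorem ac_integral {f : ℝ → ℂ} {a b : ℝ} (hf : IntervalIntegrable f volume a b) :
    AbsolutelyContinuousOnInterval (fun x => ∫ t in a..x, f t) a b := by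
  have hre : IntervalIntegrable (fun t => (f t).re) volume a b := ⟨hf.1.re, hf.2.re⟩
  have him : IntervalIntegrable (fun t => (f t).im) volume a b := ⟨hf.1.im, hf.2.im⟩
  have h1 := ac_ofReal_comp
    (hre.absolutelyContinuousOnInterval_intervalIntegral (c := a) left_mem_uIcc)
  have h2 := (ac_ofReal_comp
    (him.absolutelyContinuousOnInterval_intervalIntegral (c := a) left_mem_uIcc)).const_smul
      Complex.I
  refine ac_congr (h1.add h2) fun x hx => ?_
  have hx' : uIcc a x ⊆ uIcc a b := uIcc_subset_uIcc_left hx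
  have h3 : ∫ t in a..x, f t = ∫ t in a..x, (((f t).re : ℂ) + Complex.I * ((f t).im : ℂ)) :=
    intervalIntegral.integral_congr fun t _ => by
      rw [mul_comm]; exact (Complex.re_add_im _).symm
  have hre' : IntervalIntegrable (fun t => ((f t).re : ℂ)) volume a x :=
    ⟨(hre.mono_set hx').1.ofReal, (hre.mono_set hx').2.ofReal⟩
  have him' : IntervalIntegrable (fun t => ((f t).im : ℂ)) volume a x :=
    ⟨(him.mono_set hx').1.ofReal, (him.mono_set hx').2.ofReal⟩
  simp only [Pi.add_apply, smul_eq_mul]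
  rw [h3, intervalIntegral.integral_add hre' (him'.const_mul _),
    intervalIntegral.integral_const_mul, intervalIntegral.integral_ofReal,
    intervalIntegral.integral_ofReal]

namespace IsPrimitive

variable {F f G g : ℝ → ℂ}

theorem intervalIntegrable (h : IsPrimitive F f) (x y : ℝ) : IntervalIntegrable f volume x y :=
  intervalIntegrable_of_locallyIntegrable h.locallyIntegrable x y

theorem eq_add (h : IsPrimitive F f) (x y : ℝ) : F y = F x + ∫ t in x..y, f t := by
  rw [← h.sub_eq]; ring

theorem ae_hasDerivAt (h : IsPrimitive F f) : ∀ᵐ x, HasDerivAt F (f x) x := by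
  filter_upwards [LocallyIntegrable.ae_hasDerivAt_integral h.locallyIntegrable] with x hx
  have h1 : F = fun y => F 0 + ∫ t in (0 : ℝ)..y, f t := funext fun y => h.eq_add 0 y
  rw [h1]
  exact (hx 0).const_add _

theorem continuous (h : IsPrimitive F f) : Continuous F := by
  have h1 : F = fun y => F 0 + ∫ t in (0 : ℝ)..y, f t := funext fun y => h.eq_add 0 y
  rw [h1]
  exact continuous_const.add
    (intervalIntegral.continuous_primitive (fun a b => h.intervalIntegrable a b) 0)

theorem ac (h : IsPrimitive F f) (x y : ℝ) : AbsolutelyContinuousOnInterval F x y := by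
  have h1 : F = (fun _ => F x) + fun y => ∫ t in x..y, f t := funext fun y => h.eq_add x y
  rw [h1]
  exact AbsolutelyContinuousOnInterval.add contDiffOn_const.absolutelyContinuousOnInterval
    (ac_integral (h.intervalIntegrable x y))

end IsPrimitive

theorem integral_of_ac {F f : ℝ → ℂ} {a b : ℝ} (hF : AbsolutelyContinuousOnInterval F a b)
    (hf : IntervalIntegrable f volume a b)
    (hd : ∀ᵐ x, x ∈ uIcc a b → HasDerivAt F (f x) x) : F b - F a = ∫ t in a..b, f t := by
  have h1 := hF.sub (ac_integral hf)
  obtain ⟨C, hC⟩ := h1.const_of_ae_hasDerivAt_zero (by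
    filter_upwards [hd, hf.ae_hasDerivAt_integral] with x h1 h2 hx
    have := (h1 hx).sub (h2 hx a left_mem_uIcc)
    rwa [sub_self] at this)
  have ha := hC a left_mem_uIcc
  have hb := hC b right_mem_uIcc
  simp only [Pi.sub_apply, intervalIntegral.integral_same, sub_zero] at ha hb
  rw [ha, ← hb]; ring

theorem intervalIntegrable_deriv_of_ac {F : ℝ → ℂ} {a b : ℝ}
    (hF : AbsolutelyContinuousOnInterval F a b) : IntervalIntegrable (deriv F) volume a b := by
  have hcomp : ∀ L : ℂ →L[ℝ] ℝ, (∀ z, |L z| ≤ ‖z‖) →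
      AbsolutelyContinuousOnInterval (fun x => L (F x)) a b := by
    intro L hL
    refine squeeze_zero (fun E => Finset.sum_nonneg fun i _ => dist_nonneg) (fun E => ?_) hF
    refine Finset.sum_le_sum fun i _ => ?_
    rw [Real.dist_eq, ← map_sub, Complex.dist_eq]
    exact hL _
  have hre := (hcomp Complex.reCLM Complex.abs_re_le_norm).intervalIntegrable_deriv
  have him := (hcomp Complex.imCLM Complex.abs_im_le_norm).intervalIntegrable_deriv
  have h1 : IntervalIntegrable (fun x => ((deriv (fun x => Complex.reCLM (F x)) x : ℝ) : ℂ) +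
      ((deriv (fun x => Complex.imCLM (F x)) x : ℝ) : ℂ) * Complex.I) volume a b :=
    IntervalIntegrable.add ⟨hre.1.ofReal, hre.2.ofReal⟩
      (IntervalIntegrable.mul_const ⟨him.1.ofReal, him.2.ofReal⟩ _)
  refine h1.congr_ae ?_
  have h2 := ae_differentiableAt_of_ac hF
  filter_upwards [ae_restrict_of_ae_restrict_of_subset uIoc_subset_uIcc h2] with x hx
  have h3 := (Complex.reCLM.hasFDerivAt.comp_hasDerivAt x hx.hasDerivAt).deriv
  have h4 := (Complex.imCLM.hasFDerivAt.comp_hasDerivAt x hx.hasDerivAt).deriv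
  change deriv (fun x => Complex.reCLM (F x)) x = _ at h3
  change deriv (fun x => Complex.imCLM (F x)) x = _ at h4
  rw [h3, h4]
  exact Complex.re_add_im _

namespace IsPrimitive

variable {F f G g : ℝ → ℂ}

theorem of_ac (hF : ∀ x y, AbsolutelyContinuousOnInterval F x y) (hf : LocallyIntegrable f)
    (hd : ∀ᵐ x, HasDerivAt F (f x) x) : IsPrimitive F f :=
  ⟨hf, fun x y => integral_of_ac (hF x y) (intervalIntegrable_of_locallyIntegrable hf x y)
    (hd.mono fun _ h _ => h)⟩

theorem mul (hF : IsPrimitive F f) (hG : IsPrimitive G g) :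
    IsPrimitive (fun x => F x * G x) (fun x => f x * G x + F x * g x) := by
  refine of_ac (fun x y => (hF.ac x y).smul (hG.ac x y)) ?_ ?_
  · exact (hF.locallyIntegrable.mul_continuous hG.continuous).add
      (hG.locallyIntegrable.continuous_mul hF.continuous)
  · filter_upwards [hF.ae_hasDerivAt, hG.ae_hasDerivAt] with x h1 h2
    exact h1.mul h2

theorem of_contDiff {F : ℝ → ℂ} (hF : ContDiff ℝ 1 F) : IsPrimitive F (deriv F) :=
  of_ac (fun _ _ => hF.contDiffOn.absolutelyContinuousOnInterval)
    (hF.continuous_deriv le_rfl).locallyIntegrable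
    (Filter.Eventually.of_forall fun x => (hF.differentiable one_ne_zero x).hasDerivAt)

theorem of_integral (hf : LocallyIntegrable f) (a : ℝ) :
    IsPrimitive (fun x => ∫ t in a..x, f t) f :=
  ⟨hf, fun x y => by
    rw [intervalIntegral.integral_interval_sub_left] <;>
      exact intervalIntegrable_of_locallyIntegrable hf _ _⟩

theorem const_mul (hF : IsPrimitive F f) (c : ℂ) :
    IsPrimitive (fun x => c * F x) (fun x => c * f x) :=
  ⟨hF.locallyIntegrable.smul c, fun x y => by
    rw [intervalIntegral.integral_const_mul, ← hF.sub_eq]; ring⟩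

theorem add_const (hF : IsPrimitive F f) (c : ℂ) : IsPrimitive (fun x => F x + c) f :=
  ⟨hF.locallyIntegrable, fun x y => by rw [← hF.sub_eq]; ring⟩

theorem congr_ae (hF : IsPrimitive F f) (h : f =ᵐ[volume] g) : IsPrimitive F g :=
  ⟨hF.locallyIntegrable.congr h, fun x y => by
    rw [hF.sub_eq]
    exact intervalIntegral.integral_congr_ae (h.mono fun _ h _ => h)⟩

end IsPrimitive


/-! ### The momentum operator on an interval -/

/-- `μ` is `c` times Lebesgue measure on the nondegenerate compact interval with endpoints `a`,
`b` (in either order). -/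
structure IsScaledLebesgue (μ : Measure ℝ) (c a b : ℝ) : Prop where
  pos : 0 < c
  ne : a ≠ b
  eq : μ = ENNReal.ofReal c • volume.restrict (uIcc a b)

/-- `1` if `a < b`, and `-1` if `b < a`. -/
def orientation (a b : ℝ) : ℝ := if a < b then 1 else -1

theorem orientation_mul_self (a b : ℝ) : orientation a b * orientation a b = 1 := by
  unfold orientation; split_ifs <;> norm_num

theorem setIntegral_uIcc (a b : ℝ) (f : ℝ → ℂ) :
    ∫ x in uIcc a b, f x = orientation a b * ∫ x in a..b, f x := by
  unfold orientation
  split_ifs with h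
  · rw [uIcc_of_lt h, integral_Icc_eq_integral_Ioc, intervalIntegral.integral_of_le h.le]
    simp
  · rw [uIcc_of_ge (not_lt.1 h), integral_Icc_eq_integral_Ioc,
      intervalIntegral.integral_of_ge (not_lt.1 h)]
    simp

/-- The primitive `x ↦ ∫ₐˣ v`, with `v` extended by zero from the interval with endpoints
`a`, `b`. -/
def primitiveOn (a b : ℝ) (v : ℝ → ℂ) (x : ℝ) : ℂ := ∫ t in a..x, (uIcc a b).indicator v t

theorem primitiveOn_left (a b : ℝ) (v : ℝ → ℂ) : primitiveOn a b v a = 0 :=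
  intervalIntegral.integral_same

theorem primitiveOn_eq {a b x : ℝ} (v : ℝ → ℂ) (hx : x ∈ uIcc a b) :
    primitiveOn a b v x = ∫ t in a..x, v t :=
  intervalIntegral.integral_congr fun _ ht =>
    indicator_of_mem (uIcc_subset_uIcc_left hx ht) _

namespace IsScaledLebesgue

variable {μ : Measure ℝ} {c a b : ℝ}

theorem ae_iff (h : IsScaledLebesgue μ c a b) : ae μ = ae (volume.restrict (uIcc a b)) := by
  rw [h.eq]
  refine Measure.ae_ennreal_smul_measure_eq ?_ _
  simpa using h.pos

theorem isFiniteMeasure (h : IsScaledLebesgue μ c a b) : IsFiniteMeasure μ := by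
  rw [h.eq]
  exact ⟨by
    rw [Measure.smul_apply, Measure.restrict_apply_univ, smul_eq_mul]
    exact ENNReal.mul_lt_top ENNReal.ofReal_lt_top isCompact_uIcc.measure_lt_top⟩

theorem integral_eq (h : IsScaledLebesgue μ c a b) (f : ℝ → ℂ) :
    ∫ x, f x ∂μ = c * orientation a b * ∫ x in a..b, f x := by
  rw [h.eq, integral_smul_measure, setIntegral_uIcc, ENNReal.toReal_ofReal h.pos.le]
  simp [mul_assoc]

theorem integrable_indicator (h : IsScaledLebesgue μ c a b) {v : ℝ → ℂ} (hv : MemLp v 2 μ) :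
    Integrable ((uIcc a b).indicator v) := by
  have := h.isFiniteMeasure
  have h1 : Integrable v μ := hv.integrable one_le_two
  rw [h.eq, integrable_smul_measure (by simpa using h.pos) ENNReal.ofReal_ne_top] at h1
  exact (integrable_indicator_iff measurableSet_uIcc).2 h1

theorem isPrimitive (h : IsScaledLebesgue μ c a b) {v : ℝ → ℂ} (hv : MemLp v 2 μ) :
    IsPrimitive (primitiveOn a b v) ((uIcc a b).indicator v) :=
  .of_integral (h.integrable_indicator hv).locallyIntegrable a

theorem memLp_of_continuous (h : IsScaledLebesgue μ c a b) {F : ℝ → ℂ} (hF : Continuous F) :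
    MemLp F 2 μ := by
  have := h.isFiniteMeasure
  obtain ⟨C, hC⟩ := (isCompact_uIcc (a := a) (b := b)).exists_bound_of_continuousOn hF.continuousOn
  refine MemLp.of_bound hF.aestronglyMeasurable C ?_
  rw [h.ae_iff]
  exact ae_restrict_of_forall_mem measurableSet_uIcc hC

/-- The constant function `1`. -/
def one (h : IsScaledLebesgue μ c a b) : Lp ℂ 2 μ :=
  (h.memLp_of_continuous (F := fun _ => 1) continuous_const).toLp _

theorem coe_one (h : IsScaledLebesgue μ c a b) : h.one =ᵐ[μ] fun _ => 1 := MemLp.coeFn_toLp _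

/-- The operator `v ↦ ∫ₐˣ v` as a linear map. -/
def volterraLin (h : IsScaledLebesgue μ c a b) : Lp ℂ 2 μ →ₗ[ℂ] Lp ℂ 2 μ where
  toFun v := (h.memLp_of_continuous (h.isPrimitive (Lp.memLp v)).continuous).toLp _
  map_add' u v := by
    rw [← MemLp.toLp_add]
    apply MemLp.toLp_congr
    rw [h.ae_iff]
    refine ae_restrict_of_forall_mem measurableSet_uIcc fun x hx => ?_
    have hw := Lp.coeFn_add u v
    rw [Filter.EventuallyEq, h.ae_iff, ae_restrict_iff' measurableSet_uIcc] at hw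
    simp only [primitiveOn, Pi.add_apply]
    rw [← intervalIntegral.integral_add ((h.isPrimitive (Lp.memLp u)).intervalIntegrable _ _)
      ((h.isPrimitive (Lp.memLp v)).intervalIntegrable _ _)]
    refine intervalIntegral.integral_congr_ae (hw.mono fun t ht ht' => ?_)
    have ht2 : t ∈ uIcc a b := uIcc_subset_uIcc_left hx (uIoc_subset_uIcc ht')
    rw [indicator_of_mem ht2, indicator_of_mem ht2, indicator_of_mem ht2, ht ht2, Pi.add_apply]
  map_smul' r v := by
    rw [RingHom.id_apply, ← MemLp.toLp_const_smul]
    apply MemLp.toLp_congr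
    rw [h.ae_iff]
    refine ae_restrict_of_forall_mem measurableSet_uIcc fun x hx => ?_
    have hw := Lp.coeFn_smul r v
    rw [Filter.EventuallyEq, h.ae_iff, ae_restrict_iff' measurableSet_uIcc] at hw
    simp only [primitiveOn, Pi.smul_apply]
    rw [← intervalIntegral.integral_smul]
    refine intervalIntegral.integral_congr_ae (hw.mono fun t ht ht' => ?_)
    have ht2 : t ∈ uIcc a b := uIcc_subset_uIcc_left hx (uIoc_subset_uIcc ht')
    rw [indicator_of_mem ht2, indicator_of_mem ht2, ht ht2, Pi.smul_apply]

theorem coe_volterraLin (h : IsScaledLebesgue μ c a b) (v : Lp ℂ 2 μ) :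
    h.volterraLin v =ᵐ[μ] primitiveOn a b v :=
  MemLp.coeFn_toLp (h.memLp_of_continuous (h.isPrimitive (Lp.memLp v)).continuous)

theorem inner_one_left (h : IsScaledLebesgue μ c a b) (v : Lp ℂ 2 μ) :
    ⟪h.one, v⟫_ℂ = c * orientation a b * primitiveOn a b v b := by
  rw [L2.inner_def, primitiveOn_eq _ right_mem_uIcc, ← h.integral_eq]
  refine integral_congr_ae ?_
  filter_upwards [h.coe_one] with x hx
  simp [hx]

/-- Integration by parts; the boundary term at `a` vanishes. -/
theorem volterraLin_identity (h : IsScaledLebesgue μ c a b) (u v : Lp ℂ 2 μ) :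
    ⟪h.volterraLin u, v⟫_ℂ + ⟪u, h.volterraLin v⟫_ℂ =
      (orientation a b / c : ℝ) * (⟪u, h.one⟫_ℂ * ⟪h.one, v⟫_ℂ) := by
  have hU := h.isPrimitive (Lp.memLp u)
  have hV := h.isPrimitive (Lp.memLp v)
  have hU' : IsPrimitive (fun x => (starRingEnd ℂ) (primitiveOn a b u x))
      (fun x => (starRingEnd ℂ) ((uIcc a b).indicator u x)) := by
    refine ⟨?_, fun x y => ?_⟩
    · exact (Complex.conjCLE.toContinuousLinearMap.integrable_comp
        (h.integrable_indicator (Lp.memLp u))).locallyIntegrable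
    · rw [← map_sub, hU.sub_eq]
      simp only [intervalIntegral, map_sub, ← integral_conj]
  have h1 : ⟪h.volterraLin u, v⟫_ℂ + ⟪u, h.volterraLin v⟫_ℂ =
      ∫ x, ((starRingEnd ℂ) ((uIcc a b).indicator u x) * primitiveOn a b v x +
        (starRingEnd ℂ) (primitiveOn a b u x) * (uIcc a b).indicator v x) ∂μ := by
    rw [L2.inner_def, L2.inner_def, ← integral_add (L2.integrable_inner _ _)
      (L2.integrable_inner _ _)]
    refine integral_congr_ae ?_
    have hm : ∀ᵐ x ∂μ, x ∈ uIcc a b := by rw [h.ae_iff]; exact ae_restrict_mem measurableSet_uIcc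
    filter_upwards [h.coe_volterraLin u, h.coe_volterraLin v, hm] with x hx1 hx2 hx3
    rw [hx1, hx2, indicator_of_mem hx3, indicator_of_mem hx3]
    simp only [RCLike.inner_apply]
    ring
  have hc : (c : ℂ) ≠ 0 := by exact_mod_cast h.pos.ne'
  have ho : (orientation a b : ℂ) * orientation a b = 1 := by
    exact_mod_cast orientation_mul_self a b
  rw [h1, h.integral_eq, ← (hU'.mul hV).sub_eq, primitiveOn_left, ← inner_conj_symm,
    h.inner_one_left, h.inner_one_left]
  simp only [map_zero, zero_mul, sub_zero, map_mul, Complex.conj_ofReal]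
  push_cast
  field_simp
  linear_combination (-(starRingEnd ℂ) (primitiveOn a b u b) * primitiveOn a b v b *
    orientation a b) * ho

/-- The Volterra operator `v ↦ ∫ₐˣ v` on `L²`. It is continuous because integration by parts
provides an everywhere defined adjoint. -/
def volterra (h : IsScaledLebesgue μ c a b) : Lp ℂ 2 μ →L[ℂ] Lp ℂ 2 μ where
  toLinearMap := h.volterraLin
  cont := by
    refine h.volterraLin.continuous_of_seq_closed_graph fun u x y hu hy => ?_
    refine ext_inner_right ℂ fun v => ?_
    have key : ∀ u, ⟪h.volterraLin u, v⟫_ℂ =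
        (orientation a b / c : ℝ) * (⟪u, h.one⟫_ℂ * ⟪h.one, v⟫_ℂ) - ⟪u, h.volterraLin v⟫_ℂ :=
      fun u => eq_sub_of_add_eq (h.volterraLin_identity u v)
    have h1 : Filter.Tendsto (fun n => ⟪h.volterraLin (u n), v⟫_ℂ) Filter.atTop
        (nhds ⟪h.volterraLin x, v⟫_ℂ) := by
      simp only [key]
      have hcont : Continuous fun u : Lp ℂ 2 μ =>
        (orientation a b / c : ℝ) * (⟪u, h.one⟫_ℂ * ⟪h.one, v⟫_ℂ) - ⟪u, h.volterraLin v⟫_ℂ := by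
        fun_prop
      exact (hcont.tendsto x).comp hu
    exact tendsto_nhds_unique (hy.inner tendsto_const_nhds) h1

theorem coe_volterra (h : IsScaledLebesgue μ c a b) (v : Lp ℂ 2 μ) :
    h.volterra v =ᵐ[μ] primitiveOn a b v := h.coe_volterraLin v

theorem coe_add_volterra (h : IsScaledLebesgue μ c a b) (z : ℂ) (v : Lp ℂ 2 μ) :
    (z • h.one + Complex.I • h.volterra v : Lp ℂ 2 μ) =ᵐ[μ]
      fun x => z + Complex.I * primitiveOn a b v x := by
  filter_upwards [Lp.coeFn_add (z • h.one) (Complex.I • h.volterra v),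
    Lp.coeFn_smul z h.one, Lp.coeFn_smul Complex.I (h.volterra v), h.coe_one,
    h.coe_volterra v] with x h1 h2 h3 h4 h5
  rw [h1, Pi.add_apply, h2, h3, Pi.smul_apply, Pi.smul_apply, h4, h5]
  simp

/-- An absolutely continuous function is determined by its value `z` at `a` and its derivative. -/
theorem mem_momentumGraph_iff (h : IsScaledLebesgue μ c a b)
    (hμ : μ ≪ volume.restrict (uIcc a b)) (B : Submodule ℂ (ℂ × ℂ)) {u v : Lp ℂ 2 μ} :
    (u, v) ∈ momentumGraph μ a b hμ B ↔
      ∃ z : ℂ, u = z • h.one + Complex.I • h.volterra v ∧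
        (z, z + Complex.I * primitiveOn a b v b) ∈ B := by
  have hm : ∀ᵐ x ∂μ, x ∈ uIcc a b := by rw [h.ae_iff]; exact ae_restrict_mem measurableSet_uIcc
  have hV := h.isPrimitive (Lp.memLp v)
  constructor
  · rintro ⟨F, hF, hB, h1, h2⟩
    have hFx : ∀ x ∈ uIcc a b, F x = F a + Complex.I * primitiveOn a b v x := by
      intro x hx
      have hac := hF.mono (uIcc_subset_uIcc_left hx)
      have h3 := integral_of_ac hac (intervalIntegrable_deriv_of_ac hac) (by
        have := ae_differentiableAt_of_ac hac
        rw [ae_restrict_iff' measurableSet_uIcc] at this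
        exact this.mono fun t ht hx => (ht hx).hasDerivAt)
      have h4 : ∫ t in a..x, deriv F t = ∫ t in a..x, Complex.I * v t := by
        change ∀ᵐ x ∂μ, v x = -Complex.I * deriv F x at h2
        rw [h.ae_iff, ae_restrict_iff' measurableSet_uIcc] at h2
        refine intervalIntegral.integral_congr_ae (h2.mono fun t ht ht' => ?_)
        rw [ht (uIcc_subset_uIcc_left hx (uIoc_subset_uIcc ht')), ← mul_assoc]
        simp
      rw [intervalIntegral.integral_const_mul] at h4
      rw [primitiveOn_eq _ hx, ← h4, ← h3]
      ring
    refine ⟨F a, ?_, ?_⟩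
    · apply Lp.ext
      filter_upwards [h1, h.coe_add_volterra (F a) v, hm] with x h3 h4 h5
      rw [h3, h4, hFx x h5]
    · rwa [← hFx b right_mem_uIcc]
  · rintro ⟨z, hu, hB⟩
    have hP := (hV.const_mul Complex.I).add_const z
    refine ⟨fun x => Complex.I * primitiveOn a b v x + z, hP.ac a b, ?_, ?_, ?_⟩
    · simp only [primitiveOn_left, mul_zero, zero_add]
      rwa [add_comm _ z]
    · rw [hu]
      refine (h.coe_add_volterra z v).trans (Filter.Eventually.of_forall fun x => add_comm _ _)
    · have hd := hP.ae_hasDerivAt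
      have hd' : ∀ᵐ x ∂μ, HasDerivAt (fun x => Complex.I * primitiveOn a b v x + z)
          (Complex.I * (uIcc a b).indicator v x) x := by
        rw [h.ae_iff]; exact ae_restrict_of_ae hd
      filter_upwards [hd', hm] with x h1 h2
      rw [h1.deriv, indicator_of_mem h2, ← mul_assoc]
      simp

theorem measure_ac (h : IsScaledLebesgue μ c a b) : volume.restrict (uIcc a b) ≪ μ :=
  Measure.ae_le_iff_absolutelyContinuous.1 h.ae_iff.ge

theorem ac_measure (h : IsScaledLebesgue μ c a b) : μ ≪ volume.restrict (uIcc a b) :=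
  Measure.ae_le_iff_absolutelyContinuous.1 h.ae_iff.le

theorem measure_univ (h : IsScaledLebesgue μ c a b) :
    μ univ = ENNReal.ofReal (c * |b - a|) := by
  rw [h.eq, Measure.smul_apply, Measure.restrict_apply_univ, Real.volume_interval, smul_eq_mul,
    ENNReal.ofReal_mul h.pos.le]

theorem isVolterra (h : IsScaledLebesgue μ c a b) :
    IsVolterra h.volterra h.one (orientation a b / c) where
  ne_zero := by
    intro h0
    have h1 := h.coe_one
    rw [h0] at h1
    have h2 : ∀ᵐ x ∂μ, False := by
      filter_upwards [h1, Lp.coeFn_zero ℂ 2 μ] with x h3 h4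
      rw [h4] at h3
      exact zero_ne_one h3
    rw [Filter.eventually_false_iff_eq_bot, ae_eq_bot, ← Measure.measure_univ_eq_zero,
      h.measure_univ, ENNReal.ofReal_eq_zero] at h2
    exact absurd h2 (not_le.2 (mul_pos h.pos (abs_pos.2 (sub_ne_zero.2 h.ne.symm))))
  inner_add_inner := h.volterraLin_identity
  eq_zero_of_const v z hv := by
    refine momentumGraph_single_valued μ a b h.ac_measure h.measure_ac ⊤ (0, v) ?_ rfl
    rw [h.mem_momentumGraph_iff]
    refine ⟨-Complex.I * z, ?_, trivial⟩
    rw [hv, smul_smul, ← add_smul]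
    simp

theorem primitiveOn_right (h : IsScaledLebesgue μ c a b) (v : Lp ℂ 2 μ) :
    primitiveOn a b v b = 0 ↔ ⟪h.one, v⟫_ℂ = 0 := by
  have hc : (c : ℂ) ≠ 0 := by exact_mod_cast h.pos.ne'
  have ho : (orientation a b : ℂ) ≠ 0 := by
    intro h0
    have : (orientation a b : ℂ) * orientation a b = 1 := by
      exact_mod_cast orientation_mul_self a b
    rw [h0, zero_mul] at this
    exact zero_ne_one this
  rw [h.inner_one_left]
  simp [hc, ho]

theorem mem_minimal_graph_iff (h : IsScaledLebesgue μ c a b)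
    (hμ : μ ≪ volume.restrict (uIcc a b)) (u v : Lp ℂ 2 μ) :
    (u, v) ∈ (momentum μ a b hμ ⊥).graph ↔ u = Complex.I • h.volterra v ∧ ⟪h.one, v⟫_ℂ = 0 := by
  rw [momentum_graph _ _ _ _ h.measure_ac, h.mem_momentumGraph_iff, ← h.primitiveOn_right]
  constructor
  · rintro ⟨z, h1, h2⟩
    obtain ⟨rfl, h3⟩ := Prod.mk_eq_zero.1 ((Submodule.mem_bot ℂ).1 h2)
    exact ⟨by simpa using h1, by simpa using h3⟩
  · rintro ⟨h1, h2⟩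
    exact ⟨0, by simpa using h1, by simp [h2]⟩

theorem mem_periodic_graph_iff (h : IsScaledLebesgue μ c a b)
    (hμ : μ ≪ volume.restrict (uIcc a b)) (u v : Lp ℂ 2 μ) :
    (u, v) ∈ (momentum μ a b hμ
      (LinearMap.eqLocus (LinearMap.fst ℂ ℂ ℂ) (LinearMap.snd ℂ ℂ ℂ))).graph ↔
      (∃ z : ℂ, u = z • h.one + Complex.I • h.volterra v) ∧ ⟪h.one, v⟫_ℂ = 0 := by
  rw [momentum_graph _ _ _ _ h.measure_ac, h.mem_momentumGraph_iff, ← h.primitiveOn_right]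
  simp only [LinearMap.mem_eqLocus, LinearMap.fst_apply, LinearMap.snd_apply, left_eq_add,
    mul_eq_zero, Complex.I_ne_zero, false_or, exists_and_right]

end IsScaledLebesgue

/-- `-i d/dx` with periodic boundary conditions on the interval with endpoints `a`, `b`. -/
def PPeriodic (a b : ℝ) : L2Interval a b →ₗ.[ℂ] L2Interval a b :=
  momentum (volume.restrict (uIcc a b)) a b Measure.AbsolutelyContinuous.rfl
    (LinearMap.eqLocus (LinearMap.fst ℂ ℂ ℂ) (LinearMap.snd ℂ ℂ ℂ))

theorem isScaledLebesgue_interval {a b : ℝ} (hab : a ≠ b) :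
    IsScaledLebesgue (volume.restrict (uIcc a b)) 1 a b := ⟨one_pos, hab, by simp⟩

theorem isScaledLebesgue_circle : IsScaledLebesgue circleMeasure (1 / (2 * π)) 0 (2 * π) :=
  ⟨by positivity, by positivity, by rw [uIcc_of_le (by positivity)]; rfl⟩


/-! ### Multiplication operators -/

theorem mem_mulOp_graph {μ : Measure ℝ} {φ : ℝ → ℂ} {f h : Lp ℂ 2 μ} :
    (f, h) ∈ (mulOp μ φ).graph ↔ h =ᵐ[μ] fun k => φ k * f k := by
  constructor
  · intro H
    obtain ⟨⟨u, hu⟩, h1, h2⟩ := (LinearPMap.mem_graph_iff _).1 H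
    obtain rfl : u = f := h1
    have h3 : MemLp.toLp (fun k => φ k * u k) hu = h := h2
    rw [← h3]
    exact MemLp.coeFn_toLp _
  · intro H
    have hm : MemLp (fun k => φ k * f k) 2 μ := (Lp.memLp h).ae_eq H
    refine (LinearPMap.mem_graph_iff _).2 ⟨⟨f, hm⟩, rfl, ?_⟩
    change MemLp.toLp (fun k => φ k * f k) hm = h
    apply Lp.ext
    exact (MemLp.coeFn_toLp _).trans H.symm

theorem exists_mem_mulOp_graph {μ : Measure ℝ} {φ : ℝ → ℂ} (hφ : Continuous φ)
    (h1 : ∀ k, ‖φ k‖ = 1) (f : Lp ℂ 2 μ) : ∃ h, (f, h) ∈ (mulOp μ φ).graph := by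
  have hm : MemLp (fun k => φ k * f k) 2 μ := by
    refine (Lp.memLp f).of_le (hφ.aestronglyMeasurable.mul (Lp.aestronglyMeasurable f)) ?_
    exact Filter.Eventually.of_forall fun k => by rw [norm_mul, h1, one_mul]
  exact ⟨hm.toLp _, mem_mulOp_graph.2 hm.coeFn_toLp⟩

theorem inner_mulOp {μ : Measure ℝ} {φ : ℝ → ℂ} (h1 : ∀ k, ‖φ k‖ = 1) {u v x y : Lp ℂ 2 μ}
    (huv : (u, v) ∈ (mulOp μ φ).graph) (hxy : (x, y) ∈ (mulOp μ φ).graph) :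
    ⟪v, y⟫_ℂ = ⟪u, x⟫_ℂ := by
  rw [mem_mulOp_graph] at huv hxy
  rw [L2.inner_def, L2.inner_def]
  refine integral_congr_ae ?_
  filter_upwards [huv, hxy] with k h2 h3
  have h4 : (starRingEnd ℂ) (φ k) * φ k = 1 := by
    rw [← Complex.normSq_eq_conj_mul_self, Complex.normSq_eq_norm_sq, h1]; simp
  rw [h2, h3]
  simp only [RCLike.inner_apply, map_mul]
  linear_combination ((starRingEnd ℂ) (u k) * x k) * h4

theorem exists_mem_directSum_mulOp_graph {ι : Type*} [Fintype ι] {μ : ι → Measure ℝ} {φ : ℝ → ℂ}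
    (hφ : Continuous φ) (h1 : ∀ k, ‖φ k‖ = 1) (f : PiLp 2 fun j => Lp ℂ 2 (μ j)) :
    ∃ h, (f, h) ∈ (directSumOp fun j => mulOp (μ j) φ).graph := by
  choose h hh using fun j => exists_mem_mulOp_graph hφ h1 (f j)
  exact ⟨WithLp.toLp 2 h, mem_directSumOp_graph.2 hh⟩

theorem inner_directSum_mulOp {ι : Type*} [Fintype ι] {μ : ι → Measure ℝ} {φ : ℝ → ℂ}
    (h1 : ∀ k, ‖φ k‖ = 1) (u v x y : PiLp 2 fun j => Lp ℂ 2 (μ j))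
    (huv : (u, v) ∈ (directSumOp fun j => mulOp (μ j) φ).graph)
    (hxy : (x, y) ∈ (directSumOp fun j => mulOp (μ j) φ).graph) : ⟪v, y⟫_ℂ = ⟪u, x⟫_ℂ := by
  rw [PiLp.inner_apply, PiLp.inner_apply]
  exact Finset.sum_congr rfl fun j _ =>
    inner_mulOp h1 (mem_directSumOp_graph.1 huv j) (mem_directSumOp_graph.1 hxy j)

theorem norm_exp_I_mul (k : ℝ) : ‖Complex.exp (Complex.I * (k : ℂ))‖ = 1 := by
  rw [mul_comm]; exact Complex.norm_exp_ofReal_mul_I k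

/-! ### The Fourier basis of the periodic momentum operator -/

/-- A consequence of Parseval's identity. -/
theorem eq_zero_of_fourierCoeffOn {a b : ℝ} (hab : a < b) {f : ℝ → ℂ}
    (hf : MemLp f 2 (volume.restrict (Ioc a b))) (h : ∀ n, fourierCoeffOn hab f n = 0) :
    f =ᵐ[volume.restrict (Ioc a b)] 0 := by
  have h1 := hasSum_sq_fourierCoeffOn hab hf
  simp only [h, norm_zero, ne_eq, OfNat.ofNat_ne_zero, not_false_eq_true, zero_pow] at h1
  have h2 := h1.unique hasSum_zero
  have h3 : ∫ x in a..b, ‖f x‖ ^ 2 = 0 := by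
    rcases smul_eq_zero.1 h2 with h3 | h3
    · exact absurd h3 (inv_ne_zero (sub_ne_zero.2 hab.ne'))
    · exact h3
  rw [intervalIntegral.integral_of_le hab.le, integral_eq_zero_iff_of_nonneg
    (fun x => by positivity) hf.norm.integrable_sq] at h3
  filter_upwards [h3] with x hx
  simpa using hx

theorem IsScaledLebesgue.memLp_volume {μ : Measure ℝ} {c a b : ℝ} (h : IsScaledLebesgue μ c a b)
    {v : ℝ → ℂ} (hv : MemLp v 2 μ) : MemLp v 2 (volume.restrict (uIcc a b)) := by
  rw [h.eq] at hv
  refine (hv.smul_measure (c := (ENNReal.ofReal c)⁻¹) ?_).mono_measure ?_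
  · rw [ENNReal.inv_ne_top]; simpa using h.pos
  · rw [smul_smul, ENNReal.inv_mul_cancel (by simpa using h.pos) ENNReal.ofReal_ne_top, one_smul]

/-- The exponentials `exp (2πinx / |b - a|)`, normalized in `L²(μ)`, form an orthonormal basis of
eigenvectors of the periodic momentum operator. -/
theorem IsScaledLebesgue.exists_fourier_basis {μ : Measure ℝ} {c a b : ℝ}
    (h : IsScaledLebesgue μ c a b) (hμ : μ ≪ volume.restrict (uIcc a b)) :
    ∃ (r : ℂ) (e : HilbertBasis ℤ ℂ (Lp ℂ 2 μ)),
      (∀ n, e n =ᵐ[μ] fun x => r * Complex.exp (Complex.I * ((2 * π * n / |b - a| * x : ℝ) : ℂ))) ∧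
      ∀ n, (e n, ((2 * π * n / |b - a| : ℝ) : ℂ) • e n) ∈ (momentum μ a b hμ
        (LinearMap.eqLocus (LinearMap.fst ℂ ℂ ℂ) (LinearMap.snd ℂ ℂ ℂ))).graph := by
  set L : ℝ := |b - a| with hL
  have hL0 : 0 < L := abs_pos.2 (sub_ne_zero.2 h.ne.symm)
  have hfin := h.isFiniteMeasure
  set r : ℝ := (√(c * L))⁻¹ with hr
  have hcL : 0 < c * L := mul_pos h.pos hL0
  have hr0 : r ≠ 0 := inv_ne_zero (Real.sqrt_ne_zero'.2 hcL)
  let E : ℤ → ℝ → ℂ := fun n x => r * Complex.exp (Complex.I * ((2 * π * n / L * x : ℝ) : ℂ))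
  have hEs : ∀ n, ContDiff ℝ 1 (E n) := fun n => by
    refine contDiff_const.mul (ContDiff.cexp (contDiff_const.mul ?_))
    exact Complex.ofRealCLM.contDiff.comp (contDiff_const.mul contDiff_id)
  have hEm : ∀ n, MemLp (E n) 2 μ := fun n => h.memLp_of_continuous (hEs n).continuous
  let e : ℤ → Lp ℂ 2 μ := fun n => (hEm n).toLp _
  have he : ∀ n, e n =ᵐ[μ] E n := fun n => (hEm n).coeFn_toLp
  have hEd : ∀ n x, deriv (E n) x = Complex.I * ((2 * π * n / L : ℝ) : ℂ) * E n x := by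
    intro n x
    have h1 : HasDerivAt (fun x : ℝ => ((2 * π * n / L * x : ℝ) : ℂ))
        ((2 * π * n / L : ℝ) : ℂ) x := by
      have := ((hasDerivAt_id x).const_mul (2 * π * n / L)).ofReal_comp
      simpa using this
    have h2 := ((h1.const_mul Complex.I).cexp).const_mul (r : ℂ)
    rw [h2.deriv]
    ring
  have hgraph : ∀ n, (e n, ((2 * π * n / L : ℝ) : ℂ) • e n) ∈ (momentum μ a b hμ
      (LinearMap.eqLocus (LinearMap.fst ℂ ℂ ℂ) (LinearMap.snd ℂ ℂ ℂ))).graph := by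
    intro n
    rw [momentum_graph _ _ _ _ h.measure_ac]
    refine ⟨E n, (hEs n).contDiffOn.absolutelyContinuousOnInterval, ?_, he n, ?_⟩
    · rw [LinearMap.mem_eqLocus]
      change E n a = E n b
      have hs : ∃ s : ℤ, b - a = s * L := by
        rcases abs_choice (b - a) with h1 | h1
        · exact ⟨1, by rw [hL, h1]; simp⟩
        · exact ⟨-1, by rw [hL, h1]; simp⟩
      -- the exponents at `a` and `b` differ by a multiple of `2πi`, whatever the orientation
      obtain ⟨s, hs⟩ := hs
      have h3 : Complex.I * ((2 * π * n / L * b : ℝ) : ℂ) =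
          Complex.I * ((2 * π * n / L * a : ℝ) : ℂ) + ((n * s : ℤ) : ℂ) * (2 * π * Complex.I) := by
        rw [show b = a + s * L by linarith]
        have hLc : (L : ℂ) ≠ 0 := by exact_mod_cast hL0.ne'
        push_cast
        field_simp
      simp only [E]
      rw [h3, Complex.exp_add, Complex.exp_int_mul_two_pi_mul_I, mul_one]
    · filter_upwards [Lp.coeFn_smul ((2 * π * n / L : ℝ) : ℂ) (e n), he n] with x h1 h2
      rw [h1, Pi.smul_apply, h2, hEd, smul_eq_mul]
      linear_combination (((2 * π * n / L : ℝ) : ℂ) * E n x) * Complex.I_mul_I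
  have hsa := IsVolterra.isSelfAdjoint_periodic (h.mem_periodic_graph_iff hμ) h.isVolterra
  have hnorm : ∀ x n, (starRingEnd ℂ) (E n x) * E n x = (r : ℂ) * r := by
    intro x n
    rw [← Complex.normSq_eq_conj_mul_self, Complex.normSq_eq_norm_sq, norm_mul, norm_exp_I_mul,
      mul_one, Complex.norm_real, Real.norm_eq_abs, sq_abs]
    push_cast; ring
  have horth : Orthonormal ℂ e := by
    rw [orthonormal_iff_ite]
    intro n k
    split_ifs with hnk
    · subst hnk
      rw [L2.inner_def]
      have h1 : ∫ x, ⟪e n x, e n x⟫_ℂ ∂μ = ∫ x, (r : ℂ) * r ∂μ := by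
        refine integral_congr_ae ?_
        filter_upwards [he n] with x hx
        rw [hx, ← hnorm x n, RCLike.inner_apply, mul_comm]
      rw [h1, integral_const, measureReal_def, h.measure_univ, ENNReal.toReal_ofReal hcL.le,
        Complex.real_smul]
      norm_cast
      rw [hr, ← mul_inv, Real.mul_self_sqrt hcL.le, mul_inv_cancel₀ hcL.ne']
    -- eigenvectors to different eigenvalues are orthogonal
    · have h1 := inner_eq_of_isSelfAdjoint hsa (hgraph n) (hgraph k)
      rw [inner_smul_left, inner_smul_right, Complex.conj_ofReal] at h1
      have h2 : (((2 * π * n / L : ℝ) : ℂ) - ((2 * π * k / L : ℝ) : ℂ)) * ⟪e n, e k⟫_ℂ = 0 := by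
        rw [sub_mul, h1, sub_self]
      rcases mul_eq_zero.1 h2 with h3 | h3
      · exfalso
        rw [sub_eq_zero] at h3
        have h4 : 2 * π * n / L = 2 * π * k / L := by exact_mod_cast h3
        rw [div_left_inj' hL0.ne', mul_right_inj' (by positivity)] at h4
        exact hnk (by exact_mod_cast h4)
      · exact h3
  have hcomplete : (Submodule.span ℂ (range e))ᗮ = ⊥ := by
    refine (Submodule.eq_bot_iff _).2 fun f hf => ?_
    have hlt : min a b < max a b := min_lt_max.2 h.ne
    have hLm : max a b - min a b = L := max_sub_min_eq_abs a b
    have hres : volume.restrict (Ioc (min a b) (max a b)) = volume.restrict (uIcc a b) :=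
      Measure.restrict_congr_set Ioc_ae_eq_Icc
    have hfm : MemLp f 2 (volume.restrict (Ioc (min a b) (max a b))) := by
      rw [hres]
      exact h.memLp_volume (Lp.memLp f)
    have h0 := eq_zero_of_fourierCoeffOn hlt hfm fun n => by
      have h1 := (Submodule.mem_orthogonal _ _).1 hf (e n) (Submodule.subset_span ⟨n, rfl⟩)
      have h2 : ⟪e n, f⟫_ℂ = (c * r : ℝ) * ∫ x in uIcc a b,
          Complex.exp (-(Complex.I * ((2 * π * n / L * x : ℝ) : ℂ))) * f x := by
        rw [L2.inner_def]
        have h3 : ∫ x, ⟪e n x, f x⟫_ℂ ∂μ = ∫ x, (r : ℂ) *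
            (Complex.exp (-(Complex.I * ((2 * π * n / L * x : ℝ) : ℂ))) * f x) ∂μ := by
          refine integral_congr_ae ?_
          filter_upwards [he n] with x hx
          rw [hx, RCLike.inner_apply]
          simp only [E, map_mul, Complex.conj_ofReal, ← Complex.exp_conj, Complex.conj_I]
          ring_nf
        rw [h3, integral_const_mul, h.integral_eq, setIntegral_uIcc]
        push_cast; ring
      rw [h1] at h2
      have h4 : ((c * r : ℝ) : ℂ) ≠ 0 := by exact_mod_cast mul_ne_zero h.pos.ne' hr0
      have h5 := (mul_eq_zero.1 h2.symm).resolve_left h4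
      rw [fourierCoeffOn_eq_integral, intervalIntegral.integral_of_le hlt.le, hres]
      rw [show (∫ x in uIcc a b,
        fourier (-n) (x : AddCircle (max a b - min a b)) • f x) = 0 from ?_,
        smul_zero]
      rw [← h5]
      refine integral_congr_ae (Filter.Eventually.of_forall fun x => ?_)
      simp only [fourier_coe_apply, hLm, smul_eq_mul]
      congr 2
      push_cast
      ring
    apply Lp.ext
    rw [hres] at h0
    rw [Filter.EventuallyEq, h.ae_iff]
    have h1 := Lp.coeFn_zero ℂ 2 μ
    rw [Filter.EventuallyEq, h.ae_iff] at h1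
    filter_upwards [h0, h1] with x h2 h3
    rw [h2, h3]
  refine ⟨r, HilbertBasis.mkOfOrthogonalEqBot horth hcomplete, ?_, ?_⟩ <;>
    rw [HilbertBasis.coe_mkOfOrthogonalEqBot]
  · exact he
  · exact hgraph


/-! ### Regularity of the phase -/

theorem HasWinding.contDiff_phase {lam : ℝ → ℂ} {m : ℤ} {θ : ℝ → ℝ} (h : HasWinding lam m θ)
    (hlam : ContDiff ℝ 2 lam) : ContDiff ℝ 2 (phase m θ) := by
  have hg : Continuous (phase m θ) := (continuous_const.mul continuous_id).add h.1
  rw [contDiff_iff_contDiffAt]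
  intro k₀
  have hne : lam k₀ ≠ 0 := by rw [h.2.2]; exact Complex.exp_ne_zero _
  -- near `k₀` the phase is a branch of the logarithm
  have hev : phase m θ =ᶠ[nhds k₀]
      fun k => phase m θ k₀ + (Complex.log (lam k / lam k₀)).im := by
    have h1 : ∀ᶠ k in nhds k₀, phase m θ k ∈ Ioo (phase m θ k₀ - π) (phase m θ k₀ + π) :=
      hg.continuousAt.eventually_mem (Ioo_mem_nhds (by linarith [Real.pi_pos])
        (by linarith [Real.pi_pos]))
    filter_upwards [h1] with k hk
    rw [h.2.2 k, h.2.2 k₀, ← Complex.exp_sub, ← mul_sub, ← Complex.ofReal_sub, mul_comm Complex.I,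
      Complex.log_exp]
    · simp
    · simp; linarith [hk.1]
    · simp; linarith [hk.2]
  refine ContDiffAt.congr_of_eventuallyEq ?_ hev
  have h2 : ContDiffAt ℝ 2 (fun k => Complex.log (lam k / lam k₀)) k₀ := by
    have h3 : ContDiffAt ℝ 2 Complex.log (lam k₀ / lam k₀) := by
      rw [div_self hne]
      exact (Complex.contDiffAt_log Complex.one_mem_slitPlane).restrict_scalars ℝ
    exact h3.comp k₀ (hlam.contDiffAt.div_const _)
  exact contDiffAt_const.add (Complex.imCLM.contDiff.contDiffAt.comp k₀ h2)

theorem HasWinding.deriv_phase {lam : ℝ → ℂ} {m : ℤ} {θ : ℝ → ℝ} (h : HasWinding lam m θ)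
    (hlam : ContDiff ℝ 2 lam) (k : ℝ) : deriv (phase m θ) k = m + deriv θ k := by
  have h1 := (h.contDiff_phase hlam).differentiable two_ne_zero k
  have h2 : θ = fun k => phase m θ k - m * k := by ext k; simp [phase]
  have h3 : HasDerivAt θ (deriv (phase m θ) k - m * 1) k := by
    exact (h1.hasDerivAt.sub ((hasDerivAt_id k).const_mul (m : ℝ))).congr_of_eventuallyEq
      (Filter.Eventually.of_forall fun k => congrFun h2 k)
  rw [h3.deriv]; ring

theorem periodic_deriv {E : Type*} [NormedAddCommGroup E] [NormedSpace ℝ E] {f : ℝ → E} {c : ℝ}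
    (h : Function.Periodic f c) : Function.Periodic (deriv f) c := by
  intro k
  conv_rhs => rw [← funext h]
  rw [deriv_comp_add_const]

theorem HasWinding.periodic_deriv_phase {lam : ℝ → ℂ} {m : ℤ} {θ : ℝ → ℝ}
    (h : HasWinding lam m θ) (hlam : ContDiff ℝ 2 lam) :
    Function.Periodic (deriv (phase m θ)) (2 * π) := by
  intro k
  rw [h.deriv_phase hlam, h.deriv_phase hlam, periodic_deriv h.2.1 k]

theorem HasWinding.deriv_eq {lam : ℝ → ℂ} {m : ℤ} {θ : ℝ → ℝ}
    (h : HasWinding lam m θ) (hlam : ContDiff ℝ 2 lam) (k : ℝ) :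
    deriv lam k = 0 ↔ deriv (phase m θ) k = 0 := by
  have h1 := ((h.contDiff_phase hlam).differentiable two_ne_zero k).hasDerivAt.ofReal_comp
  have h2 := (h1.const_mul Complex.I).cexp
  have h3 : lam = fun k => Complex.exp (Complex.I * (phase m θ k : ℂ)) := funext h.2.2
  rw [h3, h2.deriv]
  simp

theorem phase_add_two_pi {lam : ℝ → ℂ} {m : ℤ} {θ : ℝ → ℝ} (h : HasWinding lam m θ) (k : ℝ) :
    phase m θ (k + 2 * π) = phase m θ k + 2 * π * m := by
  simp only [phase, h.2.1 k]; ring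

/-! ### Monotone pieces -/

/-- `g` is strictly monotone in one of the two directions on `[x, y]`. -/
def StrictMonoOrAnti (g : ℝ → ℝ) (x y : ℝ) : Prop :=
  StrictMonoOn g (Icc x y) ∨ StrictAntiOn g (Icc x y)

theorem strictMonoOrAnti_of_deriv_ne_zero {g : ℝ → ℝ} (hg : ContDiff ℝ 2 g) {x y : ℝ}
    (hxy : x ≤ y) (h : ∀ k ∈ Ioo x y, deriv g k ≠ 0) : StrictMonoOrAnti g x y := by
  refine ContinuousOn.strictMonoOn_of_injOn_Icc' hxy hg.continuous.continuousOn ?_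
  have key : ∀ s ∈ Icc x y, ∀ t ∈ Icc x y, s < t → g s ≠ g t := by
    intro s hs t ht hst heq
    obtain ⟨c, hc, hc'⟩ := exists_deriv_eq_zero hst hg.continuous.continuousOn heq
    exact h c ⟨hs.1.trans_lt hc.1, hc.2.trans_le ht.2⟩ hc'
  intro s hs t ht hst
  rcases lt_trichotomy s t with h1 | h1 | h1
  · exact absurd hst (key s hs t ht h1)
  · exact h1
  · exact absurd hst.symm (key t ht s hs h1)

namespace StrictMonoOrAnti

variable {g : ℝ → ℝ} {x y : ℝ}

theorem injOn (h : StrictMonoOrAnti g x y) : InjOn g (Icc x y) :=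
  h.elim StrictMonoOn.injOn StrictAntiOn.injOn

theorem mono (h : StrictMonoOrAnti g x y) {s t : ℝ} (hst : Icc s t ⊆ Icc x y) :
    StrictMonoOrAnti g s t :=
  h.imp (fun h => h.mono hst) (fun h => h.mono hst)

theorem image_Icc (h : StrictMonoOrAnti g x y) (hg : Continuous g) (hxy : x ≤ y) :
    g '' Icc x y = uIcc (g x) (g y) := by
  apply Subset.antisymm
  · rintro _ ⟨k, hk, rfl⟩
    rcases h with h | h
    · exact Icc_subset_uIcc ⟨h.monotoneOn (left_mem_Icc.2 hxy) hk hk.1,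
        h.monotoneOn hk (right_mem_Icc.2 hxy) hk.2⟩
    · exact Icc_subset_uIcc' ⟨h.antitoneOn hk (right_mem_Icc.2 hxy) hk.2,
        h.antitoneOn (left_mem_Icc.2 hxy) hk hk.1⟩
  · rw [← uIcc_of_le hxy]
    exact intermediate_value_uIcc hg.continuousOn

theorem image_Ioo (h : StrictMonoOrAnti g x y) (hg : Continuous g) (hxy : x ≤ y) :
    g '' Ioo x y = uIoo (g x) (g y) := by
  rw [← Icc_sdiff_both, h.injOn.image_sdiff_subset (by
    rintro k (rfl | rfl)
    · exact left_mem_Icc.2 hxy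
    · exact right_mem_Icc.2 hxy), h.image_Icc hg hxy, image_pair]
  rw [uIcc, uIoo, ← Icc_sdiff_both]
  congr 1
  rcases le_total (g x) (g y) with h1 | h1
  · simp [h1]
  · simp [h1, pair_comm]

theorem ne (h : StrictMonoOrAnti g x y) (hxy : x < y) : g x ≠ g y := fun heq =>
  hxy.ne (h.injOn (left_mem_Icc.2 hxy.le) (right_mem_Icc.2 hxy.le) heq)

/-- Change of variables; no integrability is needed. -/
theorem integral_comp (h : StrictMonoOrAnti g x y) (hg : ContDiff ℝ 2 g) (hxy : x ≤ y)
    (v : ℝ → ℂ) : ∫ E in (g x)..(g y), v E = ∫ k in x..y, ((deriv g k : ℝ) : ℂ) * v (g k) := by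
  have hd : ∀ k ∈ Icc x y, HasDerivWithinAt g (deriv g k) (Icc x y) k := fun k _ =>
    ((hg.differentiable two_ne_zero) k).hasDerivAt.hasDerivWithinAt
  have key := integral_image_eq_integral_abs_deriv_smul measurableSet_Icc hd h.injOn v
  rw [h.image_Icc hg.continuous hxy] at key
  rw [intervalIntegral.integral_of_le hxy, ← integral_Icc_eq_integral_Ioc]
  have hsign : ∀ k ∈ Ioo x y, Ioo x y ∈ nhds k := fun k hk => isOpen_Ioo.mem_nhds hk
  rcases h with h | h
  · have h1 := h.monotoneOn (left_mem_Icc.2 hxy) (right_mem_Icc.2 hxy) hxy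
    rw [uIcc_of_le h1] at key
    rw [intervalIntegral.integral_of_le h1, ← integral_Icc_eq_integral_Ioc, key,
      integral_Icc_eq_integral_Ioo, integral_Icc_eq_integral_Ioo]
    refine setIntegral_congr_fun measurableSet_Ioo fun k hk => ?_
    have h2 : 0 ≤ deriv g k := by
      rw [← derivWithin_of_mem_nhds (hsign k hk)]
      exact (h.monotoneOn.mono Ioo_subset_Icc_self).derivWithin_nonneg
    simp only [abs_of_nonneg h2, Complex.real_smul]
  · have h1 := h.antitoneOn (left_mem_Icc.2 hxy) (right_mem_Icc.2 hxy) hxy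
    rw [uIcc_of_ge h1] at key
    rw [intervalIntegral.integral_of_ge h1, ← integral_Icc_eq_integral_Ioc, key,
      integral_Icc_eq_integral_Ioo, integral_Icc_eq_integral_Ioo, ← integral_neg]
    refine setIntegral_congr_fun measurableSet_Ioo fun k hk => ?_
    have h2 : deriv g k ≤ 0 := by
      rw [← derivWithin_of_mem_nhds (hsign k hk)]
      exact (h.antitoneOn.mono Ioo_subset_Icc_self).derivWithin_nonpos
    simp only [abs_of_nonpos h2, Complex.real_smul]
    push_cast; ring

end StrictMonoOrAnti

/-! ### Periodic functions -/

/-- The representative of `x` modulo `2π` in `(a, a + 2π]`. -/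
def window (a x : ℝ) : ℝ := toIocMod Real.two_pi_pos a x

theorem window_mem (a x : ℝ) : window a x ∈ Ioc a (a + 2 * π) := toIocMod_mem_Ioc _ _ _

theorem window_add (a x : ℝ) : window a (x + 2 * π) = window a x := toIocMod_add_right _ _ _

theorem window_of_mem {a x : ℝ} (h : x ∈ Ioc a (a + 2 * π)) : window a x = x :=
  (toIocMod_eq_self _).2 h

theorem exists_window_eq (a x : ℝ) : ∃ z : ℤ, x = window a x + z * (2 * π) :=
  ⟨toIocDiv Real.two_pi_pos a x, by
    have := toIocMod_add_toIocDiv_zsmul Real.two_pi_pos a x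
    rw [zsmul_eq_mul] at this
    exact this.symm⟩

theorem apply_window {α : Type*} {f : ℝ → α} (hf : Function.Periodic f (2 * π)) (a x : ℝ) :
    f (window a x) = f x := by
  obtain ⟨z, hz⟩ := exists_window_eq a x
  conv_rhs => rw [hz]
  exact (hf.int_mul z _).symm

theorem window_window (a b x : ℝ) : window a (window b x) = window a x :=
  apply_window (f := window a) (window_add a) b x

theorem measurable_window (a : ℝ) : Measurable (window a) := by
  have : window a = fun x => a + 2 * π - Int.fract ((a + 2 * π - x) / (2 * π)) * (2 * π) :=
    funext fun x => toIocMod_eq_sub_fract_mul _ _ _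
  rw [this]
  exact measurable_const.sub
    ((((measurable_const.sub measurable_id).div_const _).fract).mul_const _)

theorem ae_of_ae_Ioc {p : ℝ → Prop} (hp : ∀ x, p (x + 2 * π) ↔ p x) {a : ℝ}
    (h : ∀ᵐ x ∂volume.restrict (Ioc a (a + 2 * π)), p x) : ∀ᵐ x, p x := by
  have hfd := isAddFundamentalDomain_Ioc Real.two_pi_pos a volume
  rw [ae_iff] at h ⊢
  have hp' : Function.Periodic p (2 * π) := fun x => propext (hp x)
  refine hfd.measure_zero_of_invariant _ (fun g => ?_) ?_
  · obtain ⟨_, z, rfl⟩ := g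
    ext x
    rw [Set.mem_vadd_set_iff_neg_vadd_mem]
    change ¬ p (-(z • (2 * π)) + x) ↔ ¬ p x
    rw [neg_add_eq_sub, hp'.sub_zsmul_eq]
  · rwa [Measure.restrict_apply' measurableSet_Ioc] at h

/-- A periodic property holds almost everywhere on the circle if and only if it does on `ℝ`. -/
theorem ae_circle_iff {p : ℝ → Prop} (hp : ∀ x, p (x + 2 * π) ↔ p x) :
    (∀ᵐ x ∂circleMeasure, p x) ↔ ∀ᵐ x, p x := by
  have h1 : ae circleMeasure = ae (volume.restrict (Ioc 0 (0 + 2 * π))) := by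
    rw [isScaledLebesgue_circle.ae_iff, uIcc_of_le (by positivity), zero_add]
    rw [restrict_Ioc_eq_restrict_Icc]
  rw [h1]
  exact ⟨ae_of_ae_Ioc hp, fun h => ae_restrict_of_ae h⟩

theorem lintegral_circle_window (a : ℝ) (Φ : ℝ → ENNReal) :
    ∫⁻ x, Φ (window a x) ∂circleMeasure =
      ENNReal.ofReal (1 / (2 * π)) * ∫⁻ x in Ioc a (a + 2 * π), Φ x := by
  rw [circleMeasure, lintegral_smul_measure, smul_eq_mul]
  congr 1
  have h1 := (isAddFundamentalDomain_Ioc Real.two_pi_pos 0 volume).setLIntegral_eq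
    (isAddFundamentalDomain_Ioc Real.two_pi_pos a volume) (fun x => Φ (window a x)) (by
      rintro ⟨_, z, rfl⟩ x
      change Φ (window a (z • (2 * π) + x)) = Φ (window a x)
      rw [add_comm, (show Function.Periodic (window a) (2 * π) from window_add a).zsmul])
  rw [zero_add] at h1
  rw [← restrict_Ioc_eq_restrict_Icc, h1]
  exact setLIntegral_congr_fun measurableSet_Ioc fun x hx => by rw [window_of_mem hx]


/-! ### Weighted composition operators -/

/-- The map `φ` carries the measure `s² μ` to `ν`, so that `F ↦ s · (F ∘ φ)` is an isometry from
`L²(ν)` to `L²(μ)`. -/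
structure IsWeightedMap (μ ν : Measure ℝ) (φ s : ℝ → ℝ) : Prop where
  measurable_map : Measurable φ
  measurable_weight : Measurable s
  lintegral_eq : ∀ Φ : ℝ → ENNReal, Measurable Φ →
    ∫⁻ x, ENNReal.ofReal (s x ^ 2) * Φ (φ x) ∂μ = ∫⁻ y, Φ y ∂ν

namespace IsWeightedMap

variable {μ ν : Measure ℝ} {φ s : ℝ → ℝ}

theorem ae_comp (h : IsWeightedMap μ ν φ s) {p : ℝ → Prop} (hp : ∀ᵐ y ∂ν, p y) :
    ∀ᵐ x ∂μ, s x ≠ 0 → p (φ x) := by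
  obtain ⟨t, ht1, ht2, ht3⟩ := exists_measurable_superset_of_null (ae_iff.1 hp)
  have h1 := h.lintegral_eq (t.indicator 1) (measurable_one.indicator ht2)
  rw [lintegral_indicator_one ht2, ht3, lintegral_eq_zero_iff] at h1
  · filter_upwards [h1] with x hx hs
    by_contra hn
    have h2 : φ x ∈ t := ht1 hn
    simp only [indicator_of_mem h2, Pi.one_apply, mul_one, Pi.zero_apply,
      ENNReal.ofReal_eq_zero] at hx
    exact absurd hx (not_le.2 (by positivity))
  · exact ((h.measurable_weight.pow_const 2).ennreal_ofReal).mul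
      ((measurable_one.indicator ht2).comp h.measurable_map)

theorem congr_ae (h : IsWeightedMap μ ν φ s) {F G : ℝ → ℂ} (hFG : F =ᵐ[ν] G) :
    (fun x => (s x : ℂ) * F (φ x)) =ᵐ[μ] fun x => (s x : ℂ) * G (φ x) := by
  filter_upwards [h.ae_comp hFG] with x hx
  by_cases hs : s x = 0
  · simp [hs]
  · rw [hx hs]

theorem aestronglyMeasurable (h : IsWeightedMap μ ν φ s) {F : ℝ → ℂ}
    (hF : AEStronglyMeasurable F ν) :
    AEStronglyMeasurable (fun x => (s x : ℂ) * F (φ x)) μ := by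
  refine AEStronglyMeasurable.congr ?_ (h.congr_ae hF.ae_eq_mk.symm)
  exact ((Complex.measurable_ofReal.comp h.measurable_weight).mul
    (hF.stronglyMeasurable_mk.measurable.comp h.measurable_map)).aestronglyMeasurable

theorem eLpNorm_eq (h : IsWeightedMap μ ν φ s) {F : ℝ → ℂ} (hF : AEStronglyMeasurable F ν) :
    eLpNorm (fun x => (s x : ℂ) * F (φ x)) 2 μ = eLpNorm F 2 ν := by
  rw [eLpNorm_congr_ae (h.congr_ae hF.ae_eq_mk), eLpNorm_congr_ae hF.ae_eq_mk]
  have hm := hF.stronglyMeasurable_mk.measurable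
  rw [eLpNorm_eq_lintegral_rpow_enorm_toReal two_ne_zero ENNReal.ofNat_ne_top,
    eLpNorm_eq_lintegral_rpow_enorm_toReal two_ne_zero ENNReal.ofNat_ne_top,
    ← h.lintegral_eq _ (hm.enorm.pow_const _)]
  congr 2
  ext x
  rw [enorm_mul, ENNReal.mul_rpow_of_nonneg _ _ (by simp)]
  congr 1
  rw [ENNReal.toReal_ofNat, ENNReal.rpow_two, ← ofReal_norm, Complex.norm_real,
    Real.norm_eq_abs, ← ENNReal.ofReal_pow (abs_nonneg _), sq_abs]

theorem memLp_iff (h : IsWeightedMap μ ν φ s) {F : ℝ → ℂ} (hF : AEStronglyMeasurable F ν) :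
    MemLp (fun x => (s x : ℂ) * F (φ x)) 2 μ ↔ MemLp F 2 ν := by
  unfold MemLp
  rw [h.eLpNorm_eq hF]
  exact ⟨fun h' => ⟨hF, h'.2⟩, fun h' => ⟨h.aestronglyMeasurable hF, h'.2⟩⟩

/-- The isometry `F ↦ s · (F ∘ φ)`. -/
def isometry (h : IsWeightedMap μ ν φ s) : Lp ℂ 2 ν →ₗᵢ[ℂ] Lp ℂ 2 μ where
  toFun F := ((h.memLp_iff (Lp.aestronglyMeasurable F)).2 (Lp.memLp F)).toLp _
  map_add' F G := by
    rw [← MemLp.toLp_add]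
    apply MemLp.toLp_congr
    filter_upwards [h.congr_ae (Lp.coeFn_add F G)] with x hx
    simp only [hx, Pi.add_apply, mul_add]
  map_smul' r F := by
    rw [RingHom.id_apply, ← MemLp.toLp_const_smul]
    apply MemLp.toLp_congr
    filter_upwards [h.congr_ae (Lp.coeFn_smul r F)] with x hx
    simp only [hx, Pi.smul_apply, smul_eq_mul]
    ring
  norm_map' F := by
    change ‖MemLp.toLp _ ((h.memLp_iff (Lp.aestronglyMeasurable F)).2 (Lp.memLp F))‖ = _
    rw [Lp.norm_toLp, h.eLpNorm_eq (Lp.aestronglyMeasurable F), Lp.norm_def]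

theorem coe_isometry (h : IsWeightedMap μ ν φ s) (F : Lp ℂ 2 ν) :
    h.isometry F =ᵐ[μ] fun x => (s x : ℂ) * F (φ x) :=
  MemLp.coeFn_toLp ((h.memLp_iff (Lp.aestronglyMeasurable F)).2 (Lp.memLp F))

end IsWeightedMap

/-! ### The unitary change of variables -/

/-- The points `a 0 < ⋯ < a n = a 0 + 2π` cut a period into intervals on which the phase `g`, a
`C²` function with `2π`-periodic derivative, has no critical points. -/
structure PhasePartition (g : ℝ → ℝ) {n : ℕ} (a : Fin (n + 1) → ℝ) : Prop where
  contDiff : ContDiff ℝ 2 g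
  periodic : Function.Periodic (deriv g) (2 * π)
  strictMono : StrictMono a
  last : a (Fin.last n) = a 0 + 2 * π
  deriv_ne_zero : ∀ j : Fin n, ∀ k ∈ Ioo (a j.castSucc) (a j.succ), deriv g k ≠ 0

theorem exists_mem_Ioc_of_partition {n : ℕ} (a : Fin (n + 1) → ℝ) {x : ℝ} (h0 : a 0 < x)
    (h1 : x ≤ a (Fin.last n)) : ∃ j : Fin n, x ∈ Ioc (a j.castSucc) (a j.succ) := by
  induction n with
  | zero => exact absurd h0 (not_lt.2 h1)
  | succ n ih =>
    by_cases h2 : x ≤ a (Fin.last n).castSucc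
    · obtain ⟨j, hj⟩ := ih (fun i => a i.castSucc) h0 h2
      exact ⟨j.castSucc, hj⟩
    · exact ⟨Fin.last n, not_le.1 h2, h1⟩

theorem ae_circle_mem : ∀ᵐ k ∂circleMeasure, k ∈ Ioc 0 (0 + 2 * π) := by
  have h1 : ae circleMeasure = ae (volume.restrict (Ioc 0 (0 + 2 * π))) := by
    rw [isScaledLebesgue_circle.ae_iff, uIcc_of_le (by positivity), zero_add,
      restrict_Ioc_eq_restrict_Icc]
  rw [h1]
  exact ae_restrict_mem measurableSet_Ioc

theorem coeFn_sum {ι : Type*} {μ : Measure ℝ} (s : Finset ι) (f : ι → Lp ℂ 2 μ) :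
    (∑ i ∈ s, f i : Lp ℂ 2 μ) =ᵐ[μ] fun x => ∑ i ∈ s, f i x := by
  classical
  induction s using Finset.induction_on with
  | empty =>
    simp only [Finset.sum_empty]
    exact Lp.coeFn_zero ℂ 2 μ
  | insert i s hi ih =>
    rw [Finset.sum_insert hi]
    filter_upwards [Lp.coeFn_add (f i) (∑ i ∈ s, f i), ih] with x h1 h2
    rw [h1, Pi.add_apply, h2, Finset.sum_insert hi]

namespace PhasePartition

variable {g : ℝ → ℝ} {n : ℕ} {a : Fin (n + 1) → ℝ}

theorem lt (h : PhasePartition g a) (j : Fin n) : a j.castSucc < a j.succ :=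
  h.strictMono (Fin.castSucc_lt_succ)

theorem strictMonoOrAnti (h : PhasePartition g a) (j : Fin n) :
    StrictMonoOrAnti g (a j.castSucc) (a j.succ) :=
  strictMonoOrAnti_of_deriv_ne_zero h.contDiff (h.lt j).le (h.deriv_ne_zero j)

theorem ne (h : PhasePartition g a) (j : Fin n) : g (a j.castSucc) ≠ g (a j.succ) :=
  (h.strictMonoOrAnti j).ne (h.lt j)

theorem continuous_deriv (h : PhasePartition g a) : Continuous (deriv g) :=
  h.contDiff.continuous_deriv one_le_two

theorem Ioo_subset (h : PhasePartition g a) (j : Fin n) :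
    Ioo (a j.castSucc) (a j.succ) ⊆ Ioc (a 0) (a 0 + 2 * π) := by
  rw [← h.last]
  exact fun x hx => ⟨(h.strictMono.monotone (Fin.zero_le _)).trans_lt hx.1,
    hx.2.le.trans (h.strictMono.monotone (Fin.le_last _))⟩

theorem eq_of_mem (h : PhasePartition g a) {i j : Fin n} {x : ℝ}
    (hi : x ∈ Ioo (a i.castSucc) (a i.succ)) (hj : x ∈ Ioo (a j.castSucc) (a j.succ)) : i = j := by
  have key : ∀ i j : Fin n, x ∈ Ioo (a i.castSucc) (a i.succ) →
      x ∈ Ioo (a j.castSucc) (a j.succ) → ¬ i < j := by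
    intro i j hi hj hij
    have h1 : a i.succ ≤ a j.castSucc := h.strictMono.monotone (Fin.succ_le_castSucc_iff.2 hij)
    exact absurd (hj.1.trans hi.2) (not_lt.2 h1)
  exact le_antisymm (not_lt.1 (key j i hj hi)) (not_lt.1 (key i j hi hj))

theorem ae_exists_mem (h : PhasePartition g a) :
    ∀ᵐ k, ∃ j : Fin n, window (a 0) k ∈ Ioo (a j.castSucc) (a j.succ) := by
  have hc : (⋃ i : Fin (n + 1), range fun z : ℤ => a i + z * (2 * π)).Countable :=
    countable_iUnion fun i => countable_range _
  filter_upwards [hc.ae_notMem volume] with k hk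
  have h1 := window_mem (a 0) k
  obtain ⟨j, hj⟩ := exists_mem_Ioc_of_partition a h1.1 (h1.2.trans h.last.ge)
  refine ⟨j, hj.1, hj.2.lt_of_ne fun heq => hk ?_⟩
  obtain ⟨z, hz⟩ := exists_window_eq (a 0) k
  rw [heq] at hz
  exact mem_iUnion.2 ⟨j.succ, z, hz.symm⟩

theorem deriv_window (h : PhasePartition g a) (k : ℝ) :
    deriv g (window (a 0) k) = deriv g k := apply_window h.periodic _ _

theorem ae_deriv_ne_zero (h : PhasePartition g a) : ∀ᵐ k, deriv g k ≠ 0 := by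
  filter_upwards [h.ae_exists_mem] with k ⟨j, hj⟩
  rw [← h.deriv_window]
  exact h.deriv_ne_zero j _ hj

/-- The weight of the change of variables `E = g(k)` on the `j`-th interval, extended periodically
in `k` and by zero to the other intervals. The factor `2π` makes up for the normalization of
`circleMeasure`. -/
def weight (_ : PhasePartition g a) (j : Fin n) (k : ℝ) : ℝ :=
  (Ioo (a j.castSucc) (a j.succ)).indicator (fun x => √(2 * π * |deriv g x|)) (window (a 0) k)

theorem weight_of_mem (h : PhasePartition g a) {j : Fin n} {k : ℝ}
    (hk : window (a 0) k ∈ Ioo (a j.castSucc) (a j.succ)) :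
    h.weight j k = √(2 * π * |deriv g k|) := by
  rw [weight, indicator_of_mem hk, h.deriv_window]

theorem weight_of_notMem (h : PhasePartition g a) {j : Fin n} {k : ℝ}
    (hk : window (a 0) k ∉ Ioo (a j.castSucc) (a j.succ)) : h.weight j k = 0 :=
  indicator_of_notMem hk _

theorem isWeightedMap (h : PhasePartition g a) (j : Fin n) :
    IsWeightedMap circleMeasure
      (volume.restrict (uIcc (g (a j.castSucc)) (g (a j.succ)))) (fun k => g (window (a 0) k))
      (h.weight j) where
  measurable_map := h.contDiff.continuous.measurable.comp (measurable_window _)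
  measurable_weight := by
    refine Measurable.comp (Measurable.indicator ?_ measurableSet_Ioo) (measurable_window _)
    exact (Real.continuous_sqrt.comp (continuous_const.mul h.continuous_deriv.abs)).measurable
  lintegral_eq Φ hΦ := by
    have hd : ∀ k ∈ Ioo (a j.castSucc) (a j.succ), HasDerivWithinAt g (deriv g k)
        (Ioo (a j.castSucc) (a j.succ)) k := fun k _ =>
      ((h.contDiff.differentiable two_ne_zero) k).hasDerivAt.hasDerivWithinAt
    have hinj := (h.strictMonoOrAnti j).injOn.mono Ioo_subset_Icc_self
    have h1 := lintegral_image_eq_lintegral_abs_deriv_mul measurableSet_Ioo hd hinj Φ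
    rw [(h.strictMonoOrAnti j).image_Ioo h.contDiff.continuous (h.lt j).le] at h1
    have h2 : volume.restrict (uIcc (g (a j.castSucc)) (g (a j.succ))) =
        volume.restrict (uIoo (g (a j.castSucc)) (g (a j.succ))) :=
      Measure.restrict_congr_set Ioo_ae_eq_Icc.symm
    rw [h2, h1]
    let Ψ : ℝ → ENNReal := (Ioo (a j.castSucc) (a j.succ)).indicator fun x =>
      ENNReal.ofReal (2 * π * |deriv g x|) * Φ (g x)
    have h3 : ∀ k, ENNReal.ofReal (h.weight j k ^ 2) * Φ (g (window (a 0) k)) =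
        Ψ (window (a 0) k) := by
      intro k
      by_cases hk : window (a 0) k ∈ Ioo (a j.castSucc) (a j.succ)
      · rw [h.weight_of_mem hk, Real.sq_sqrt (by positivity), ← h.deriv_window]
        simp only [Ψ, indicator_of_mem hk]
      · rw [h.weight_of_notMem hk]
        simp only [Ψ, indicator_of_notMem hk]
        simp
    simp only [h3]
    rw [lintegral_circle_window]
    simp only [Ψ]
    rw [setLIntegral_indicator measurableSet_Ioo, inter_eq_left.2 (h.Ioo_subset j),
      ← lintegral_const_mul']
    · refine lintegral_congr fun x => ?_
      rw [← mul_assoc, ← ENNReal.ofReal_mul (by positivity)]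
      congr 2
      field_simp
    · exact ENNReal.ofReal_ne_top

/-- The Hilbert space `⨁ⱼ L²(g(Iⱼ))`. -/
abbrev Target (g : ℝ → ℝ) {n : ℕ} (a : Fin (n + 1) → ℝ) : Type :=
  PiLp 2 fun j : Fin n => L2Interval (g (a j.castSucc)) (g (a j.succ))

theorem orthogonalFamily (h : PhasePartition g a) :
    OrthogonalFamily ℂ (fun j : Fin n => L2Interval (g (a j.castSucc)) (g (a j.succ)))
      (fun j => (h.isWeightedMap j).isometry) := by
  intro i j hij F G
  rw [L2.inner_def]
  refine integral_eq_zero_of_ae ?_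
  filter_upwards [(h.isWeightedMap i).coe_isometry F, (h.isWeightedMap j).coe_isometry G]
    with k h1 h2
  by_cases hk : window (a 0) k ∈ Ioo (a i.castSucc) (a i.succ)
  · have hk' : window (a 0) k ∉ Ioo (a j.castSucc) (a j.succ) := fun h' => hij (h.eq_of_mem hk h')
    rw [h2, h.weight_of_notMem hk']
    simp
  · rw [h1, h.weight_of_notMem hk]
    simp

/-- The isometry from `⨁ⱼ L²(g(Iⱼ))` to `K1` given by the change of variables `E = g(k)`. -/
def isometry (h : PhasePartition g a) : Target g a →ₗᵢ[ℂ] K1 where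
  toFun x := ∑ j, (h.isWeightedMap j).isometry (x j)
  map_add' x y := by simp [Finset.sum_add_distrib]
  map_smul' c x := by simp [Finset.smul_sum]
  norm_map' x := by
    have h1 := h.orthogonalFamily.norm_sum (fun j => x j) Finset.univ
    rw [← PiLp.norm_sq_eq_of_L2] at h1
    exact (sq_eq_sq₀ (norm_nonneg _) (norm_nonneg _)).1 h1

theorem ae_isometry (h : PhasePartition g a) (x : Target g a) :
    ∀ᵐ k ∂circleMeasure, ∀ j, window (a 0) k ∈ Ioo (a j.castSucc) (a j.succ) →
      h.isometry x k = √(2 * π * |deriv g k|) * x j (g (window (a 0) k)) := by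
  have h0 : h.isometry x = ∑ j, (h.isWeightedMap j).isometry (x j) := rfl
  have h1 : ∀ᵐ k ∂circleMeasure, ∀ j, (h.isWeightedMap j).isometry (x j) k =
      h.weight j k * x j (g (window (a 0) k)) :=
    ae_all_iff.2 fun j => (h.isWeightedMap j).coe_isometry (x j)
  have h2 : (h.isometry x : ℝ → ℂ) =ᵐ[circleMeasure]
      fun k => ∑ j, (h.isWeightedMap j).isometry (x j) k := by
    rw [h0]
    exact coeFn_sum _ _
  filter_upwards [h1, h2] with k h3 h4 j hj
  rw [h4, Finset.sum_eq_single j, h3, h.weight_of_mem hj]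
  · intro i _ hij
    rw [h3, h.weight_of_notMem fun hi => hij (h.eq_of_mem hi hj)]
    simp
  · simp

theorem ae_circle_exists_mem (h : PhasePartition g a) :
    ∀ᵐ k ∂circleMeasure, ∃ j : Fin n, window (a 0) k ∈ Ioo (a j.castSucc) (a j.succ) :=
  (ae_circle_iff fun x => by simp only [window_add]).2 h.ae_exists_mem

theorem isometry_eq_of_ae (h : PhasePartition g a) (x : Target g a) {f : K1}
    (hf : ∀ᵐ k ∂circleMeasure, ∀ j, window (a 0) k ∈ Ioo (a j.castSucc) (a j.succ) →
      f k = √(2 * π * |deriv g k|) * x j (g (window (a 0) k))) : h.isometry x = f := by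
  apply Lp.ext
  filter_upwards [hf, h.ae_isometry x, h.ae_circle_exists_mem] with k h1 h2 ⟨j, hj⟩
  rw [h1 j hj, h2 j hj]

theorem surjective_isometry (h : PhasePartition g a) : Function.Surjective h.isometry := by
  intro f
  let I : Fin n → Set ℝ := fun j => Icc (a j.castSucc) (a j.succ)
  -- on each interval, divide by the weight and compose with the inverse of `g`
  let F : Fin n → ℝ → ℂ := fun j E => f (window 0 (Function.invFunOn g (I j) E)) /
    (√(2 * π * |deriv g (Function.invFunOn g (I j) E)|) : ℝ)
  have hpos : ∀ (k : ℝ) (j : Fin n), window (a 0) k ∈ Ioo (a j.castSucc) (a j.succ) →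
      √(2 * π * |deriv g k|) ≠ 0 := by
    intro k j hj
    have h1 := h.deriv_ne_zero j _ hj
    rw [h.deriv_window] at h1
    exact Real.sqrt_ne_zero'.2 (by positivity)
  have key : ∀ k ∈ Ioc 0 (0 + 2 * π), ∀ j : Fin n, window (a 0) k ∈ Ioo (a j.castSucc) (a j.succ) →
      (√(2 * π * |deriv g k|) : ℝ) * F j (g (window (a 0) k)) = f k := by
    intro k hk j hj
    have h1 : Function.invFunOn g (I j) (g (window (a 0) k)) = window (a 0) k :=
      (h.strictMonoOrAnti j).injOn.leftInvOn_invFunOn (Ioo_subset_Icc_self hj)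
    have h2 : ((√(2 * π * |deriv g k|) : ℝ) : ℂ) ≠ 0 := by exact_mod_cast hpos k j hj
    simp only [F, h1, h.deriv_window, window_window, window_of_mem hk]
    field_simp
  have hF : ∀ j, MemLp (F j) 2 (volume.restrict (uIcc (g (a j.castSucc)) (g (a j.succ)))) := by
    intro j
    have himg := (h.strictMonoOrAnti j).image_Icc h.contDiff.continuous (h.lt j).le
    have hinv : AEMeasurable (Function.invFunOn g (I j))
        (volume.restrict (uIcc (g (a j.castSucc)) (g (a j.succ)))) := by
      rw [← himg]
      have hms : MeasurableSet (g '' I j) := by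
        simp only [I]; rw [himg]; exact measurableSet_uIcc
      rcases h.strictMonoOrAnti j with hm | hm
      · refine aemeasurable_restrict_of_monotoneOn hms ?_
        rintro _ ⟨s, hs, rfl⟩ _ ⟨t, ht, rfl⟩ hst
        rw [hm.injOn.leftInvOn_invFunOn hs, hm.injOn.leftInvOn_invFunOn ht]
        exact (hm.le_iff_le hs ht).1 hst
      · refine aemeasurable_restrict_of_antitoneOn hms ?_
        rintro _ ⟨s, hs, rfl⟩ _ ⟨t, ht, rfl⟩ hst
        rw [hm.injOn.leftInvOn_invFunOn hs, hm.injOn.leftInvOn_invFunOn ht]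
        exact (hm.le_iff_ge hs ht).1 hst
    have hmeas : AEStronglyMeasurable (F j)
        (volume.restrict (uIcc (g (a j.castSucc)) (g (a j.succ)))) := by
      have h1 : Measurable fun x => f (window 0 x) / ((√(2 * π * |deriv g x|) : ℝ) : ℂ) :=
        ((Lp.stronglyMeasurable f).measurable.comp (measurable_window 0)).div
          (Complex.measurable_ofReal.comp (Real.continuous_sqrt.comp
            (continuous_const.mul h.continuous_deriv.abs)).measurable)
      exact (h1.comp_aemeasurable hinv).aestronglyMeasurable
    rw [← (h.isWeightedMap j).memLp_iff hmeas]
    refine (Lp.memLp f).of_le ((h.isWeightedMap j).aestronglyMeasurable hmeas) ?_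
    filter_upwards [ae_circle_mem] with k hk
    by_cases hj : window (a 0) k ∈ Ioo (a j.castSucc) (a j.succ)
    · rw [h.weight_of_mem hj, key k hk j hj]
    · rw [h.weight_of_notMem hj]; simp
  refine ⟨WithLp.toLp 2 fun j => (hF j).toLp _, h.isometry_eq_of_ae _ ?_⟩
  have h1 : ∀ᵐ k ∂circleMeasure, ∀ j, h.weight j k ≠ 0 →
      (hF j).toLp _ (g (window (a 0) k)) = F j (g (window (a 0) k)) :=
    ae_all_iff.2 fun j => (h.isWeightedMap j).ae_comp (hF j).coeFn_toLp
  filter_upwards [h1, ae_circle_mem] with k h2 hk j hj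
  rw [← key k hk j hj]
  congr 1
  refine (h2 j ?_).symm
  rw [h.weight_of_mem hj]
  exact hpos k j hj

/-- The unitary `⨁ⱼ L²(g(Iⱼ)) → K1` given by the change of variables `E = g(k)`. -/
def unitary (h : PhasePartition g a) : Target g a ≃ₗᵢ[ℂ] K1 :=
  LinearIsometryEquiv.ofSurjective h.isometry h.surjective_isometry

end PhasePartition


/-! ### Periodic primitives and the operator `P` -/

theorem ae_circle_of_ae {p : ℝ → Prop} (h : ∀ᵐ x, p x) : ∀ᵐ x ∂circleMeasure, p x := by
  rw [isScaledLebesgue_circle.ae_iff]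
  exact ae_restrict_of_ae h

theorem locallyIntegrable_of_periodic {r : ℝ → ℂ} (hr : Function.Periodic r (2 * π))
    (h : MemLp r 2 circleMeasure) : LocallyIntegrable r := by
  have h1 : IntervalIntegrable r volume 0 (2 * π) := by
    have h2 := isScaledLebesgue_circle.integrable_indicator h
    rw [integrable_indicator_iff measurableSet_uIcc] at h2
    exact (intervalIntegrable_iff.2 (h2.mono_set uIoc_subset_uIcc))
  have h3 := hr.intervalIntegrable₀ (by positivity) h1
  rw [locallyIntegrable_iff]
  intro K hK
  obtain ⟨R, hR⟩ := hK.isBounded.subset_closedBall 0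
  rw [Real.closedBall_eq_Icc] at hR
  rcases le_total (0 - R) (0 + R) with h4 | h4
  · exact ((intervalIntegrable_iff_integrableOn_Icc_of_le h4).1 (h3 _ _)).mono_set hR
  · exact (integrableOn_singleton (hx := by simp)).mono_set (hR.trans fun x hx =>
      le_antisymm hx.2 (h4.trans hx.1))

theorem periodic_integral {r : ℝ → ℂ} (hr : Function.Periodic r (2 * π))
    (hl : LocallyIntegrable r) (a : ℝ) (h0 : ∫ t in a..(a + 2 * π), r t = 0) :
    Function.Periodic (fun x => ∫ t in a..x, r t) (2 * π) := by
  intro x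
  have hi := intervalIntegrable_of_locallyIntegrable hl
  simp only
  rw [← intervalIntegral.integral_add_adjacent_intervals (hi a x) (hi x (x + 2 * π)),
    hr.intervalIntegral_add_eq x a, h0, add_zero]

theorem ae_eq_window (v : ℝ → ℂ) : v =ᵐ[circleMeasure] fun x => v (window 0 x) := by
  filter_upwards [ae_circle_mem] with x hx
  rw [window_of_mem hx]

theorem memLp_window {v : ℝ → ℂ} (hv : MemLp v 2 circleMeasure) :
    MemLp (fun x => v (window 0 x)) 2 circleMeasure := hv.ae_eq (ae_eq_window v)

theorem periodic_window (v : ℝ → ℂ) (a : ℝ) :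
    Function.Periodic (fun x => v (window a x)) (2 * π) := fun x => by
  simp only [window_add]

/-- The functions in the domain of `P` extend to periodic primitives on `ℝ`. -/
theorem mem_P_graph_iff {f h : K1} : (f, h) ∈ P.graph ↔
    ∃ G r : ℝ → ℂ, Function.Periodic G (2 * π) ∧ Function.Periodic r (2 * π) ∧
      IsPrimitive G r ∧ f =ᵐ[circleMeasure] G ∧
      h =ᵐ[circleMeasure] fun x => -Complex.I * r x := by
  constructor
  · intro hfh
    obtain ⟨⟨z, hz⟩, h0⟩ := (isScaledLebesgue_circle.mem_periodic_graph_iff _ f h).1 hfh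
    have hper := periodic_window h 0
    have hl := locallyIntegrable_of_periodic hper (memLp_window (Lp.memLp h))
    have hint : ∀ x ∈ Icc 0 (2 * π), ∫ t in (0 : ℝ)..x, h (window 0 t) =
        primitiveOn 0 (2 * π) h x := by
      intro x hx
      rw [primitiveOn_eq _ (by rwa [uIcc_of_le (by positivity)])]
      refine intervalIntegral.integral_congr_ae (Filter.Eventually.of_forall fun t ht => ?_)
      rw [uIoc_of_le hx.1] at ht
      rw [window_of_mem]
      exact ⟨ht.1, by linarith [ht.2, hx.2]⟩
    have hG := ((IsPrimitive.of_integral hl 0).const_mul Complex.I).add_const z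
    refine ⟨_, _, ?_, ?_, hG, ?_, ?_⟩
    · have h1 := periodic_integral hper hl 0 (by
        rw [zero_add, hint _ ⟨by positivity, le_rfl⟩]
        exact (isScaledLebesgue_circle.primitiveOn_right h).2 h0)
      exact fun x => congrArg (fun t => Complex.I * t + z) (h1 x)
    · exact fun x => congrArg (fun t => Complex.I * t) (hper x)
    · rw [hz]
      have hm : ∀ᵐ x ∂circleMeasure, x ∈ Icc 0 (2 * π) := by
        filter_upwards [ae_circle_mem] with x hx
        exact ⟨hx.1.le, by simpa using hx.2⟩
      filter_upwards [isScaledLebesgue_circle.coe_add_volterra z h, hm] with x h1 h2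
      rw [h1, hint x h2, add_comm]
    · filter_upwards [ae_eq_window h] with x hx
      rw [← mul_assoc]
      simpa using hx
  · rintro ⟨G, r, hG, hr, hGr, h1, h2⟩
    rw [mem_P_graph]
    refine ⟨G, hGr.ac _ _, by simpa using (hG 0).symm, h1, ?_⟩
    filter_upwards [h2, ae_circle_of_ae hGr.ae_hasDerivAt] with x h3 h4
    rw [h3, h4.deriv]

theorem IsScaledLebesgue.memLp_mul {μ : Measure ℝ} {c a b : ℝ} (h : IsScaledLebesgue μ c a b)
    {φ r : ℝ → ℂ} (hφ : Continuous φ) (hr : MemLp r 2 μ) : MemLp (fun k => φ k * r k) 2 μ := by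
  obtain ⟨C, hC⟩ := (isCompact_uIcc (a := a) (b := b)).exists_bound_of_continuousOn hφ.continuousOn
  have hbound : ∀ᵐ k ∂μ, ‖φ k‖ ≤ C := by
    rw [h.ae_iff]
    exact ae_restrict_of_forall_mem measurableSet_uIcc hC
  have hm : AEStronglyMeasurable (fun k => φ k * r k) μ := hφ.aestronglyMeasurable.mul hr.1
  refine MemLp.of_le_mul (c := C) hr hm ?_
  filter_upwards [hbound] with k hk
  rw [norm_mul]
  gcongr

/-! ### The graph of the time operator -/

/-- The operator `½ (γ⁻¹ P + P γ⁻¹)`. -/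
def timeOpOf (γ : ℝ → ℝ) : K1 →ₗ.[ℂ] K1 :=
  (1 / 2 : ℂ) • (prodOp (mulOp circleMeasure fun k => 1 / (γ k : ℂ)) P +
    prodOp P (mulOp circleMeasure fun k => 1 / (γ k : ℂ)))

theorem timeOp_eq {lam : ℝ → ℂ} {m : ℤ} {θ : ℝ → ℝ} (h : HasWinding lam m θ)
    (hlam : ContDiff ℝ 2 lam) : timeOp m θ = timeOpOf (deriv (phase m θ)) := by
  have : invSpeed m θ = mulOp circleMeasure fun k => 1 / ((deriv (phase m θ) k : ℝ) : ℂ) := by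
    unfold invSpeed
    congr 1
    ext k
    rw [h.deriv_phase hlam]
    push_cast
    rfl
  rw [timeOp, timeOpOf, this]

theorem mem_timeOpOf_graph {γ : ℝ → ℝ} {f h : K1} : (f, h) ∈ (timeOpOf γ).graph ↔
    ∃ y y' z z' : K1, (f, y) ∈ P.graph ∧ z =ᵐ[circleMeasure] (fun k => 1 / (γ k : ℂ) * y k) ∧
      y' =ᵐ[circleMeasure] (fun k => 1 / (γ k : ℂ) * f k) ∧ (y', z') ∈ P.graph ∧
      h = (1 / 2 : ℂ) • (z + z') := by
  simp only [timeOpOf, mem_smul_graph, mem_add_graph, mem_prodOp_graph, mem_mulOp_graph]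
  constructor
  · rintro ⟨_, ⟨z, z', ⟨y, h1, h2⟩, ⟨y', h3, h4⟩, rfl⟩, h5⟩
    exact ⟨y, y', z, z', h1, h2, h3, h4, h5⟩
  · rintro ⟨y, y', z, z', h1, h2, h3, h4, h5⟩
    exact ⟨_, ⟨z, z', ⟨y, h1, h2⟩, ⟨y', h3, h4⟩, rfl⟩, h5⟩

/-- `γ` is a `C¹` function of period `2π` that is almost everywhere nonzero. -/
structure IsSpeed (γ : ℝ → ℝ) : Prop where
  contDiff : ContDiff ℝ 1 γ
  periodic : Function.Periodic γ (2 * π)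
  ae_ne_zero : ∀ᵐ k, γ k ≠ 0

theorem PhasePartition.isSpeed {g : ℝ → ℝ} {n : ℕ} {a : Fin (n + 1) → ℝ}
    (h : PhasePartition g a) : IsSpeed (deriv g) where
  contDiff := (contDiff_succ_iff_deriv (n := 1).1 h.contDiff).2.2
  periodic := h.periodic
  ae_ne_zero := h.ae_deriv_ne_zero

namespace IsSpeed

variable {γ : ℝ → ℝ}

theorem contDiff_ofReal (h : IsSpeed γ) : ContDiff ℝ 1 fun k => (γ k : ℂ) :=
  Complex.ofRealCLM.contDiff.comp h.contDiff

theorem deriv_ofReal (h : IsSpeed γ) (k : ℝ) :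
    deriv (fun k => (γ k : ℂ)) k = ((deriv γ k : ℝ) : ℂ) :=
  ((h.contDiff.differentiable one_ne_zero) k).hasDerivAt.ofReal_comp.deriv

/-- Where `f = γ u`, one has `γ⁻¹ f' = u' + (γ' / γ) u`, so that formally
`T f = -i (u' + ½ (γ' / γ) u)`. -/
theorem exists_of_mem_graph (h : IsSpeed γ) {f y : K1} (hfy : (f, y) ∈ (timeOpOf γ).graph) :
    ∃ u r : ℝ → ℂ, Function.Periodic u (2 * π) ∧ Function.Periodic r (2 * π) ∧
      IsPrimitive u r ∧ f =ᵐ[circleMeasure] (fun k => γ k * u k) ∧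
      y =ᵐ[circleMeasure] fun k =>
        -Complex.I * (r k + 1 / 2 * (((deriv γ k : ℝ) : ℂ) / γ k) * u k) := by
  obtain ⟨y₁, y₂, z₁, z₂, h1, h2, h3, h4, rfl⟩ := mem_timeOpOf_graph.1 hfy
  obtain ⟨G, s, hG, hs, hGs, h5, h6⟩ := mem_P_graph_iff.1 h1
  obtain ⟨u, r, hu, hr, hur, h7, h8⟩ := mem_P_graph_iff.1 h4
  have hγ := ae_circle_of_ae h.ae_ne_zero
  have h9 : f =ᵐ[circleMeasure] fun k => γ k * u k := by
    filter_upwards [h3, h7, hγ] with k h9 h10 h11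
    have : (γ k : ℂ) ≠ 0 := by exact_mod_cast h11
    rw [← h10, h9]
    field_simp
  have hprod := (IsPrimitive.of_contDiff h.contDiff_ofReal).mul hur
  have h10 : G = fun k => (γ k : ℂ) * u k := by
    have h11 : ∀ᵐ k, G k = γ k * u k := by
      refine (ae_circle_iff fun x => ?_).1 (h5.symm.trans h9)
      rw [hG, hu, h.periodic]
    exact Continuous.ae_eq_iff_eq volume hGs.continuous hprod.continuous |>.1 h11
  have h11 : ∀ᵐ k, s k = ((deriv γ k : ℝ) : ℂ) * u k + γ k * r k := by
    filter_upwards [hGs.ae_hasDerivAt, hprod.ae_hasDerivAt] with k h12 h13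
    rw [h10] at h12
    rw [h12.unique h13, h.deriv_ofReal]
  refine ⟨u, r, hu, hr, hur, h9, ?_⟩
  filter_upwards [Lp.coeFn_smul (1 / 2 : ℂ) (z₁ + z₂), Lp.coeFn_add z₁ z₂, h2, h6, h8, hγ,
    ae_circle_of_ae h11] with k k1 k2 k3 k4 k5 k6 k7
  have : (γ k : ℂ) ≠ 0 := by exact_mod_cast k6
  rw [k1, Pi.smul_apply, k2, Pi.add_apply, k3, k4, k5, k7, smul_eq_mul]
  field_simp
  ring

/-- The converse of `exists_of_mem_graph`. That `(γ' / γ) u` is square integrable is implied by the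
formula for `y`. -/
theorem mem_graph_of_primitive (h : IsSpeed γ) {f y : K1} {u r : ℝ → ℂ}
    (hu : Function.Periodic u (2 * π)) (hr : Function.Periodic r (2 * π)) (hur : IsPrimitive u r)
    (hr2 : MemLp r 2 circleMeasure) (hf : f =ᵐ[circleMeasure] fun k => γ k * u k)
    (hy : y =ᵐ[circleMeasure] fun k =>
      -Complex.I * (r k + 1 / 2 * (((deriv γ k : ℝ) : ℂ) / γ k) * u k)) :
    (f, y) ∈ (timeOpOf γ).graph := by
  have hγ := ae_circle_of_ae h.ae_ne_zero
  have hprod := (IsPrimitive.of_contDiff h.contDiff_ofReal).mul hur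
  simp only [h.deriv_ofReal] at hprod
  have hper := periodic_deriv h.periodic
  have hper1 : Function.Periodic (fun k => ((deriv γ k : ℝ) : ℂ) * u k + γ k * r k) (2 * π) := by
    intro k
    simp only [hper k, hu k, hr k, h.periodic k]
  have hm1 : MemLp (fun k => -Complex.I * (((deriv γ k : ℝ) : ℂ) * u k + γ k * r k)) 2
      circleMeasure :=
    ((isScaledLebesgue_circle.memLp_of_continuous ((Complex.continuous_ofReal.comp
      (h.contDiff.continuous_deriv le_rfl)).mul hur.continuous)).add
      (isScaledLebesgue_circle.memLp_mul h.contDiff_ofReal.continuous hr2)).const_mul _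
  have hm2 : MemLp (fun k => -Complex.I * r k) 2 circleMeasure := hr2.const_mul _
  have hmu := isScaledLebesgue_circle.memLp_of_continuous hur.continuous
  refine mem_timeOpOf_graph.2 ⟨hm1.toLp _, hmu.toLp _, (2 : ℂ) • y - hm2.toLp _, hm2.toLp _,
    ?_, ?_, ?_, ?_, ?_⟩
  · exact mem_P_graph_iff.2 ⟨_, _, (fun k => by simp only [hu k, h.periodic k]), hper1, hprod, hf,
      hm1.coeFn_toLp⟩
  · filter_upwards [Lp.coeFn_sub ((2 : ℂ) • y) (hm2.toLp _), Lp.coeFn_smul (2 : ℂ) y,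
      hm1.coeFn_toLp, hm2.coeFn_toLp, hy, hγ] with k k1 k2 k3 k4 k5 k6
    have : (γ k : ℂ) ≠ 0 := by exact_mod_cast k6
    rw [k1, Pi.sub_apply, k2, k3, k4, Pi.smul_apply, k5, smul_eq_mul]
    field_simp
    ring
  · filter_upwards [hmu.coeFn_toLp, hf, hγ] with k k1 k2 k3
    have : (γ k : ℂ) ≠ 0 := by exact_mod_cast k3
    rw [k1, k2]
    field_simp
  · exact mem_P_graph_iff.2 ⟨u, r, hu, hr, hur, hmu.coeFn_toLp, hm2.coeFn_toLp⟩
  · rw [sub_add_cancel, smul_smul]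
    norm_num

end IsSpeed


/-! ### Boundary values -/

/-- The signed square root `t / √|t|`. -/
def signedSqrt (t : ℝ) : ℝ := √t - √(-t)

theorem continuous_signedSqrt : Continuous signedSqrt :=
  Real.continuous_sqrt.sub (Real.continuous_sqrt.comp continuous_neg)

theorem signedSqrt_zero : signedSqrt 0 = 0 := by simp [signedSqrt]

theorem signedSqrt_mul_sqrt (t : ℝ) : signedSqrt t * √|t| = t := by
  rcases le_total 0 t with h | h
  · rw [signedSqrt, abs_of_nonneg h, Real.sqrt_eq_zero_of_nonpos (neg_nonpos.2 h), sub_zero,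
      Real.mul_self_sqrt h]
  · rw [signedSqrt, abs_of_nonpos h, Real.sqrt_eq_zero_of_nonpos h, zero_sub, neg_mul,
      Real.mul_self_sqrt (neg_nonneg.2 h), neg_neg]

theorem signedSqrt_mul_sqrt_two_pi (t : ℝ) : signedSqrt t * √(2 * π * |t|) = √(2 * π) * t := by
  rw [Real.sqrt_mul (by positivity), mul_left_comm, signedSqrt_mul_sqrt]

theorem hasDerivAt_signedSqrt {t : ℝ} (ht : t ≠ 0) :
    HasDerivAt signedSqrt (signedSqrt t / (2 * t)) t := by
  have h1 := (Real.hasDerivAt_sqrt ht).sub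
    ((Real.hasDerivAt_sqrt (neg_ne_zero.2 ht)).comp t (hasDerivAt_neg t))
  refine h1.congr_deriv ?_
  rcases lt_or_gt_of_ne ht with h | h
  · have h2 : √(-t) ≠ 0 := Real.sqrt_ne_zero'.2 (neg_pos.2 h)
    have h3 : √(-t) * √(-t) = -t := Real.mul_self_sqrt (neg_nonneg.2 h.le)
    rw [signedSqrt, Real.sqrt_eq_zero_of_nonpos h.le]
    field_simp
    rw [div_zero]
    linear_combination h3
  · have h2 : √t ≠ 0 := Real.sqrt_ne_zero'.2 h
    have h3 : √t * √t = t := Real.mul_self_sqrt h.le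
    rw [signedSqrt, Real.sqrt_eq_zero_of_nonpos (neg_nonpos.2 h.le)]
    field_simp
    rw [div_zero]
    linear_combination -h3

theorem contDiffAt_signedSqrt {t : ℝ} (ht : t ≠ 0) : ContDiffAt ℝ 1 signedSqrt t :=
  (Real.contDiffAt_sqrt ht).sub ((Real.contDiffAt_sqrt (neg_ne_zero.2 ht)).comp t
    contDiff_neg.contDiffAt)

namespace PhasePartition

variable {g : ℝ → ℝ} {n : ℕ} {a : Fin (n + 1) → ℝ}

theorem isometry_symm (h : PhasePartition g a) (y : K1) :
    h.isometry (h.unitary.symm y) = y := h.unitary.apply_symm_apply y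

theorem ae_unitary_symm (h : PhasePartition g a) (y : K1) :
    ∀ᵐ k, ∀ j : Fin n, k ∈ Ioo (a j.castSucc) (a j.succ) →
      y (window 0 k) = √(2 * π * |deriv g k|) * h.unitary.symm y j (g k) := by
  have h1 := h.ae_isometry (h.unitary.symm y)
  rw [h.isometry_symm] at h1
  have h2 : ∀ᵐ k ∂circleMeasure, ∀ j, window (a 0) k ∈ Ioo (a j.castSucc) (a j.succ) →
      y (window 0 k) = √(2 * π * |deriv g k|) * h.unitary.symm y j (g (window (a 0) k)) := by
    filter_upwards [h1, ae_eq_window y] with k h2 h3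
    rwa [← h3]
  rw [ae_circle_iff fun x => by simp only [window_add, h.periodic x]] at h2
  filter_upwards [h2] with k h3 j hj
  have h4 := window_of_mem (h.Ioo_subset j hj)
  have h5 := h3 j (by rwa [h4])
  rwa [h4] at h5

theorem uIcc_subset (h : PhasePartition g a) (j : Fin n) {c d : ℝ}
    (hc : c ∈ Icc (a j.castSucc) (a j.succ)) (hd : d ∈ Icc (a j.castSucc) (a j.succ)) :
    uIcc (g c) (g d) ⊆ uIcc (g (a j.castSucc)) (g (a j.succ)) := by
  have h1 := (h.strictMonoOrAnti j).image_Icc h.contDiff.continuous (h.lt j).le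
  exact uIcc_subset_uIcc (h1 ▸ mem_image_of_mem g hc) (h1 ▸ mem_image_of_mem g hd)

/-- The change of variables for `∫ E`, in terms of the function on the circle. -/
theorem integral_unitary_symm (h : PhasePartition g a) (y : K1) (j : Fin n) {c d : ℝ}
    (hc : c ∈ Icc (a j.castSucc) (a j.succ)) (hd : d ∈ Icc (a j.castSucc) (a j.succ))
    (hcd : c ≤ d) :
    ∫ k in c..d, (signedSqrt (deriv g k) : ℂ) * y (window 0 k) =
      √(2 * π) * ∫ E in (g c)..(g d), h.unitary.symm y j E := by
  rw [((h.strictMonoOrAnti j).mono (Icc_subset_Icc hc.1 hd.2)).integral_comp h.contDiff hcd,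
    ← intervalIntegral.integral_const_mul]
  refine intervalIntegral.integral_congr_ae ?_
  have h0 : ∀ᵐ k : ℝ, k ≠ a j.succ := compl_mem_ae_iff.2 (measure_singleton _)
  filter_upwards [h.ae_unitary_symm y, h0] with k h1 h2 h3
  rw [uIoc_of_le hcd] at h3
  rw [h1 j ⟨hc.1.trans_lt h3.1, (h3.2.trans hd.2).lt_of_ne h2⟩, ← mul_assoc, ← mul_assoc,
    ← Complex.ofReal_mul, signedSqrt_mul_sqrt_two_pi, Complex.ofReal_mul]

theorem scaled (h : PhasePartition g a) (j : Fin n) :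
    IsScaledLebesgue (volume.restrict (uIcc (g (a j.castSucc)) (g (a j.succ)))) 1
      (g (a j.castSucc)) (g (a j.succ)) := isScaledLebesgue_interval (h.ne j)

theorem primitiveOn_sub (h : PhasePartition g a) (j : Fin n)
    (v : L2Interval (g (a j.castSucc)) (g (a j.succ))) {c d : ℝ}
    (hc : c ∈ Icc (a j.castSucc) (a j.succ)) (hd : d ∈ Icc (a j.castSucc) (a j.succ)) :
    primitiveOn (g (a j.castSucc)) (g (a j.succ)) v (g d) -
      primitiveOn (g (a j.castSucc)) (g (a j.succ)) v (g c) = ∫ E in (g c)..(g d), v E := by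
  rw [((h.scaled j).isPrimitive (Lp.memLp v)).sub_eq]
  exact intervalIntegral.integral_congr fun t ht => indicator_of_mem (h.uIcc_subset j hc hd ht) _

/-- If `f = γ u` lies in the domain of `T`, then on each interval the function `γ u / √|γ|`, which
corresponds to `f` under the change of variables, is a primitive of the function corresponding to
`i T f`, up to the endpoints. -/
theorem exists_boundary_value (h : PhasePartition g a) {f y : K1}
    (hfy : (f, y) ∈ (timeOpOf (deriv g)).graph) :
    ∃ u : ℝ → ℂ, Function.Periodic u (2 * π) ∧ f =ᵐ[circleMeasure] (fun k => deriv g k * u k) ∧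
      ∀ j : Fin n, ∀ k ∈ Icc (a j.castSucc) (a j.succ),
        (signedSqrt (deriv g k) : ℂ) * u k =
          signedSqrt (deriv g (a j.castSucc)) * u (a j.castSucc) + √(2 * π) * (Complex.I *
            primitiveOn (g (a j.castSucc)) (g (a j.succ)) (h.unitary.symm y j) (g k)) := by
  obtain ⟨u, r, hu, hr, hur, hf, hy⟩ := h.isSpeed.exists_of_mem_graph hfy
  refine ⟨u, hu, hf, fun j => ?_⟩
  have hper := periodic_deriv h.periodic
  have hy' : ∀ᵐ k, y (window 0 k) = -Complex.I *
      (r k + 1 / 2 * (((deriv (deriv g) k : ℝ) : ℂ) / (deriv g k : ℝ)) * u k) := by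
    refine (ae_circle_iff fun k => ?_).1 ((ae_eq_window y).symm.trans hy)
    simp only [window_add, hr k, hu k, hper k, h.periodic k]
  have hint : ∀ c ∈ Ioo (a j.castSucc) (a j.succ), ∀ d ∈ Ioo (a j.castSucc) (a j.succ), c ≤ d →
      (signedSqrt (deriv g d) : ℂ) * u d - signedSqrt (deriv g c) * u c =
        Complex.I * (√(2 * π) * ∫ E in (g c)..(g d), h.unitary.symm y j E) := by
    intro c hc d hd hcd
    have hsub : uIcc c d ⊆ Ioo (a j.castSucc) (a j.succ) := by
      rw [uIcc_of_le hcd]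
      exact fun x hx => ⟨hc.1.trans_le hx.1, hx.2.trans_lt hd.2⟩
    rw [← h.integral_unitary_symm y j (Ioo_subset_Icc_self hc) (Ioo_subset_Icc_self hd) hcd,
      ← intervalIntegral.integral_const_mul]
    have hs : ContDiffOn ℝ 1 (fun k => (signedSqrt (deriv g k) : ℂ)) (uIcc c d) := fun k hk =>
      (Complex.ofRealCLM.contDiff.contDiffAt.comp k ((contDiffAt_signedSqrt
        (h.deriv_ne_zero j k (hsub hk))).comp k
          h.isSpeed.contDiff.contDiffAt)).contDiffWithinAt
    refine integral_of_ac (F := fun k => (signedSqrt (deriv g k) : ℂ) * u k)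
      (hs.absolutelyContinuousOnInterval.smul (hur.ac c d)) ?_ ?_
    · have hl := intervalIntegrable_of_locallyIntegrable (locallyIntegrable_of_periodic
        (periodic_window y 0) (memLp_window (Lp.memLp y))) c d
      exact (hl.continuousOn_mul (Complex.continuous_ofReal.comp (continuous_signedSqrt.comp
        h.continuous_deriv)).continuousOn).const_mul _
    · filter_upwards [hur.ae_hasDerivAt, hy'] with k h1 h2 hk
      have h0 := h.deriv_ne_zero j k (hsub hk)
      have h3 := ((hasDerivAt_signedSqrt h0).comp k
        ((h.isSpeed.contDiff.differentiable one_ne_zero) k).hasDerivAt).ofReal_comp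
      refine (h3.mul h1).congr_deriv ?_
      have h4 : ((deriv g k : ℝ) : ℂ) ≠ 0 := by exact_mod_cast h0
      rw [h2, Function.comp_apply]
      push_cast
      field_simp
      linear_combination ((signedSqrt (deriv g k) : ℂ) * (2 * r k * (deriv g k : ℝ) +
        u k * (deriv (deriv g) k : ℝ))) * Complex.I_sq
  -- the difference of the two sides is continuous, and constant inside the interval
  let D : ℝ → ℂ := fun k => (signedSqrt (deriv g k) : ℂ) * u k - √(2 * π) * (Complex.I *
    primitiveOn (g (a j.castSucc)) (g (a j.succ)) (h.unitary.symm y j) (g k))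
  have hD : Continuous D := by
    refine ((Complex.continuous_ofReal.comp (continuous_signedSqrt.comp h.continuous_deriv)).mul
      hur.continuous).sub (continuous_const.mul (continuous_const.mul ?_))
    exact ((h.scaled j).isPrimitive (Lp.memLp _)).continuous.comp h.contDiff.continuous
  have hDc : ∀ c ∈ Ioo (a j.castSucc) (a j.succ), ∀ d ∈ Ioo (a j.castSucc) (a j.succ), c ≤ d →
      D d = D c := by
    intro c hc d hd hcd
    have h1 := hint c hc d hd hcd
    rw [← h.primitiveOn_sub j _ (Ioo_subset_Icc_self hc) (Ioo_subset_Icc_self hd)] at h1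
    simp only [D]
    linear_combination h1
  obtain ⟨x, hx⟩ := nonempty_Ioo.2 (h.lt j)
  have hDx : EqOn D (fun _ => D x) (Icc (a j.castSucc) (a j.succ)) := by
    rw [← closure_Ioo (h.lt j).ne]
    refine EqOn.closure (fun c hc => ?_) hD continuous_const
    rcases le_total c x with h1 | h1
    · exact (hDc c hc x hx h1).symm
    · exact hDc x hx c hc h1
  intro k hk
  have h1 := (hDx hk).trans (hDx (left_mem_Icc.2 (h.lt j).le)).symm
  simp only [D, primitiveOn_left] at h1
  linear_combination h1

/-- Every element of the domain of `T` corresponds to elements of the maximal domains of `-i d/dx`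
on the intervals; the second identity compares the boundary values at the two endpoints. -/
theorem unitary_symm_of_mem_graph (h : PhasePartition g a) {f y : K1}
    (hfy : (f, y) ∈ (timeOpOf (deriv g)).graph) :
    ∃ u : ℝ → ℂ, Function.Periodic u (2 * π) ∧ ∀ j : Fin n,
      (h.unitary.symm f j = (signedSqrt (deriv g (a j.castSucc)) * u (a j.castSucc) / √(2 * π)) •
        (h.scaled j).one + Complex.I • (h.scaled j).volterra (h.unitary.symm y j)) ∧
      (signedSqrt (deriv g (a j.succ)) : ℂ) * u (a j.succ) =
        signedSqrt (deriv g (a j.castSucc)) * u (a j.castSucc) + √(2 * π) * (Complex.I *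
          primitiveOn (g (a j.castSucc)) (g (a j.succ)) (h.unitary.symm y j) (g (a j.succ))) := by
  obtain ⟨u, hu, hf, hb⟩ := h.exists_boundary_value hfy
  refine ⟨u, hu, fun j => ⟨?_, hb j _ (right_mem_Icc.2 (h.lt j).le)⟩⟩
  let z : Fin n → ℂ := fun j =>
    signedSqrt (deriv g (a j.castSucc)) * u (a j.castSucc) / √(2 * π)
  let x : Target g a := WithLp.toLp 2 fun j =>
    z j • (h.scaled j).one + Complex.I • (h.scaled j).volterra (h.unitary.symm y j)
  have hx : h.unitary x = f := by
    refine h.isometry_eq_of_ae x ?_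
    have h1 : ∀ᵐ k ∂circleMeasure, ∀ j : Fin n, h.weight j k ≠ 0 → x j (g (window (a 0) k)) =
        z j + Complex.I * primitiveOn (g (a j.castSucc)) (g (a j.succ)) (h.unitary.symm y j)
          (g (window (a 0) k)) :=
      ae_all_iff.2 fun j => (h.isWeightedMap j).ae_comp ((h.scaled j).coe_add_volterra _ _)
    filter_upwards [h1, hf] with k h2 h3 j hj
    have h0 : deriv g k ≠ 0 := by
      rw [← h.deriv_window]
      exact h.deriv_ne_zero j _ hj
    have hw : √(2 * π * |deriv g k|) ≠ 0 := Real.sqrt_ne_zero'.2 (by positivity)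
    rw [h2 j (by rwa [h.weight_of_mem hj]), h3]
    have h4 := hb j _ (Ioo_subset_Icc_self hj)
    rw [apply_window hu, h.deriv_window] at h4
    have hp : ((√(2 * π) : ℝ) : ℂ) ≠ 0 := by
      exact_mod_cast Real.sqrt_ne_zero'.2 Real.two_pi_pos
    have h5 : ((signedSqrt (deriv g k) : ℝ) : ℂ) * (√(2 * π * |deriv g k|) : ℝ) =
      (√(2 * π) : ℝ) * (deriv g k : ℝ) := by exact_mod_cast signedSqrt_mul_sqrt_two_pi _
    simp only [z]
    rw [div_add' _ _ _ hp, mul_div_assoc', eq_div_iff hp]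
    linear_combination (-u k) * h5 + ((√(2 * π * |deriv g k|) : ℝ) : ℂ) * h4
  rw [← hx, LinearIsometryEquiv.symm_apply_apply]

end PhasePartition


/-! ### Elements of the domain of the time operator -/

theorem signedSqrt_ne_zero {t : ℝ} (ht : t ≠ 0) : signedSqrt t ≠ 0 := by
  intro h
  have := signedSqrt_mul_sqrt t
  rw [h, zero_mul] at this
  exact ht this.symm

/-- A `C¹` function that agrees with `√|t| / t` away from zero. -/
theorem exists_cutoff {δ : ℝ} (hδ : 0 < δ) : ∃ ζ : ℝ → ℝ, ContDiff ℝ 1 ζ ∧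
    ∀ t, δ ≤ |t| → ζ t = (signedSqrt t)⁻¹ ∧ HasDerivAt ζ (-ζ t / (2 * t)) t := by
  let η : ContDiffBump (0 : ℝ) := ⟨δ / 3, δ / 2, by positivity, by linarith⟩
  refine ⟨fun t => (1 - η t) * (signedSqrt t)⁻¹, ?_, fun t ht => ?_⟩
  · rw [contDiff_iff_contDiffAt]
    intro t
    by_cases ht : t = 0
    · refine (contDiffAt_const (c := (0 : ℝ))).congr_of_eventuallyEq ?_
      rw [ht]
      filter_upwards [η.eventuallyEq_one] with x hx
      simp [hx]
    · exact (contDiffAt_const.sub η.contDiff.contDiffAt).mul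
        ((contDiffAt_signedSqrt ht).inv (signedSqrt_ne_zero ht))
  · have ht0 : t ≠ 0 := abs_pos.1 (hδ.trans_le ht)
    have h0 : ∀ x : ℝ, δ / 2 < |x| → η x = 0 := fun x hx =>
      η.zero_of_le_dist (by simpa [Real.dist_eq] using hx.le)
    have h1 : (fun t => (1 - η t) * (signedSqrt t)⁻¹) =ᶠ[nhds t] fun t => (signedSqrt t)⁻¹ := by
      filter_upwards [continuous_abs.continuousAt.eventually (lt_mem_nhds
        (show δ / 2 < |t| by linarith))] with x hx
      rw [h0 x hx, sub_zero, one_mul]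
    have h2 := ((hasDerivAt_signedSqrt ht0).inv (signedSqrt_ne_zero ht0)).congr_of_eventuallyEq h1
    have h3 := h1.self_of_nhds
    refine ⟨h3, h2.congr_deriv ?_⟩
    rw [h3]
    have := signedSqrt_ne_zero ht0
    field_simp

/-- If `B` vanishes near the zeros of `γ` and `B' = i (γ / √|γ|) y`, then `√|γ| B` is mapped to `y`
by `T`. -/
theorem IsSpeed.mem_graph_of_vanishing {γ : ℝ → ℝ} (h : IsSpeed γ) {f y : K1} {B : ℝ → ℂ}
    (hB : Function.Periodic B (2 * π))
    (hBb : IsPrimitive B fun k => Complex.I * ((signedSqrt (γ k) : ℂ) * y (window 0 k)))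
    {δ : ℝ} (hδ : 0 < δ) (h0 : ∀ k, |γ k| < δ → B k = 0)
    (hf : f =ᵐ[circleMeasure] fun k => (√|γ k| : ℝ) * B k) : (f, y) ∈ (timeOpOf γ).graph := by
  obtain ⟨ζ, hζ, hζ'⟩ := exists_cutoff hδ
  have hc : ContDiff ℝ 1 fun k => ((ζ (γ k) : ℝ) : ℂ) :=
    Complex.ofRealCLM.contDiff.comp (hζ.comp h.contDiff)
  have hu := (IsPrimitive.of_contDiff hc).mul hBb
  have hd : ∀ k, deriv (fun k => ((ζ (γ k) : ℝ) : ℂ)) k = (deriv (fun k => ζ (γ k)) k : ℝ) :=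
    fun k => (((hζ.comp h.contDiff).differentiable one_ne_zero) k).hasDerivAt.ofReal_comp.deriv
  simp only [hd] at hu
  have hper : Function.Periodic (fun k => ζ (γ k)) (2 * π) := fun k => by simp only [h.periodic k]
  -- the derivative of `B` vanishes where `B` does
  have hy0 : ∀ᵐ k, |γ k| < δ → y (window 0 k) = 0 := by
    filter_upwards [hBb.ae_hasDerivAt, h.ae_ne_zero] with k h1 h2 h3
    have h4 : B =ᶠ[nhds k] fun _ => 0 := by
      filter_upwards [h.contDiff.continuous.abs.continuousAt.eventually (gt_mem_nhds h3)] with x hx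
      exact h0 x hx
    have h5 := h1.unique ((hasDerivAt_const k (0 : ℂ)).congr_of_eventuallyEq h4)
    have h6 : ((signedSqrt (γ k) : ℝ) : ℂ) ≠ 0 := by exact_mod_cast signedSqrt_ne_zero h2
    simpa [h6] using h5
  have hy1 : ∀ᵐ k ∂circleMeasure, (ζ (γ k) : ℂ) * (Complex.I * ((signedSqrt (γ k) : ℂ) *
      y (window 0 k))) = Complex.I * y k := by
    filter_upwards [ae_circle_of_ae hy0, ae_circle_of_ae h.ae_ne_zero, ae_eq_window y]
      with k h1 h2 h3
    rw [h3]
    rcases lt_or_ge (|γ k|) δ with h4 | h4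
    · rw [h1 h4]; simp
    · have h6 : ((signedSqrt (γ k) : ℝ) : ℂ) ≠ 0 := by exact_mod_cast signedSqrt_ne_zero h2
      rw [(hζ' _ h4).1]
      push_cast
      field_simp
  refine h.mem_graph_of_primitive (fun k => by simp only [hB k, h.periodic k]) (fun k => ?_) hu
    ?_ ?_ ?_
  · simp only [hB k, h.periodic k, window_add, periodic_deriv hper k]
  · refine MemLp.add (isScaledLebesgue_circle.memLp_of_continuous
      ((Complex.continuous_ofReal.comp ((hζ.comp h.contDiff).continuous_deriv le_rfl)).mul
        hBb.continuous)) ?_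
    exact ((Lp.memLp y).const_mul Complex.I).ae_eq (hy1.mono fun k hk => hk.symm)
  · filter_upwards [hf, ae_circle_of_ae h.ae_ne_zero] with k h1 h2
    rw [h1]
    rcases lt_or_ge (|γ k|) δ with h4 | h4
    · rw [h0 k h4]; simp
    · rw [(hζ' _ h4).1]
      have h5 : (√|γ k| : ℝ) = γ k * (signedSqrt (γ k))⁻¹ :=
        (eq_mul_inv_iff_mul_eq₀ (signedSqrt_ne_zero h2)).2
          ((mul_comm _ _).trans (signedSqrt_mul_sqrt _))
      rw [h5]
      push_cast
      ring
  · filter_upwards [hy1, ae_circle_of_ae h.ae_ne_zero, ae_circle_of_ae hy0, ae_eq_window y]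
      with k h1 h2 h3 h7
    rw [h1]
    rcases lt_or_ge (|γ k|) δ with h4 | h4
    · rw [h7, h3 h4, h0 k h4]; simp
    · have h5 : deriv (fun k => ζ (γ k)) k = -ζ (γ k) / (2 * γ k) * deriv γ k :=
        ((hζ' _ h4).2.comp k ((h.contDiff.differentiable one_ne_zero) k).hasDerivAt).deriv
      have h6 : ((γ k : ℝ) : ℂ) ≠ 0 := by exact_mod_cast h2
      rw [h5]
      push_cast
      field_simp
      linear_combination (2 * y k * γ k) * Complex.I_sq

namespace PhasePartition

variable {g : ℝ → ℝ} {n : ℕ} {a : Fin (n + 1) → ℝ}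

/-- If all components of `y` have mean zero, then the primitives of these components fit together
to a periodic function on the line, with the same value `C` at all points of the partition. -/
theorem exists_periodic_primitive (h : PhasePartition g a) (y : K1) (C : ℂ)
    (hy : ∀ j, ⟪(h.scaled j).one, h.unitary.symm y j⟫_ℂ = 0) :
    ∃ B : ℝ → ℂ, Function.Periodic B (2 * π) ∧
      IsPrimitive B (fun k => Complex.I * ((signedSqrt (deriv g k) : ℂ) * y (window 0 k))) ∧
      ∀ j : Fin n, ∀ k ∈ Icc (a j.castSucc) (a j.succ), B k = C + √(2 * π) * (Complex.I *
        primitiveOn (g (a j.castSucc)) (g (a j.succ)) (h.unitary.symm y j) (g k)) := by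
  set b : ℝ → ℂ := fun k => Complex.I * ((signedSqrt (deriv g k) : ℂ) * y (window 0 k)) with hb
  have hper : Function.Periodic b (2 * π) := fun k => by
    simp only [hb, h.periodic k, window_add]
  have hl : LocallyIntegrable b := locallyIntegrable_of_periodic hper
    ((isScaledLebesgue_circle.memLp_mul (Complex.continuous_ofReal.comp
      (continuous_signedSqrt.comp h.continuous_deriv)) (memLp_window (Lp.memLp y))).const_mul _)
  have hP := IsPrimitive.of_integral hl (a 0)
  have h1 : ∀ j : Fin n, ∀ k ∈ Icc (a j.castSucc) (a j.succ),
      ∫ t in (a 0)..k, b t = (∫ t in (a 0)..(a j.castSucc), b t) + √(2 * π) * (Complex.I *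
        primitiveOn (g (a j.castSucc)) (g (a j.succ)) (h.unitary.symm y j) (g k)) := by
    intro j k hk
    have h2 := h.integral_unitary_symm y j (left_mem_Icc.2 (h.lt j).le) hk hk.1
    rw [← h.primitiveOn_sub j _ (left_mem_Icc.2 (h.lt j).le) hk, primitiveOn_left, sub_zero] at h2
    have h3 : ∫ t in (a j.castSucc)..k, b t = Complex.I * ∫ t in (a j.castSucc)..k,
        (signedSqrt (deriv g t) : ℂ) * y (window 0 t) := intervalIntegral.integral_const_mul _ _
    rw [hP.eq_add (a j.castSucc) k, h3, h2]
    ring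
  have h2 : ∀ i : Fin (n + 1), ∫ t in (a 0)..(a i), b t = 0 := by
    intro i
    induction i using Fin.induction with
    | zero => exact intervalIntegral.integral_same
    | succ j ih =>
      rw [h1 j _ (right_mem_Icc.2 (h.lt j).le), ih, ((h.scaled j).primitiveOn_right _).2 (hy j)]
      simp
  refine ⟨fun k => (∫ t in (a 0)..k, b t) + C, fun k => ?_, hP.add_const C, fun j k hk => ?_⟩
  · have := periodic_integral hper hl (a 0) (by rw [← h.last]; exact h2 _) k
    exact congrArg (· + C) this
  · simp only
    rw [h1 j k hk, h2]
    ring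

/-- The elements of the periodic operators lie in the graph of `T` if they have a common boundary
value `z` and vanish where the speed `g'` is small. -/
theorem mem_graph_of_vanishing (h : PhasePartition g a) {y : K1} {z : ℂ}
    (hy : ∀ j, ⟪(h.scaled j).one, h.unitary.symm y j⟫_ℂ = 0) {δ : ℝ} (hδ : 0 < δ)
    (h0 : ∀ j : Fin n, ∀ k ∈ Icc (a j.castSucc) (a j.succ), |deriv g k| < δ →
      z + Complex.I * primitiveOn (g (a j.castSucc)) (g (a j.succ)) (h.unitary.symm y j) (g k) = 0)
    {x : Target g a} (hx : ∀ j, x j = z • (h.scaled j).one +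
      Complex.I • (h.scaled j).volterra (h.unitary.symm y j)) :
    (h.unitary x, y) ∈ (timeOpOf (deriv g)).graph := by
  obtain ⟨B, hB, hBb, hBj⟩ := h.exists_periodic_primitive y (√(2 * π) * z) hy
  refine h.isSpeed.mem_graph_of_vanishing hB hBb hδ (fun k hk => ?_) ?_
  · have h1 := window_mem (a 0) k
    obtain ⟨j, hj⟩ := exists_mem_Ioc_of_partition a h1.1 (h1.2.trans h.last.ge)
    rw [← apply_window hB (a 0), hBj j _ (Ioc_subset_Icc_self hj), ← mul_add,
      h0 j _ (Ioc_subset_Icc_self hj) (by rwa [h.deriv_window]), mul_zero]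
  · have hxj : ∀ j, x j =ᵐ[volume.restrict (uIcc (g (a j.castSucc)) (g (a j.succ)))]
        fun E => z + Complex.I *
          primitiveOn (g (a j.castSucc)) (g (a j.succ)) (h.unitary.symm y j) E := fun j => by
      rw [hx]
      exact (h.scaled j).coe_add_volterra _ _
    have h1 : ∀ᵐ k ∂circleMeasure, ∀ j : Fin n, h.weight j k ≠ 0 → x j (g (window (a 0) k)) =
        z + Complex.I * primitiveOn (g (a j.castSucc)) (g (a j.succ)) (h.unitary.symm y j)
          (g (window (a 0) k)) :=
      ae_all_iff.2 fun j => (h.isWeightedMap j).ae_comp (hxj j)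
    filter_upwards [h1, h.ae_isometry x, h.ae_circle_exists_mem] with k h2 h3 ⟨j, hj⟩
    have hd : deriv g k ≠ 0 := by
      rw [← h.deriv_window]
      exact h.deriv_ne_zero j _ hj
    have hw : √(2 * π * |deriv g k|) ≠ 0 := Real.sqrt_ne_zero'.2 (by positivity)
    refine (h3 j hj).trans ?_
    rw [h2 j (by rwa [h.weight_of_mem hj]), ← apply_window hB (a 0),
      hBj j _ (Ioo_subset_Icc_self hj), Real.sqrt_mul (by positivity)]
    push_cast
    ring

end PhasePartition

/-! ### Functions vanishing near the endpoints -/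

/-- The functions in `L²(I)` that vanish near the endpoints of `I`. -/
def vanishingNearEndpoints (a b : ℝ) : Submodule ℂ (L2Interval a b) where
  carrier := {v | ∃ ε > 0, ∀ᵐ t ∂volume.restrict (uIcc a b), |t - a| < ε ∨ |t - b| < ε → v t = 0}
  add_mem' := by
    rintro v w ⟨ε, hε, hv⟩ ⟨ε', hε', hw⟩
    refine ⟨min ε ε', lt_min hε hε', ?_⟩
    filter_upwards [hv, hw, Lp.coeFn_add v w] with t h1 h2 h3 h4
    rw [h3, Pi.add_apply, h1 (h4.imp (fun h => h.trans_le (min_le_left _ _))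
      fun h => h.trans_le (min_le_left _ _)), h2 (h4.imp
      (fun h => h.trans_le (min_le_right _ _)) fun h => h.trans_le (min_le_right _ _)), add_zero]
  zero_mem' := ⟨1, one_pos, (Lp.coeFn_zero ℂ 2 _).mono fun _ h _ => h⟩
  smul_mem' := by
    rintro c v ⟨ε, hε, hv⟩
    refine ⟨ε, hε, ?_⟩
    filter_upwards [hv, Lp.coeFn_smul c v] with t h1 h2 h3
    rw [h2, Pi.smul_apply, h1 h3, smul_zero]

theorem dense_vanishingNearEndpoints (a b : ℝ) :
    Dense (vanishingNearEndpoints a b : Set (L2Interval a b)) := by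
  rw [Submodule.dense_iff_topologicalClosure_eq_top, Submodule.topologicalClosure_eq_top_iff,
    Submodule.eq_bot_iff]
  intro w hw
  rw [Submodule.mem_orthogonal] at hw
  have key : ∀ ε > 0, ∀ᵐ t ∂volume.restrict (uIcc a b), ε ≤ |t - a| ∧ ε ≤ |t - b| → w t = 0 := by
    intro ε hε
    let A : Set ℝ := {t | ε ≤ |t - a| ∧ ε ≤ |t - b|}
    have hA : MeasurableSet A :=
      ((isClosed_le continuous_const
        (continuous_abs.comp (continuous_id.sub continuous_const))).inter
        (isClosed_le continuous_const
          (continuous_abs.comp (continuous_id.sub continuous_const)))).measurableSet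
    have hm : MemLp (A.indicator w) 2 (volume.restrict (uIcc a b)) := (Lp.memLp w).indicator hA
    have hmem : hm.toLp _ ∈ vanishingNearEndpoints a b := by
      refine ⟨ε, hε, hm.coeFn_toLp.mono fun t h1 h2 => ?_⟩
      rw [h1, indicator_of_notMem]
      rintro ⟨h3, h4⟩
      exact h2.elim (fun h => absurd h (not_lt.2 h3)) fun h => absurd h (not_lt.2 h4)
    have h1 := hw _ hmem
    have h2 : ⟪hm.toLp _, hm.toLp _⟫_ℂ = 0 := by
      rw [← h1, L2.inner_def, L2.inner_def]
      refine integral_congr_ae (hm.coeFn_toLp.mono fun t h2 => ?_)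
      simp only [h2]
      by_cases ht : t ∈ A
      · rw [indicator_of_mem ht]
      · rw [indicator_of_notMem ht]; simp
    have h3 := hm.coeFn_toLp
    rw [inner_self_eq_zero.1 h2] at h3
    filter_upwards [h3, Lp.coeFn_zero ℂ 2 (volume.restrict (uIcc a b))] with t h4 h5 h6
    rw [h5, indicator_of_mem (show t ∈ A from h6)] at h4
    exact h4.symm
  have hn : ∀ᵐ t ∂volume.restrict (uIcc a b), ∀ n : ℕ,
      1 / ((n : ℝ) + 1) ≤ |t - a| ∧ 1 / ((n : ℝ) + 1) ≤ |t - b| → w t = 0 :=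
    ae_all_iff.2 fun n => key _ (by positivity)
  have hne : ∀ x : ℝ, ∀ᵐ t ∂volume.restrict (uIcc a b), t ≠ x := fun x =>
    ae_restrict_of_ae (compl_mem_ae_iff.2 (measure_singleton _))
  apply Lp.ext
  filter_upwards [hn, hne a, hne b, Lp.coeFn_zero ℂ 2 (volume.restrict (uIcc a b))]
    with t h1 h2 h3 h4
  obtain ⟨n, hn⟩ := exists_nat_one_div_lt
    (lt_min (abs_pos.2 (sub_ne_zero.2 h2)) (abs_pos.2 (sub_ne_zero.2 h3)))
  rw [h4]
  exact h1 n ⟨hn.le.trans (min_le_left _ _), hn.le.trans (min_le_right _ _)⟩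

/-- A hyperplane `e⊥` meets a dense subspace in a dense subspace of itself. -/
theorem mem_closure_of_inner_eq_zero {H : Type*} [NormedAddCommGroup H] [InnerProductSpace ℂ H]
    {C : Submodule ℂ H} (hC : Dense (C : Set H)) {e y : H} (hy : ⟪e, y⟫_ℂ = 0) :
    y ∈ closure {x | x ∈ C ∧ ⟪e, x⟫_ℂ = 0} := by
  by_cases h0 : ∃ c ∈ C, ⟪e, c⟫_ℂ ≠ 0
  · obtain ⟨c, hc, hce⟩ := h0
    -- project along `c` onto `e⊥`
    let φ : H → H := fun x => x - (⟪e, x⟫_ℂ / ⟪e, c⟫_ℂ) • c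
    have hφ : Continuous φ := by
      refine continuous_id.sub (Continuous.smul (Continuous.div_const ?_ _) continuous_const)
      exact continuous_const.inner continuous_id
    have hφy : φ y = y := by simp [φ, hy]
    have h1 : φ y ∈ φ '' closure (C : Set H) := ⟨y, hC y, rfl⟩
    rw [hφy] at h1
    refine closure_mono ?_ (image_closure_subset_closure_image hφ h1)
    rintro _ ⟨x, hx, rfl⟩
    refine ⟨C.sub_mem hx (C.smul_mem _ hc), ?_⟩
    simp only [φ, inner_sub_right, inner_smul_right]
    field_simp
    ring
  · push Not at h0
    refine closure_mono (fun x hx => ?_) (hC y)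
    exact ⟨hx, h0 x hx⟩

theorem primitiveOn_eq_zero {a b ε t : ℝ} (hab : a ≠ b) {v : L2Interval a b}
    (hv : ∀ᵐ t ∂volume.restrict (uIcc a b), |t - a| < ε ∨ |t - b| < ε → v t = 0)
    (h0 : ⟪(isScaledLebesgue_interval hab).one, v⟫_ℂ = 0) (ht : |t - a| < ε ∨ |t - b| < ε) :
    primitiveOn a b v t = 0 := by
  have hP := (isScaledLebesgue_interval hab).isPrimitive (Lp.memLp v)
  have hv' : ∀ᵐ t, |t - a| < ε ∨ |t - b| < ε → (uIcc a b).indicator v t = 0 := by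
    rw [ae_restrict_iff' measurableSet_uIcc] at hv
    filter_upwards [hv] with s h1 h2
    by_cases hs : s ∈ uIcc a b
    · rw [indicator_of_mem hs, h1 hs h2]
    · exact indicator_of_notMem hs _
  have key : ∀ x, (∀ s ∈ uIoc x t, |s - a| < ε ∨ |s - b| < ε) → primitiveOn a b v x = 0 →
      primitiveOn a b v t = 0 := by
    intro x hx h1
    rw [hP.eq_add x t, h1, zero_add]
    exact intervalIntegral.integral_zero_ae (hv'.mono fun s h2 hs => h2 (hx s hs))
  have hle : ∀ x, ∀ s ∈ uIoc x t, |s - x| ≤ |t - x| := fun x s hs =>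
    abs_sub_left_of_mem_uIcc (uIoc_subset_uIcc hs)
  rcases ht with ht | ht
  · exact key a (fun s hs => Or.inl ((hle a s hs).trans_lt ht)) (primitiveOn_left _ _ _)
  · exact key b (fun s hs => Or.inr ((hle b s hs).trans_lt ht))
      (((isScaledLebesgue_interval hab).primitiveOn_right v).2 h0)


namespace PhasePartition

variable {g : ℝ → ℝ} {n : ℕ} {a : Fin (n + 1) → ℝ}

/-! ### Critical points at the endpoints -/

/-- The direct sum of the operators `P_I`, carried over to `K1` by the change of variables. -/
def minimalOp (h : PhasePartition g a) : K1 →ₗ.[ℂ] K1 :=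
  conjOp h.unitary (directSumOp fun j : Fin n => PInterval (g (a j.castSucc)) (g (a j.succ)))

/-- The direct sum of the operators `-i d/dx` with periodic boundary conditions, carried over to
`K1` by the change of variables. -/
def periodicOp (h : PhasePartition g a) : K1 →ₗ.[ℂ] K1 :=
  conjOp h.unitary (directSumOp fun j : Fin n => PPeriodic (g (a j.castSucc)) (g (a j.succ)))

theorem mem_pInterval_graph (h : PhasePartition g a) (j : Fin n)
    (u v : L2Interval (g (a j.castSucc)) (g (a j.succ))) :
    (u, v) ∈ (PInterval (g (a j.castSucc)) (g (a j.succ))).graph ↔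
      u = Complex.I • (h.scaled j).volterra v ∧ ⟪(h.scaled j).one, v⟫_ℂ = 0 :=
  (h.scaled j).mem_minimal_graph_iff _ u v

theorem mem_pPeriodic_graph (h : PhasePartition g a) (j : Fin n)
    (u v : L2Interval (g (a j.castSucc)) (g (a j.succ))) :
    (u, v) ∈ (PPeriodic (g (a j.castSucc)) (g (a j.succ))).graph ↔
      (∃ z : ℂ, u = z • (h.scaled j).one + Complex.I • (h.scaled j).volterra v) ∧
        ⟪(h.scaled j).one, v⟫_ℂ = 0 :=
  (h.scaled j).mem_periodic_graph_iff _ u v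

theorem mem_minimalOp_graph (h : PhasePartition g a) {f y : K1} :
    (f, y) ∈ h.minimalOp.graph ↔ ∀ j,
      h.unitary.symm f j = Complex.I • (h.scaled j).volterra (h.unitary.symm y j) ∧
        ⟪(h.scaled j).one, h.unitary.symm y j⟫_ℂ = 0 := by
  rw [minimalOp, mem_conjOp_graph, mem_directSumOp_graph]
  exact forall_congr' fun j => h.mem_pInterval_graph j _ _

theorem mem_periodicOp_graph (h : PhasePartition g a) {f y : K1} :
    (f, y) ∈ h.periodicOp.graph ↔ ∀ j,
      (∃ z : ℂ, h.unitary.symm f j = z • (h.scaled j).one +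
        Complex.I • (h.scaled j).volterra (h.unitary.symm y j)) ∧
        ⟪(h.scaled j).one, h.unitary.symm y j⟫_ℂ = 0 := by
  rw [periodicOp, mem_conjOp_graph, mem_directSumOp_graph]
  exact forall_congr' fun j => h.mem_pPeriodic_graph j _ _

theorem dense_pInterval (h : PhasePartition g a) (j : Fin n) :
    Dense ((PInterval (g (a j.castSucc)) (g (a j.succ))).domain :
      Set (L2Interval (g (a j.castSucc)) (g (a j.succ)))) :=
  IsVolterra.dense_minimal (h.mem_pInterval_graph j) (h.scaled j).isVolterra

theorem dense_minimalOp (h : PhasePartition g a) : Dense (h.minimalOp.domain : Set K1) :=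
  dense_conjOp (dense_directSumOp h.dense_pInterval)

theorem isClosed_minimalOp (h : PhasePartition g a) : h.minimalOp.IsClosed :=
  isClosed_conjOp (isClosed_directSumOp fun j =>
    IsVolterra.isClosed_minimal (h.mem_pInterval_graph j))

theorem inner_minimalOp (h : PhasePartition g a) {u v x y : K1}
    (huv : (u, v) ∈ h.minimalOp.graph) (hxy : (x, y) ∈ h.minimalOp.graph) :
    ⟪v, x⟫_ℂ = ⟪u, y⟫_ℂ := by
  rw [minimalOp, mem_conjOp_graph, mem_directSumOp_graph] at huv hxy
  rw [← h.unitary.symm.inner_map_map v x, ← h.unitary.symm.inner_map_map u y, PiLp.inner_apply,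
    PiLp.inner_apply]
  exact Finset.sum_congr rfl fun j _ => IsVolterra.symm_minimal (h.mem_pInterval_graph j)
    (h.scaled j).isVolterra _ _ _ _ (huv j) (hxy j)

theorem isSelfAdjoint_periodicOp (h : PhasePartition g a) : IsSelfAdjoint h.periodicOp :=
  isSelfAdjoint_conjOp (isSelfAdjoint_directSumOp fun j =>
    IsVolterra.isSelfAdjoint_periodic (h.mem_pPeriodic_graph j) (h.scaled j).isVolterra)

theorem minimalOp_le_periodicOp (h : PhasePartition g a) : h.minimalOp ≤ h.periodicOp := by
  refine LinearPMap.le_of_le_graph ?_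
  rintro ⟨f, y⟩ hfy
  rw [mem_minimalOp_graph] at hfy
  rw [mem_periodicOp_graph]
  exact fun j => ⟨⟨0, by rw [zero_smul, zero_add]; exact (hfy j).1⟩, (hfy j).2⟩

theorem defectNumber_minimalOp (h : PhasePartition g a) {z : ℂ}
    (hz : z = Complex.I ∨ z = -Complex.I) : defectNumber h.minimalOp z = n := by
  rw [minimalOp, defectNumber_conjOp (dense_directSumOp h.dense_pInterval)]
  exact defectNumber_directSumOp h.dense_pInterval fun j =>
    IsVolterra.defectNumber_minimal (h.mem_pInterval_graph j) (h.scaled j).isVolterra hz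

theorem timeOpOf_le_minimalOp (h : PhasePartition g a) (hz : ∀ i, deriv g (a i) = 0) :
    timeOpOf (deriv g) ≤ h.minimalOp := by
  refine LinearPMap.le_of_le_graph ?_
  rintro ⟨f, y⟩ hfy
  obtain ⟨u, -, hu⟩ := h.unitary_symm_of_mem_graph hfy
  refine h.mem_minimalOp_graph.2 fun j => ?_
  obtain ⟨h1, h2⟩ := hu j
  rw [hz, hz, signedSqrt_zero, Complex.ofReal_zero, zero_mul, zero_mul, zero_add] at h2
  rw [hz, signedSqrt_zero] at h1
  have hp : ((√(2 * π) : ℝ) : ℂ) ≠ 0 := by exact_mod_cast Real.sqrt_ne_zero'.2 Real.two_pi_pos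
  refine ⟨by simpa using h1, ((h.scaled j).primitiveOn_right _).1 ?_⟩
  exact (mul_eq_zero.1 ((mul_eq_zero.1 h2.symm).resolve_left hp)).resolve_left Complex.I_ne_zero

/-- The functions whose components vanish near the endpoints and have mean zero form a core. -/
theorem minimalOp_graph_subset_closure (h : PhasePartition g a) :
    (h.minimalOp.graph : Set (K1 × K1)) ⊆ closure ((timeOpOf (deriv g)).graph : Set (K1 × K1)) := by
  rintro ⟨f, y⟩ hfy
  rw [SetLike.mem_coe, mem_minimalOp_graph] at hfy
  let D : ∀ j : Fin n, Set (L2Interval (g (a j.castSucc)) (g (a j.succ))) := fun j =>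
    {v | v ∈ vanishingNearEndpoints (g (a j.castSucc)) (g (a j.succ)) ∧
      ⟪(h.scaled j).one, v⟫_ℂ = 0}
  let Ψ : (∀ j : Fin n, L2Interval (g (a j.castSucc)) (g (a j.succ))) → K1 × K1 := fun v =>
    (h.unitary (WithLp.toLp 2 fun j => Complex.I • (h.scaled j).volterra (v j)),
      h.unitary (WithLp.toLp 2 v))
  have hΨ : Continuous Ψ := by
    have h1 : Continuous fun (v : ∀ j : Fin n, L2Interval (g (a j.castSucc)) (g (a j.succ))) =>
        fun j => Complex.I • (h.scaled j).volterra (v j) :=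
      continuous_pi fun j =>
        ((h.scaled j).volterra.continuous.comp (continuous_apply j)).const_smul Complex.I
    have h2 : Continuous fun (v : ∀ j : Fin n, L2Interval (g (a j.castSucc)) (g (a j.succ))) =>
        (WithLp.toLp 2 v : Target g a) := PiLp.continuous_toLp 2 _
    exact (h.unitary.continuous.comp (h2.comp h1)).prodMk (h.unitary.continuous.comp h2)
  have hy : (fun j => h.unitary.symm y j) ∈ closure (pi univ D) := by
    rw [closure_pi_set]
    exact fun j _ => mem_closure_of_inner_eq_zero (dense_vanishingNearEndpoints _ _) (hfy j).2
  have hΨy : Ψ (fun j => h.unitary.symm y j) = (f, y) := by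
    have h1 : (WithLp.toLp 2 fun j => Complex.I • (h.scaled j).volterra (h.unitary.symm y j) :
        Target g a) = h.unitary.symm f := by
      ext1 j
      exact (hfy j).1.symm
    have h2 : (WithLp.toLp 2 fun j => h.unitary.symm y j : Target g a) = h.unitary.symm y := rfl
    simp only [Ψ, h1, h2, LinearIsometryEquiv.apply_symm_apply]
  rw [← hΨy]
  refine closure_mono ?_ (image_closure_subset_closure_image hΨ ⟨_, hy, rfl⟩)
  rintro _ ⟨v, hv, rfl⟩
  have hv1 : ∀ j, h.unitary.symm (h.unitary (WithLp.toLp 2 v)) j = v j := fun j => by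
    rw [LinearIsometryEquiv.symm_apply_apply]
  -- the speed is bounded below on the preimages of the supports
  have key : ∀ j : Fin n, ∃ δ > 0, ∀ k ∈ Icc (a j.castSucc) (a j.succ), |deriv g k| < δ →
      primitiveOn (g (a j.castSucc)) (g (a j.succ)) (v j) (g k) = 0 := by
    intro j
    obtain ⟨⟨ε, hε, h1⟩, h2⟩ := hv j (mem_univ j)
    let K : Set ℝ := Icc (a j.castSucc) (a j.succ) ∩
      {k | ε ≤ |g k - g (a j.castSucc)| ∧ ε ≤ |g k - g (a j.succ)|}
    have hK : IsCompact K := by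
      refine isCompact_Icc.inter_right ?_
      exact (isClosed_le continuous_const (h.contDiff.continuous.sub continuous_const).abs).inter
        (isClosed_le continuous_const (h.contDiff.continuous.sub continuous_const).abs)
    have hpos : ∀ k ∈ K, 0 < |deriv g k| := by
      rintro k ⟨hk, hk1, hk2⟩
      refine abs_pos.2 (h.deriv_ne_zero j k ⟨hk.1.lt_of_ne ?_, hk.2.lt_of_ne ?_⟩)
      · rintro rfl
        rw [sub_self, abs_zero] at hk1
        exact absurd hε (not_lt.2 hk1)
      · rintro rfl
        rw [sub_self, abs_zero] at hk2
        exact absurd hε (not_lt.2 hk2)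
    obtain ⟨δ, hδ, hδK⟩ := hK.exists_forall_le' h.continuous_deriv.abs.continuousOn hpos
    refine ⟨δ, hδ, fun k hk hlt => primitiveOn_eq_zero (h.ne j) h1 h2 ?_⟩
    by_contra hcon
    rw [not_or, not_lt, not_lt] at hcon
    exact absurd hlt (not_lt.2 (hδK k ⟨hk, hcon⟩))
  choose δ hδ hδ' using key
  obtain ⟨d, hd⟩ : ∃ d > 0, ∀ j, d < δ j := by
    have h1 : ∀ᶠ d in nhdsWithin (0 : ℝ) (Ioi 0), ∀ j, d < δ j :=
      Filter.eventually_all.2 fun j =>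
        Filter.mem_of_superset (Ioo_mem_nhdsGT (hδ j)) fun d hd => hd.2
    exact ((eventually_mem_nhdsWithin (s := Ioi (0 : ℝ))).and h1).exists
  refine h.mem_graph_of_vanishing (z := 0) (fun j => ?_) hd.1 (fun j k hk hlt => ?_) (fun j => ?_)
  · rw [hv1]
    exact (hv j (mem_univ j)).2
  · rw [hv1, hδ' j k hk (hlt.trans (hd.2 j))]
    simp
  · rw [hv1, zero_smul, zero_add]

theorem dense_timeOpOf (h : PhasePartition g a) : Dense ((timeOpOf (deriv g)).domain : Set K1) :=
  dense_domain_of_graph_le_closure h.dense_minimalOp h.minimalOp_graph_subset_closure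

theorem closure_timeOpOf (h : PhasePartition g a) (hz : ∀ i, deriv g (a i) = 0) :
    (timeOpOf (deriv g)).closure = h.minimalOp :=
  closure_eq_of_graph h.isClosed_minimalOp (h.timeOpOf_le_minimalOp hz)
    h.minimalOp_graph_subset_closure

theorem isSymmetricOp_timeOpOf (h : PhasePartition g a) (hz : ∀ i, deriv g (a i) = 0) :
    IsSymmetricOp (timeOpOf (deriv g)) := by
  refine isSymmetricOp_of_graph h.dense_timeOpOf fun u v x y huv hxy => ?_
  have hle := LinearPMap.le_graph_of_le (h.timeOpOf_le_minimalOp hz)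
  exact h.inner_minimalOp (hle huv) (hle hxy)

theorem defectNumber_timeOpOf (h : PhasePartition g a) (hz : ∀ i, deriv g (a i) = 0) {z : ℂ}
    (hz' : z = Complex.I ∨ z = -Complex.I) : defectNumber (timeOpOf (deriv g)) z = n := by
  rw [← h.defectNumber_minimalOp hz']
  exact defectNumber_congr fun x y => mem_adjoint_graph_of_closure h.dense_minimalOp
    (h.timeOpOf_le_minimalOp hz) h.minimalOp_graph_subset_closure

/-- Multiplication by `e^{i g}` corresponds to multiplication by `e^{iE}`. -/
theorem mulOp_eq_conjOp (h : PhasePartition g a) {lam : ℝ → ℂ}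
    (hper : Function.Periodic lam (2 * π)) (hg : ∀ k, lam k = Complex.exp (Complex.I * (g k : ℂ))) :
    mulOp circleMeasure lam = conjOp h.unitary (directSumOp fun j : Fin n =>
      mulOp (volume.restrict (uIcc (g (a j.castSucc)) (g (a j.succ))))
        fun E => Complex.exp (Complex.I * (E : ℂ))) := by
  have hcont : Continuous fun E : ℝ => Complex.exp (Complex.I * (E : ℂ)) := by fun_prop
  have key : ∀ x y : Target g a, (x, y) ∈ (directSumOp fun j : Fin n =>
      mulOp (volume.restrict (uIcc (g (a j.castSucc)) (g (a j.succ))))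
        fun E => Complex.exp (Complex.I * (E : ℂ))).graph →
      h.unitary y =ᵐ[circleMeasure] fun k => lam k * h.unitary x k := by
    intro x y hxy
    rw [mem_directSumOp_graph] at hxy
    have h1 : ∀ᵐ k ∂circleMeasure, ∀ j : Fin n, h.weight j k ≠ 0 → y j (g (window (a 0) k)) =
        Complex.exp (Complex.I * (g (window (a 0) k) : ℂ)) * x j (g (window (a 0) k)) :=
      ae_all_iff.2 fun j => (h.isWeightedMap j).ae_comp (mem_mulOp_graph.1 (hxy j))
    filter_upwards [h1, h.ae_isometry x, h.ae_isometry y, h.ae_circle_exists_mem]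
      with k h2 h3 h4 ⟨j, hj⟩
    have hd : deriv g k ≠ 0 := by
      rw [← h.deriv_window]
      exact h.deriv_ne_zero j _ hj
    have hw : √(2 * π * |deriv g k|) ≠ 0 := Real.sqrt_ne_zero'.2 (by positivity)
    refine (h4 j hj).trans ?_
    rw [h2 j (by rwa [h.weight_of_mem hj]), ← hg, apply_window hper]
    refine Eq.trans ?_ (congrArg (lam k * ·) (h3 j hj).symm)
    ring
  refine ext_graph fun f y => ?_
  rw [mem_mulOp_graph, mem_conjOp_graph]
  constructor
  · intro hy
    obtain ⟨y', hy'⟩ := exists_mem_directSum_mulOp_graph hcont norm_exp_I_mul (h.unitary.symm f)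
    have h1 := key _ _ hy'
    rw [LinearIsometryEquiv.apply_symm_apply] at h1
    have h2 : h.unitary y' = y := Lp.ext (h1.trans hy.symm)
    rwa [← h2, LinearIsometryEquiv.symm_apply_apply]
  · intro hy
    have h1 := key _ _ hy
    rwa [LinearIsometryEquiv.apply_symm_apply, LinearIsometryEquiv.apply_symm_apply] at h1

/-! ### No critical points -/

/-- Without critical points a period forms a single interval, at whose endpoints the boundary
values agree. -/
theorem timeOpOf_eq_periodicOp {a : Fin (1 + 1) → ℝ} (h : PhasePartition g a)
    (h0 : ∀ k, deriv g k ≠ 0) : timeOpOf (deriv g) = h.periodicOp := by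
  have hp : ((√(2 * π) : ℝ) : ℂ) ≠ 0 := by exact_mod_cast Real.sqrt_ne_zero'.2 Real.two_pi_pos
  refine ext_graph fun f y => ⟨fun hfy => ?_, fun hfy => ?_⟩
  · obtain ⟨u, hu, hb⟩ := h.unitary_symm_of_mem_graph hfy
    refine h.mem_periodicOp_graph.2 fun j => ⟨⟨_, (hb j).1⟩, ?_⟩
    have h1 := (hb j).2
    have h2 : a j.succ = a j.castSucc + 2 * π := by
      rw [Subsingleton.elim j 0]
      exact h.last
    have h3 : (signedSqrt (deriv g (a j.succ)) : ℂ) * u (a j.succ) =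
        signedSqrt (deriv g (a j.castSucc)) * u (a j.castSucc) := by
      rw [h2, h.periodic, hu]
    rw [h3, left_eq_add] at h1
    exact ((h.scaled j).primitiveOn_right _).1
      ((mul_eq_zero.1 ((mul_eq_zero.1 h1).resolve_left hp)).resolve_left Complex.I_ne_zero)
  · have h1 := h.mem_periodicOp_graph.1 hfy
    obtain ⟨z, hz⟩ := (h1 0).1
    obtain ⟨δ, hδ, hδ'⟩ := (isCompact_Icc (a := a 0) (b := a 0 + 2 * π)).exists_forall_le'
      h.continuous_deriv.abs.continuousOn (a := 0) fun k _ => abs_pos.2 (h0 k)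
    have h2 := h.mem_graph_of_vanishing (x := h.unitary.symm f) (z := z) (fun j => (h1 j).2) hδ
      (fun j k hk hlt => absurd hlt (not_lt.2 (hδ' k ?_))) (fun j => ?_)
    · rwa [LinearIsometryEquiv.apply_symm_apply] at h2
    · rw [← h.last]
      exact ⟨(h.strictMono.monotone (Fin.zero_le _)).trans hk.1,
        hk.2.trans (h.strictMono.monotone (Fin.le_last _))⟩
    · rw [Subsingleton.elim j 0]
      exact hz

end PhasePartition

theorem exists_reindex_basis {ι κ H : Type*} [NormedAddCommGroup H] [InnerProductSpace ℂ H]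
    [CompleteSpace H] (b : HilbertBasis κ ℂ H) (e : ι ≃ κ) :
    ∃ b' : HilbertBasis ι ℂ H, ∀ i, b' i = b (e i) := by
  have hv : Orthonormal ℂ (b ∘ e) := b.orthonormal.comp e e.injective
  have hsp : (Submodule.span ℂ (range (b ∘ e)))ᗮ = ⊥ := by
    rw [e.surjective.range_comp, ← Submodule.topologicalClosure_eq_top_iff, b.dense_span]
  exact ⟨HilbertBasis.mkOfOrthogonalEqBot hv hsp, fun i => by
    rw [HilbertBasis.coe_mkOfOrthogonalEqBot]; rfl⟩

/-- On an interval of length `2π M`, the operator `-i d/dx` with periodic boundary conditions is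
unitarily equivalent to `⨁ⱼ (P + j / M)` with `j = 0, …, M - 1`: its eigenvalues are the numbers
`l + j / M`. The equivalence respects multiplication by `e^{iE}`, which raises `l` by one. -/
theorem exists_unitary_periodic {α β : Fin 1 → ℝ} {M : ℕ} (hM : M ≠ 0)
    (hab : ∀ j, |β j - α j| = 2 * π * M) :
    ∃ V : PiLp 2 (fun j : Fin 1 => L2Interval (α j) (β j)) ≃ₗᵢ[ℂ] PiLp 2 (fun _ : Fin M => K1),
      conjOp V (directSumOp fun j : Fin 1 => PPeriodic (α j) (β j)) = directSumOp (fun j : Fin M =>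
        (((j : ℕ) : ℂ) / (M : ℂ)) • (LinearMap.id : K1 →ₗ[ℂ] K1) +ᵥ P) ∧
      conjOp V (directSumOp fun j : Fin 1 => mulOp (volume.restrict (uIcc (α j) (β j)))
          fun E => Complex.exp (Complex.I * (E : ℂ))) =
        directSumOp (fun _ : Fin M =>
          mulOp circleMeasure (fun k => Complex.exp (Complex.I * (k : ℂ)))) := by
  have : NeZero M := ⟨hM⟩
  have hM' : (M : ℝ) ≠ 0 := by exact_mod_cast hM
  have hM2 : (M : ℂ) ≠ 0 := by exact_mod_cast hM
  have hne : ∀ j, α j ≠ β j := by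
    intro j hj
    have h1 := hab j
    rw [hj, sub_self, abs_zero] at h1
    exact (by positivity : (2 * π * M : ℝ) ≠ 0) h1.symm
  have hcont : Continuous fun E : ℝ => Complex.exp (Complex.I * (E : ℂ)) := by fun_prop
  have hs := fun j => isScaledLebesgue_interval (hne j)
  have hc := isScaledLebesgue_circle
  choose r b₀ hb₀ hb₀' using fun j => (hs j).exists_fourier_basis Measure.AbsolutelyContinuous.rfl
  obtain ⟨r', c₀, hc₀, hc₀'⟩ := hc.exists_fourier_basis circleMeasure_ac
  obtain ⟨b₁, hb₁⟩ := exists_directSum_basis b₀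
  obtain ⟨c, hcc⟩ := exists_directSum_basis fun _ : Fin M => c₀
  -- the exponential of index `l M + j` corresponds to the `l`-th one of the `j`-th summand
  let e : ℤ × Fin M ≃ ℤ × Fin 1 := (Int.divModEquiv M).symm.trans (Equiv.prodUnique ℤ (Fin 1)).symm
  obtain ⟨b, hb⟩ := exists_reindex_basis b₁ e
  have hb2 : ∀ i : ℤ × Fin M, b i = WithLp.toLp 2 (Pi.single 0 (b₀ 0 (i.1 * M + (i.2 : ℕ)))) :=
    fun i => by rw [hb, hb₁]; rfl
  refine ⟨basisEquiv b c, ?_, ?_⟩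
  · refine conjOp_basisEquiv (ev := fun i => i.1 + (i.2 : ℕ) / (M : ℝ)) ?_ ?_ b c ?_ ?_
    · exact isSelfAdjoint_directSumOp fun j =>
        IsVolterra.isSelfAdjoint_periodic ((hs j).mem_periodic_graph_iff _) (hs j).isVolterra
    · refine isSelfAdjoint_directSumOp fun j => ?_
      have h1 := isSelfAdjoint_vadd (A := P) (IsVolterra.isSelfAdjoint_periodic
        (hc.mem_periodic_graph_iff circleMeasure_ac) hc.isVolterra) ((j : ℕ) / (M : ℝ))
      push_cast at h1
      exact h1
    · intro i
      have h1 := single_mem_directSumOp_graph (A := fun j : Fin 1 => PPeriodic (α j) (β j)) (j := 0)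
        (hb₀' 0 (i.1 * M + (i.2 : ℕ)))
      rw [hb2]
      convert h1 using 2
      rw [← WithLp.toLp_smul, ← Pi.single_smul]
      congr 3
      rw [hab]
      push_cast
      have : (π : ℂ) ≠ 0 := by exact_mod_cast Real.pi_ne_zero
      field_simp
    · intro i
      rw [hcc]
      have h1 : (c₀ i.1, (i.1 + ((i.2 : ℕ) : ℂ) / (M : ℂ)) • c₀ i.1) ∈
          ((((i.2 : ℕ) : ℂ) / (M : ℂ)) • (LinearMap.id : K1 →ₗ[ℂ] K1) +ᵥ P).graph := by
        rw [mem_vadd_graph, ← sub_smul, add_sub_cancel_right]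
        have h2 := hc₀' i.1
        rw [sub_zero, abs_of_pos Real.two_pi_pos, mul_div_cancel_left₀ _ Real.two_pi_pos.ne',
          Complex.ofReal_intCast] at h2
        exact h2
      have h2 := single_mem_directSumOp_graph (A := fun j : Fin M =>
        (((j : ℕ) : ℂ) / (M : ℂ)) • (LinearMap.id : K1 →ₗ[ℂ] K1) +ᵥ P) h1
      convert h2 using 2
      rw [← WithLp.toLp_smul, ← Pi.single_smul]
      push_cast
      rfl
  · refine conjOp_basisEquiv_of_isometric
      (exists_mem_directSum_mulOp_graph (μ := fun j : Fin 1 => volume.restrict (uIcc (α j) (β j)))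
        hcont norm_exp_I_mul)
      (exists_mem_directSum_mulOp_graph (μ := fun _ : Fin M => circleMeasure) hcont norm_exp_I_mul)
      (inner_directSum_mulOp (μ := fun j : Fin 1 => volume.restrict (uIcc (α j) (β j)))
        (φ := fun E => Complex.exp (Complex.I * (E : ℂ))) norm_exp_I_mul)
      (inner_directSum_mulOp (μ := fun _ : Fin M => circleMeasure)
        (φ := fun E => Complex.exp (Complex.I * (E : ℂ))) norm_exp_I_mul) b c
      (fun i => (i.1 + 1, i.2)) (fun i => ⟨(i.1 - 1, i.2), by simp⟩) ?_ ?_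
    · intro i
      rw [hb2, hb2]
      refine single_mem_directSumOp_graph (A := fun j : Fin 1 =>
        mulOp (volume.restrict (uIcc (α j) (β j))) fun E => Complex.exp (Complex.I * (E : ℂ))) ?_
      rw [mem_mulOp_graph]
      filter_upwards [hb₀ 0 (i.1 * M + (i.2 : ℕ)), hb₀ 0 ((i.1 + 1) * M + (i.2 : ℕ))] with x h1 h2
      rw [h1, h2, mul_left_comm, ← Complex.exp_add, hab]
      congr 2
      push_cast
      have : (π : ℂ) ≠ 0 := by exact_mod_cast Real.pi_ne_zero
      field_simp
      ring
    · intro i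
      rw [hcc, hcc]
      refine single_mem_directSumOp_graph (A := fun _ : Fin M =>
        mulOp circleMeasure fun k => Complex.exp (Complex.I * (k : ℂ))) ?_
      rw [mem_mulOp_graph]
      filter_upwards [hc₀ i.1, hc₀ (i.1 + 1)] with x h1 h2
      rw [h1, h2, mul_left_comm, ← Complex.exp_add, sub_zero, abs_of_pos Real.two_pi_pos]
      congr 2
      push_cast
      have : (π : ℂ) ≠ 0 := by exact_mod_cast Real.pi_ne_zero
      field_simp
      ring


/-! ### The partition by critical points -/

section

variable {lam : ℝ → ℂ} {m : ℤ} {θ : ℝ → ℝ}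

theorem phasePartition_criticalPoints (hwind : HasWinding lam m θ) (hlam : ContDiff ℝ 2 lam)
    {n : ℕ} {a : Fin (n + 1) → ℝ} (ha : StrictMono a)
    (hrange : range (fun j : Fin n => a j.castSucc) = criticalPoints lam)
    (hlast : a (Fin.last n) = 2 * π + a 0) :
    PhasePartition (phase m θ) a ∧ ∀ i, deriv (phase m θ) (a i) = 0 := by
  have hper := hwind.periodic_deriv_phase hlam
  have hcrit : ∀ j : Fin n, a j.castSucc ∈ criticalPoints lam := fun j =>
    hrange ▸ mem_range_self j
  have hmem : ∀ k ∈ Ico 0 (2 * π), deriv (phase m θ) k = 0 → ∃ i : Fin n, a i.castSucc = k :=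
    fun k hk hk0 => by
      have : k ∈ criticalPoints lam := ⟨hk, (hwind.deriv_eq hlam k).2 hk0⟩
      rwa [← hrange] at this
  refine ⟨⟨hwind.contDiff_phase hlam, hper, ha, by rw [hlast, add_comm], fun j k hk hk0 => ?_⟩,
    fun i => ?_⟩
  · have hj := (hcrit j).1
    rcases lt_or_ge k (2 * π) with h | h
    · obtain ⟨i, rfl⟩ := hmem k ⟨hj.1.trans hk.1.le, h⟩ hk0
      have h1 := ha.lt_iff_lt.1 hk.1
      have h2 := ha.lt_iff_lt.1 hk.2
      rw [Fin.lt_def] at h1 h2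
      simp only [Fin.val_castSucc, Fin.val_succ] at h1 h2
      omega
    -- a critical point beyond `2π` would, moved back by a period, lie below the smallest one
    · have h1 : k < 2 * π + a 0 := hk.2.trans_le (hlast ▸ ha.monotone (Fin.le_last _))
      have h2 := hper (k - 2 * π)
      rw [sub_add_cancel, hk0] at h2
      have h3 : a 0 ≤ a j.castSucc := ha.monotone (Fin.zero_le _)
      obtain ⟨i, hi⟩ := hmem (k - 2 * π) ⟨by linarith, by linarith [hj.2]⟩ h2.symm
      have h4 : a 0 ≤ a i.castSucc := ha.monotone (Fin.zero_le _)
      linarith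
  · have h1 : ∀ j : Fin n, deriv (phase m θ) (a j.castSucc) = 0 := fun j =>
      (hwind.deriv_eq hlam _).1 (hcrit j).2
    induction i using Fin.lastCases with
    | cast j => exact h1 j
    | last =>
      rw [hlast, add_comm, hper]
      rcases Nat.eq_zero_or_pos n with rfl | hn
      · exact absurd hlast (by
          rw [Fin.last_zero]
          linarith [Real.pi_pos])
      · exact h1 ⟨0, hn⟩

theorem exists_criticalPoints_enumeration (hfin : (criticalPoints lam).Finite)
    (hne : (criticalPoints lam).Nonempty) :
    ∃ a : Fin ((criticalPoints lam).ncard + 1) → ℝ, StrictMono a ∧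
      range (fun j : Fin (criticalPoints lam).ncard => a j.castSucc) = criticalPoints lam ∧
      a (Fin.last _) = 2 * π + a 0 := by
  obtain ⟨N, hN⟩ := Nat.exists_eq_succ_of_ne_zero ((ncard_pos hfin).2 hne).ne'
  rw [hN]
  have hcard : hfin.toFinset.card = N + 1 := by rw [← ncard_eq_toFinset_card _ hfin, hN]
  let e := hfin.toFinset.orderEmbOfFin hcard
  have he : ∀ i, e i ∈ criticalPoints lam := fun i =>
    hfin.mem_toFinset.1 (Finset.orderEmbOfFin_mem _ hcard i)
  refine ⟨Fin.snoc (α := fun _ => ℝ) e (2 * π + e 0), ?_, ?_, ?_⟩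
  · rw [Fin.strictMono_iff_lt_succ]
    intro i
    rw [Fin.snoc_castSucc]
    induction i using Fin.lastCases with
    | cast j =>
      rw [Fin.succ_castSucc, Fin.snoc_castSucc]
      exact e.strictMono Fin.castSucc_lt_succ
    | last =>
      rw [Fin.succ_last, Fin.snoc_last]
      linarith [(he (Fin.last N)).1.2, (he 0).1.1]
  · simp only [Fin.snoc_castSucc]
    rw [Finset.range_orderEmbOfFin, hfin.coe_toFinset]
  · rw [Fin.snoc_last, show (0 : Fin (N + 1 + 1)) = Fin.castSucc (0 : Fin (N + 1)) from rfl,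
      Fin.snoc_castSucc]

theorem phasePartition_zero_two_pi (hwind : HasWinding lam m θ) (hlam : ContDiff ℝ 2 lam)
    (h0 : ∀ k, deriv (phase m θ) k ≠ 0) :
    PhasePartition (phase m θ) (![0, 2 * π] : Fin (1 + 1) → ℝ) where
  contDiff := hwind.contDiff_phase hlam
  periodic := hwind.periodic_deriv_phase hlam
  strictMono := by
    rw [Fin.strictMono_iff_lt_succ]
    intro i
    rw [Subsingleton.elim i 0]
    simpa using Real.pi_pos
  last := by simp
  deriv_ne_zero _ k _ := h0 k

theorem deriv_ne_zero_of_criticalPoints_eq_empty (hper : Function.Periodic lam (2 * π))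
    (h : criticalPoints lam = ∅) (k : ℝ) : deriv lam k ≠ 0 := by
  intro hk
  obtain ⟨y, hy, hky⟩ := (periodic_deriv hper).exists_mem_Ico₀ Real.two_pi_pos k
  have : y ∈ criticalPoints lam := ⟨hy, hky ▸ hk⟩
  rw [h] at this
  exact this

/-- The case of no critical points: the spectral representation of `T` and of `lam`. -/
theorem exists_unitary_of_deriv_ne_zero (hwind : HasWinding lam m θ) (hlam : ContDiff ℝ 2 lam)
    (hper : Function.Periodic lam (2 * π)) (h0 : ∀ k, deriv (phase m θ) k ≠ 0) :
    m ≠ 0 ∧ IsSelfAdjoint (timeOp m θ) ∧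
      ∃ V : K1 ≃ₗᵢ[ℂ] PiLp 2 (fun _ : Fin m.natAbs => K1),
        conjOp V (timeOp m θ) = directSumOp (fun j : Fin m.natAbs =>
          (((j : ℕ) : ℂ) / (m.natAbs : ℂ)) • (LinearMap.id : K1 →ₗ[ℂ] K1) +ᵥ P) ∧
        conjOp V (mulOp circleMeasure lam) = directSumOp (fun _ : Fin m.natAbs =>
          mulOp circleMeasure (fun k => Complex.exp (Complex.I * (k : ℂ)))) := by
  have hp := phasePartition_zero_two_pi hwind hlam h0
  have hT : timeOp m θ = hp.periodicOp := by
    rw [timeOp_eq hwind hlam, hp.timeOpOf_eq_periodicOp h0]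
  -- over one period the phase changes by `2π m`
  have hlen : ∀ j : Fin 1, |phase m θ ((![0, 2 * π] : Fin (1 + 1) → ℝ) j.succ) -
      phase m θ ((![0, 2 * π] : Fin (1 + 1) → ℝ) j.castSucc)| = 2 * π * m.natAbs := by
    intro j
    rw [Subsingleton.elim j 0]
    have h1 := phase_add_two_pi hwind 0
    rw [zero_add] at h1
    simp only [Fin.succ_zero_eq_one, Fin.castSucc_zero, Matrix.cons_val_one, Matrix.cons_val_zero,
      Matrix.cons_val_fin_one]
    rw [h1, add_sub_cancel_left, abs_mul, abs_of_pos Real.two_pi_pos, Nat.cast_natAbs,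
      Int.cast_abs]
  have hm : m ≠ 0 := by
    rintro rfl
    have h1 := hlen 0
    rw [Int.natAbs_zero, Nat.cast_zero, mul_zero, abs_eq_zero, sub_eq_zero] at h1
    exact hp.ne 0 h1.symm
  refine ⟨hm, hT ▸ hp.isSelfAdjoint_periodicOp, ?_⟩
  obtain ⟨V, hV1, hV2⟩ := exists_unitary_periodic (Int.natAbs_ne_zero.2 hm) hlen
  refine ⟨hp.unitary.symm.trans V, ?_, ?_⟩
  · rw [conjOp_trans, hT, PhasePartition.periodicOp, conjOp_symm_conjOp]
    exact hV1
  · rw [conjOp_trans, hp.mulOp_eq_conjOp hper hwind.2.2, conjOp_symm_conjOp]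
    exact hV2

end

end TimeOp

end

theorem mainTheorem1 (lam : ℝ → ℂ) (hlam_unit : ∀ k, ‖lam k‖ = 1)
    (hlam_smooth : ContDiff ℝ 2 lam) (hlam_per : Function.Periodic lam (2 * π))
    (hlam_fin : (criticalPoints lam).Finite)
    (m : ℤ) (θ : ℝ → ℝ) (hwind : HasWinding lam m θ) :
    IsSymmetricOp (timeOp m θ) ∧
    -- `lam'` has no zeros
    ((∀ k, deriv lam k ≠ 0) →
      m ≠ 0 ∧ IsSelfAdjoint (timeOp m θ) ∧
      ∃ V : K1 ≃ₗᵢ[ℂ] PiLp 2 (fun _ : Fin m.natAbs => K1),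
        conjOp V (timeOp m θ) = directSumOp (fun j : Fin m.natAbs =>
          (((j : ℕ) : ℂ) / (m.natAbs : ℂ)) • (LinearMap.id : K1 →ₗ[ℂ] K1) +ᵥ P) ∧
        conjOp V (mulOp circleMeasure lam) = directSumOp (fun _ : Fin m.natAbs =>
          mulOp circleMeasure (fun k => Complex.exp (Complex.I * (k : ℂ))))) ∧
    -- `lam'` has a zero: `a 0 < ⋯ < a (n - 1)` are the zeros of `lam'` in `[0, 2π)` and `a n = 2π + a 0`
    (∀ (n : ℕ) (a : Fin (n + 1) → ℝ), StrictMono a →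
      Set.range (fun j : Fin n => a j.castSucc) = criticalPoints lam →
      a (Fin.last n) = 2 * π + a 0 →
      (∀ j : Fin n, phase m θ '' Set.Icc (a j.castSucc) (a j.succ) =
        Set.uIcc (phase m θ (a j.castSucc)) (phase m θ (a j.succ))) ∧
      ∃ V : K1 ≃ₗᵢ[ℂ] PiLp 2 (fun j : Fin n =>
          L2Interval (phase m θ (a j.castSucc)) (phase m θ (a j.succ))),
        conjOp V (timeOp m θ).closure = directSumOp (fun j : Fin n =>
          PInterval (phase m θ (a j.castSucc)) (phase m θ (a j.succ))) ∧
        conjOp V (mulOp circleMeasure lam) = directSumOp (fun j : Fin n =>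
          mulOp (volume.restrict
              (Set.uIcc (phase m θ (a j.castSucc)) (phase m θ (a j.succ))))
            (fun E => Complex.exp (Complex.I * (E : ℂ))))) ∧
    -- deficiency indices and a self-adjoint extension
    (deficiencyIndexPlus (timeOp m θ) = (criticalPoints lam).ncard ∧
      deficiencyIndexMinus (timeOp m θ) = (criticalPoints lam).ncard ∧
      ∃ S : K1 →ₗ.[ℂ] K1, timeOp m θ ≤ S ∧ IsSelfAdjoint S) := by
  have hdef : ∀ z, defectNumber (timeOp m θ) z = defectNumber (timeOpOf (deriv (phase m θ))) z :=
    fun z => by rw [timeOp_eq hwind hlam_smooth]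
  refine ⟨?_, fun h0 => ?_, fun n a ha hrange hlast => ?_, ?_⟩
  · rcases (criticalPoints lam).eq_empty_or_nonempty with hemp | hne
    · have h0 := deriv_ne_zero_of_criticalPoints_eq_empty hlam_per hemp
      have hT := (exists_unitary_of_deriv_ne_zero hwind hlam_smooth hlam_per fun k hk =>
        h0 k ((hwind.deriv_eq hlam_smooth k).2 hk)).2.1
      exact isSymmetricOp_of_graph hT.dense_domain fun u v x y => inner_eq_of_isSelfAdjoint hT
    · obtain ⟨a, ha, hrange, hlast⟩ := exists_criticalPoints_enumeration hlam_fin hne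
      obtain ⟨hp, hz⟩ := phasePartition_criticalPoints hwind hlam_smooth ha hrange hlast
      rw [timeOp_eq hwind hlam_smooth]
      exact hp.isSymmetricOp_timeOpOf hz
  · exact exists_unitary_of_deriv_ne_zero hwind hlam_smooth hlam_per fun k hk =>
      h0 k ((hwind.deriv_eq hlam_smooth k).2 hk)
  · obtain ⟨hp, hz⟩ := phasePartition_criticalPoints hwind hlam_smooth ha hrange hlast
    refine ⟨fun j => (hp.strictMonoOrAnti j).image_Icc hp.contDiff.continuous (hp.lt j).le,
      hp.unitary.symm, ?_, ?_⟩
    · rw [timeOp_eq hwind hlam_smooth, hp.closure_timeOpOf hz, PhasePartition.minimalOp,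
        conjOp_symm_conjOp]
    · rw [hp.mulOp_eq_conjOp hlam_per hwind.2.2, conjOp_symm_conjOp]
  · rcases (criticalPoints lam).eq_empty_or_nonempty with hemp | hne
    · have h0 := deriv_ne_zero_of_criticalPoints_eq_empty hlam_per hemp
      have hT := (exists_unitary_of_deriv_ne_zero hwind hlam_smooth hlam_per fun k hk =>
        h0 k ((hwind.deriv_eq hlam_smooth k).2 hk)).2.1
      rw [hemp, ncard_empty, Nat.cast_zero]
      exact ⟨defectNumber_of_isSelfAdjoint hT (Or.inl rfl),
        defectNumber_of_isSelfAdjoint hT (Or.inr rfl), _, le_rfl, hT⟩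
    · obtain ⟨a, ha, hrange, hlast⟩ := exists_criticalPoints_enumeration hlam_fin hne
      obtain ⟨hp, hz⟩ := phasePartition_criticalPoints hwind hlam_smooth ha hrange hlast
      refine ⟨(hdef _).trans (hp.defectNumber_timeOpOf hz (Or.inl rfl)),
        (hdef _).trans (hp.defectNumber_timeOpOf hz (Or.inr rfl)), hp.periodicOp, ?_,
        hp.isSelfAdjoint_periodicOp⟩
      rw [timeOp_eq hwind hlam_smooth]
      exact (hp.timeOpOf_le_minimalOp hz).trans hp.minimalOp_le_periodicOp
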